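/- Let $\langle\cdot,\cdot\rangle$ and $\|\cdot\|$ be the inner product and norm of $\mathbb{R}^d$, $\mathbb{S}^{d-1}$ its unit sphere, $\mathbb{R}^*=\mathbb{R}\setminus\{0\}$ and $\mathcal{I}_j=(2^{-j},2^{-j+1}]$ for $j\ge 1$. Let $\nu$ be an admissible measure, that is, a Borel measure on $\mathbb{S}^{d-1}\times\mathbb{R}^*$ that is invariant under $(s,x)\mapsto(-s,-x)$ and satisfies $$\int (1\wedge x^2)\,\nu(\mathrm{d}s,\mathrm{d}x)<\infty \qquad\text{and}\qquad \sum_{j=1}^{\infty}2^{-j}(j\nu_j)^{1/2}<\infty,\quad\text{where } \nu_j=\nu(\mathbb{S}^{d-1}\times\mathcal{I}_j).$$ Let $N$ be a Poisson random measure on $(0,\infty)\times\mathbb{S}^{d-1}\times\mathbb{R}^*$ with intensity $\mathrm{d}\rho\otimes\nu(\mathrm{d}s,\mathrm{d}x)$. For $t\in\mathbb{R}^d$ let $V_t=\{(\rho,s)\mid \rho<\langle s,t\rangle\}$ and $$L_{\nu,0}(t)=\int_{(\rho,s)\in V_t,\ |x|>1}x\,N(\mathrm{d}\rho,\mathrm{d}s,\mathrm{d}x),$$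 $$L_{\nu,j}(t)=\int_{(\rho,s)\in V_t,\ |x|\in\mathcal{I}_j}x\,N(\mathrm{d}\rho,\mathrm{d}s,\mathrm{d}x)-\int_{(\rho,s)\in V_t,\ |x|\in\mathcal{I}_j}x\,\mathrm{d}\rho\,\nu(\mathrm{d}s,\mathrm{d}x)\qquad(j\ge 1),$$ and $L_\nu(t)=\sum_{j=0}^{\infty}L_{\nu,j}(t)$. Let $J_\nu$ be the set of all $t\in\mathbb{R}^d$ that lie on a jump hyperplane, i.e. such that $N(\{(\rho,s,x)\mid\rho=\langle s,t\rangle\})\ge 1$. For $\alpha>0$ let $$K_\nu(\alpha)=\bigl\{t\in\mathbb{R}^d \bigm| N(\{(\rho,s,x)\mid |x|\le 1,\ |\rho-\langle s,t\rangle|<|x|^{1/\alpha}\})=\infty\bigr\},$$ and let $\mathrm{A}_\nu(t)=\inf\{\alpha>0\mid t\in K_\nu(\alpha)\}\in[0,\infty]$, with $\inf\emptyset=\infty$. For a locally bounded $f:\mathbb{R}^d\to\mathbb{R}$ and $\alpha>0$, write $f\in C^\alpha(t_0)$ if there are $C>0$ and a polynomial $Q$ of degree less than $\alpha$ such that $|f(t)-Q(t)|\le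 C\|t-t_0\|^\alpha$ for all $t$ in a neighbourhood of $t_0$. The Hölder exponent of $f$ at $t_0$ is $\alpha_f(t_0)=\sup\{\alpha>0\mid f\in C^\alpha(t_0)\}\in[0,\infty]$, with $\sup\emptyset=0$. Then, with probability one, the series defining $L_\nu(t)$ converges for every $t\in\mathbb{R}^d$, the function $L_\nu$ is locally bounded, and for every $t\in\mathbb{R}^d$, $$\alpha_{L_\nu}(t)=\begin{cases}0&\text{if }t\in J_\nu,\\ \mathrm{A}_\nu(t)&\text{otherwise.}\end{cases}$$ -/

import Mathlib

open MeasureTheory ProbabilityTheory Filter Topology Set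
open scoped ENNReal NNReal

noncomputable section

namespace LevyField

/-- The Euclidean space `ℝ^d`. -/
abbrev Space (d : ℕ) : Type := EuclideanSpace ℝ (Fin d)

/-- The unit sphere `𝕊^{d-1}` of `ℝ^d`. -/
abbrev UnitSphere (d : ℕ) : Type := Metric.sphere (0 : Space d) 1

/-- The set `ℝ^* = ℝ \ {0}` of possible jump sizes. -/
abbrev NonzeroReal : Type := {x : ℝ // x ≠ 0}

/-- The space `𝕊^{d-1} × ℝ^*` that carries the Lévy measure. -/
abbrev MarkSpace (d : ℕ) : Type := UnitSphere d × NonzeroReal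

/-- The space `(0,∞) × 𝕊^{d-1} × ℝ^*`. A point `(ρ, s, x)` encodes a jump of size `x` across the
hyperplane `{t | ρ = ⟨s, t⟩}`. -/
abbrev AtomSpace (d : ℕ) : Type := Ioi (0 : ℝ) × MarkSpace d

variable {d : ℕ}

/-- The coordinate `ρ` of `(ρ, s, x)`. -/
def dist0 (p : AtomSpace d) : ℝ := (p.1 : ℝ)

/-- The coordinate `s` of `(ρ, s, x)`, as a vector of `ℝ^d`. -/
def normal (p : AtomSpace d) : Space d := (p.2.1 : Space d)

/-- The coordinate `x` of `(ρ, s, x)`. -/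
def jump (p : AtomSpace d) : ℝ := (p.2.2 : ℝ)

/-- The map `(s, x) ↦ (-s, -x)` of `𝕊^{d-1} × ℝ^*`. -/
def reflect (q : MarkSpace d) : MarkSpace d := (-q.1, ⟨-(q.2 : ℝ), neg_ne_zero.mpr q.2.2⟩)

/-- The dyadic interval `(2^{-j}, 2^{-j+1}]`. -/
def band (j : ℕ) : Set ℝ := Ioc ((2 : ℝ) ^ (-(j : ℤ))) ((2 : ℝ) ^ (-(j : ℤ) + 1))

/-- `ν_j = ν (𝕊^{d-1} × (2^{-j}, 2^{-j+1}])`. -/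
def bandMass (ν : Measure (MarkSpace d)) (j : ℕ) : ℝ≥0∞ := ν {q | (q.2 : ℝ) ∈ band j}

/-- `χ_ν = ∑_{j ≥ 1} 2^{-j} (j ν_j)^{1/2}`. -/
def chi (ν : Measure (MarkSpace d)) : ℝ≥0∞ :=
  ∑' j : ℕ, (2 : ℝ≥0∞) ^ (-((j + 1 : ℕ) : ℤ)) *
    (((j + 1 : ℕ) : ℝ≥0∞) * bandMass ν (j + 1)) ^ (1 / 2 : ℝ)

/-- Admissible measures on `𝕊^{d-1} × ℝ^*`: invariant under `(s, x) ↦ (-s, -x)`, with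
`∫ (1 ∧ x²) ν(ds, dx) < ∞` and `χ_ν < ∞`. -/
structure IsAdmissible (ν : Measure (MarkSpace d)) : Prop where
  symmetric : ν.map reflect = ν
  levy : ∫⁻ q, ENNReal.ofReal (min 1 ((q.2 : ℝ) ^ 2)) ∂ν < ∞
  chi_lt_top : chi ν < ∞

/-- `N` is a Poisson random measure with intensity `m`, on the probability space `(Ω, P)`: almost
surely a sum of countably many unit point masses; the number of points in a measurable set `B` is
Poisson distributed with mean `m B` (almost surely infinite if `m B = ∞`); the numbers of points in
disjoint measurable sets are independent. -/
structure IsPoissonRandomMeasure {Ω X : Type*} [MeasurableSpace Ω] [MeasurableSpace X]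
    (P : Measure Ω) (m : Measure X) (N : Ω → Measure X) : Prop where
  measurable : Measurable N
  pointMeasure : ∀ᵐ ω ∂P, ∃ (I : Set ℕ) (a : I → X), N ω = Measure.sum fun n => Measure.dirac (a n)
  law_of_lt_top : ∀ B : Set X, MeasurableSet B → m B < ∞ →
    P.map (fun ω => N ω B) = (poissonMeasure (m B).toNNReal).map (fun k : ℕ => (k : ℝ≥0∞))
  eq_top : ∀ B : Set X, MeasurableSet B → m B = ∞ → ∀ᵐ ω ∂P, N ω B = ∞
  indep : ∀ (n : ℕ) (B : Fin n → Set X), (∀ i, MeasurableSet (B i)) →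
    Pairwise (fun i j => Disjoint (B i) (B j)) → iIndepFun (fun i ω => N ω (B i)) P

/-- The intensity `dρ ⊗ ν(ds, dx)` on `(0,∞) × 𝕊^{d-1} × ℝ^*`. -/
def intensity (ν : Measure (MarkSpace d)) : Measure (AtomSpace d) :=
  (Measure.comap ((↑) : Ioi (0 : ℝ) → ℝ) volume).prod ν

/-- The points `(ρ, s, x)` such that `ρ < ⟨s, t⟩`, that is, whose hyperplane separates `t` from the
origin. -/
def separating (t : Space d) : Set (AtomSpace d) := {p | dist0 p < inner ℝ (normal p) t}

/-- The summand `L_{ν,j}(t)` computed from the point measure `n`: for `j = 0`, the sum of the jumps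
of magnitude more than one; for `j ≥ 1`, the compensated sum of the jumps with magnitude in
`(2^{-j}, 2^{-j+1}]`. -/
def layer (ν : Measure (MarkSpace d)) (n : Measure (AtomSpace d)) : ℕ → Space d → ℝ
  | 0, t => ∫ p in separating t ∩ {p | 1 < |jump p|}, jump p ∂n
  | j + 1, t => (∫ p in separating t ∩ {p | |jump p| ∈ band (j + 1)}, jump p ∂n) -
      ∫ p in separating t ∩ {p | |jump p| ∈ band (j + 1)}, jump p ∂(intensity ν)

/-- The partial sum `∑_{j < k} L_{ν,j}(t)`. -/
def partialField (ν : Measure (MarkSpace d)) (n : Measure (AtomSpace d)) (k : ℕ) (t : Space d) :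
    ℝ :=
  ∑ j ∈ Finset.range k, layer ν n j t

/-- The sample path `L_ν(t) = ∑_{j ≥ 0} L_{ν,j}(t)`, as the limit of the partial sums. -/
def field (ν : Measure (MarkSpace d)) (n : Measure (AtomSpace d)) (t : Space d) : ℝ :=
  limUnder atTop (fun k => partialField ν n k t)

/-- The set `J_ν` of the points that lie on a jump hyperplane. -/
def jumpSet (n : Measure (AtomSpace d)) : Set (Space d) :=
  {t | 1 ≤ n {p | dist0 p = inner ℝ (normal p) t}}

/-- The set `K_ν(α)` of the points `t` such that `|ρ - ⟨s, t⟩| < |x|^{1/α}` for infinitely many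
atoms `(ρ, s, x)` with `|x| ≤ 1`. -/
def approxSet (n : Measure (AtomSpace d)) (α : ℝ) : Set (Space d) :=
  {t | n {p | |jump p| ≤ 1 ∧ |dist0 p - inner ℝ (normal p) t| < |jump p| ^ (1 / α)} = ∞}

/-- `A_ν(t) = inf {α > 0 | t ∈ K_ν(α)} ∈ [0,∞]`, with `inf ∅ = ∞`. -/
def approxRate (n : Measure (AtomSpace d)) (t : Space d) : ℝ≥0∞ :=
  ⨅ (α : ℝ) (_ : 0 < α ∧ t ∈ approxSet n α), ENNReal.ofReal α

/-- `f` is bounded near every point. -/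
def IsLocallyBounded (f : Space d → ℝ) : Prop :=
  ∀ t₀, ∃ M : ℝ, ∀ᶠ t in 𝓝 t₀, |f t| ≤ M

/-- `f ∈ C^α(t₀)`. -/
def IsPointwiseHolder (f : Space d → ℝ) (α : ℝ) (t₀ : Space d) : Prop :=
  ∃ C : ℝ, 0 < C ∧ ∃ Q : MvPolynomial (Fin d) ℝ, (Q.totalDegree : ℝ) < α ∧
    ∀ᶠ t in 𝓝 t₀, |f t - MvPolynomial.eval (fun i => t i) Q| ≤ C * ‖t - t₀‖ ^ α

/-- The Hölder exponent of `f` at `t₀`, in `[0,∞]`; it is `0` if `f` is in no class `C^α(t₀)`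
with `α > 0`. -/
def holderExponent (f : Space d → ℝ) (t₀ : Space d) : ℝ≥0∞ :=
  ⨆ (α : ℝ) (_ : 0 < α ∧ IsPointwiseHolder f α t₀), ENNReal.ofReal α

end LevyField

end

/-! The two inequalities between the Hölder exponent and `approxRate` have separate sources. All the
randomness is collected in `IsRegularSample`, which holds almost surely by `ae_isRegularSample`;
what follows it is deterministic.

Upper bound. The atoms have pairwise distinct `ρ` (`ae_exists_atoms`), so a Baire argument finds,
near every point of a jump hyperplane, points that lie on this hyperplane and on no other
(`exists_generic_point`). Across such a point the field jumps by exactly `x` (`tendsto_field_sub`),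
whereas a polynomial is continuous. Hence a Hölder condition of order `β` at `t` forces `|x| ≤ C
r^β` for every atom whose hyperplane is within `r` of `t`, for small `r`
(`IsPointwiseHolder.exists_jump_le`). On the jump set let `r → 0`; if `t ∈ K_ν(α)`, apply it along
atoms with `x → 0` and distance below `|x|^{1/α}` (`le_of_mem_approxSet`).

Lower bound. Let `t` be outside `J_ν` and `K_ν(α)`, and let `r = ‖u - t‖` be small. No jump larger
than `r^α` separates `u` from `t` (`exists_radius_separated`), so the coarse bands, those with
`2^{-(j+1)/α} ≥ r`, vary only through their compensators, which are linear because `ν` is symmetric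
(`setIntegral_intensity_eq_inner`). The fine bands obey the locally uniform bound `2^{-j} (√((j+1)
ν_{j+1} r) + j + 1)` of `ae_increment`. That bound comes from Chernoff estimates at pairs of points
of the lattice `4^{-j} ℤ^d`, Borel–Cantelli, and interpolation; `χ_ν < ∞` makes the mesh fine
enough, and also makes the series converge.

For exponents `β < 1/2`, summing these bounds needs only `χ_ν < ∞` (`termwise_small`). For `β ≥ 1/2`
a covering argument supplies more: if `ν_{j+1}` exceeded a multiple of `(j+1) 2^{(j+1)/α}` for
infinitely many `j`, the strips of width `2^{-(j+1)/α}` around the hyperplanes would cover every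
ball infinitely often, and no point would avoid `K_ν(α)` (`ae_covering`). With this growth bound the
layers sum to `O(r^β)` (`termwise_large`), for `β > 1` after subtraction of the compensators, whose
slopes are then summable. A polynomial of degree at most one therefore always suffices. -/

noncomputable section

namespace LevyField

/-! ### Laws and exponential moments of Poisson counts. -/

section Poisson

lemma tsum_le_tsum_of_shift_two {f g : ℕ → ℝ≥0∞} (h0 : f 0 = 0) (h1 : f 1 = 0)
    (h : ∀ k, f (k + 2) ≤ g k) : ∑' k, f k ≤ ∑' k, g k := by
  have e : ∑' k, f k = f 0 + ∑' k, f (k + 1) := tsum_eq_zero_add' ENNReal.summable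
  have e' : ∑' k, f (k + 1) = f (0 + 1) + ∑' k, f (k + 1 + 1) :=
    tsum_eq_zero_add' (f := fun k => f (k + 1)) ENNReal.summable
  rw [e, e', h0, zero_add, zero_add, h1, zero_add]
  exact ENNReal.tsum_le_tsum h

namespace IsPoissonRandomMeasure

variable {Ω X : Type*} [MeasurableSpace Ω] [MeasurableSpace X] {P : Measure Ω}
  {m : Measure X} {N : Ω → Measure X}

lemma measurable_apply (hN : IsPoissonRandomMeasure P m N) {B : Set X} (hB : MeasurableSet B) :
    Measurable fun ω => N ω B :=
  (Measure.measurable_coe hB).comp hN.measurable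

lemma lintegral_count (hN : IsPoissonRandomMeasure P m N) {B : Set X} (hB : MeasurableSet B)
    (hm : m B < ∞) {g : ℝ≥0∞ → ℝ≥0∞} (hg : Measurable g) :
    ∫⁻ ω, g (N ω B) ∂P = ∑' k : ℕ, g k *
      ENNReal.ofReal (Real.exp (-(m B).toReal) * (m B).toReal ^ k / k.factorial) := by
  have h1 : ∫⁻ ω, g (N ω B) ∂P = ∫⁻ x, g x ∂(P.map fun ω => N ω B) :=
    (lintegral_map hg (hN.measurable_apply hB)).symm
  rw [h1, hN.law_of_lt_top B hB hm, lintegral_map hg .of_discrete, lintegral_countable']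
  simp_rw [poissonMeasure_singleton]
  rfl

lemma ae_lt_top (hN : IsPoissonRandomMeasure P m N) {B : Set X} (hB : MeasurableSet B)
    (hm : m B < ∞) : ∀ᵐ ω ∂P, N ω B < ∞ := by
  have h : ∫⁻ ω, ({∞} : Set ℝ≥0∞).indicator 1 (N ω B) ∂P = 0 := by
    rw [hN.lintegral_count hB hm (measurable_one.indicator (measurableSet_singleton _))]
    simp
  have hmeas : Measurable fun ω => ({∞} : Set ℝ≥0∞).indicator (1 : ℝ≥0∞ → ℝ≥0∞) (N ω B) :=
    (measurable_one.indicator (measurableSet_singleton _)).comp (hN.measurable_apply hB)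
  filter_upwards [(lintegral_eq_zero_iff hmeas).1 h] with ω hω
  by_contra hc
  have : N ω B = ∞ := by simpa using hc
  simp [this] at hω

lemma lintegral_exp_count (hN : IsPoissonRandomMeasure P m N) {B : Set X} (hB : MeasurableSet B)
    (hm : m B < ∞) (c : ℝ) :
    ∫⁻ ω, ENNReal.ofReal (Real.exp (c * (N ω B).toReal)) ∂P =
      ENNReal.ofReal (Real.exp ((m B).toReal * (Real.exp c - 1))) := by
  rw [hN.lintegral_count hB hm (g := fun x => ENNReal.ofReal (Real.exp (c * x.toReal)))
    (by fun_prop)]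
  have key : HasSum (fun k : ℕ => Real.exp (c * k) *
      (Real.exp (-(m B).toReal) * (m B).toReal ^ k / k.factorial))
      (Real.exp ((m B).toReal * (Real.exp c - 1))) := by
    have h := (NormedSpace.expSeries_div_hasSum_exp ((m B).toReal * Real.exp c)).mul_left
      (Real.exp (-(m B).toReal))
    rw [← Real.exp_eq_exp_ℝ, ← Real.exp_add, show -(m B).toReal + (m B).toReal * Real.exp c =
      (m B).toReal * (Real.exp c - 1) by ring] at h
    refine (congrArg (fun f : ℕ → ℝ => HasSum f _) (funext fun k => ?_)).mpr h
    rw [mul_pow, ← Real.exp_nat_mul, mul_comm c]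
    ring
  rw [← key.tsum_eq, ENNReal.ofReal_tsum_of_nonneg (fun k => by positivity) key.summable]
  congr 1
  ext k
  rw [← ENNReal.ofReal_mul (by positivity), ENNReal.toReal_natCast]

lemma measure_count_eq_zero (hN : IsPoissonRandomMeasure P m N) {B : Set X}
    (hB : MeasurableSet B) (hm : m B < ∞) :
    P {ω | N ω B = 0} = ENNReal.ofReal (Real.exp (-(m B).toReal)) := by
  have h1 : P {ω | N ω B = 0} = ∫⁻ ω, ({0} : Set ℝ≥0∞).indicator 1 (N ω B) ∂P := by
    refine (lintegral_indicator_one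
      (hN.measurable_apply hB (measurableSet_singleton 0))).symm.trans ?_
    rfl
  rw [h1, hN.lintegral_count hB hm (measurable_one.indicator (measurableSet_singleton _)),
    tsum_eq_single 0]
  · simp
  · intro k hk
    simp [hk]

/-- Dropping the first two terms of the Poisson series and using `k! ≤ (k + 2)!` leaves `a²` times
the total mass. The quadratic order is what rules out coincidences of atoms in `ae_slab_lt_two`. -/
lemma measure_two_le_count (hN : IsPoissonRandomMeasure P m N) {B : Set X}
    (hB : MeasurableSet B) (hm : m B < ∞) :
    P {ω | 2 ≤ N ω B} ≤ (m B) ^ 2 := by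
  have h1 : P {ω | 2 ≤ N ω B} = ∫⁻ ω, (Ici 2 : Set ℝ≥0∞).indicator 1 (N ω B) ∂P := by
    rw [show {ω | 2 ≤ N ω B} = (fun ω => N ω B) ⁻¹' Ici 2 from rfl,
      ← lintegral_indicator_one (hN.measurable_apply hB measurableSet_Ici)]
    simp only [← indicator_comp_right, Function.comp_def, Pi.one_apply]
    rfl
  obtain ⟨a, ha⟩ : ∃ a, a = (m B).toReal := ⟨_, rfl⟩
  have ha0 : 0 ≤ a := ha ▸ ENNReal.toReal_nonneg
  have hma : (m B) ^ 2 = ENNReal.ofReal (a ^ 2) := by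
    rw [ENNReal.ofReal_pow ha0, ha, ENNReal.ofReal_toReal hm.ne]
  have key : HasSum (fun k : ℕ => a ^ 2 * (Real.exp (-a) * a ^ k / k.factorial)) (a ^ 2) := by
    have h := ((NormedSpace.expSeries_div_hasSum_exp a).mul_left (Real.exp (-a))).mul_left (a ^ 2)
    rw [← Real.exp_eq_exp_ℝ, ← Real.exp_add, neg_add_cancel, Real.exp_zero, mul_one] at h
    refine (congrArg (fun f : ℕ → ℝ => HasSum f _) (funext fun k => ?_)).mpr h
    ring
  have h0 : ((0 : ℕ) : ℝ≥0∞) ∉ Ici (2 : ℝ≥0∞) := by simp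
  have h0' : ((1 : ℕ) : ℝ≥0∞) ∉ Ici (2 : ℝ≥0∞) := by simp
  have h2 (k : ℕ) : ((k + 2 : ℕ) : ℝ≥0∞) ∈ Ici (2 : ℝ≥0∞) := by
    rw [mem_Ici]
    exact_mod_cast (by omega : 2 ≤ k + 2)
  rw [h1, hN.lintegral_count hB hm (measurable_one.indicator measurableSet_Ici), hma, ← ha,
    ← key.tsum_eq, ENNReal.ofReal_tsum_of_nonneg (fun k => by positivity) key.summable]
  refine tsum_le_tsum_of_shift_two ?_ ?_ fun k => ?_
  · rw [indicator_of_notMem h0, zero_mul]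
  · rw [indicator_of_notMem h0', zero_mul]
  rw [indicator_of_mem (h2 k), Pi.one_apply, one_mul]
  apply ENNReal.ofReal_le_ofReal
  have h3 : a ^ 2 * (Real.exp (-a) * a ^ k / k.factorial) =
      Real.exp (-a) * a ^ (k + 2) / k.factorial := by ring
  rw [h3]
  have : a ^ (k + 2) ≥ 0 := pow_nonneg ha0 _
  gcongr
  omega

lemma indep_fintype (hN : IsPoissonRandomMeasure P m N) {ι : Type*} [Fintype ι] (B : ι → Set X)
    (hB : ∀ i, MeasurableSet (B i)) (hd : Pairwise fun i j => Disjoint (B i) (B j)) :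
    iIndepFun (fun i ω => N ω (B i)) P := by
  have h := (hN.indep _ (B ∘ (Fintype.equivFin ι).symm) (fun i => hB _)
    (fun i j hij => hd ((Fintype.equivFin ι).symm.injective.ne hij))).precomp
    (Fintype.equivFin ι).injective
  simpa using h

/-- The exponential moment of the integral of a simple function against a Poisson random
measure. -/
lemma lintegral_exp_simpleFunc (hN : IsPoissonRandomMeasure P m N) {B : Set X}
    (hB : MeasurableSet B) (hm : m B < ∞) (φ : SimpleFunc X ℝ) (θ : ℝ) :
    ∫⁻ ω, ENNReal.ofReal
        (Real.exp (θ * ∑ c ∈ φ.range, c * (N ω (B ∩ φ ⁻¹' {c})).toReal)) ∂P =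
      ENNReal.ofReal
        (Real.exp (∑ c ∈ φ.range, (m (B ∩ φ ⁻¹' {c})).toReal * (Real.exp (θ * c) - 1))) := by
  have hmeas : ∀ c : ℝ, MeasurableSet (B ∩ φ ⁻¹' {c}) := fun c => hB.inter (φ.measurableSet_preimage _)
  -- The level sets of `φ` are disjoint, so the counts are independent and the exponential moment
  -- factorizes.
  have hind : iIndepFun (fun (c : φ.range) ω => N ω (B ∩ φ ⁻¹' {(c : ℝ)})) P := by
    refine hN.indep_fintype _ (fun c => hmeas c) fun c c' hcc' => ?_
    refine Set.disjoint_left.2 ?_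
    rintro x ⟨-, hx⟩ ⟨-, hx'⟩
    simp only [mem_preimage, mem_singleton_iff] at hx hx'
    exact hcc' (Subtype.ext (hx.symm.trans hx'))
  have hind' := hind.comp
    (fun c x => ENNReal.ofReal (Real.exp (θ * c * x.toReal))) (fun c => by fun_prop)
  have h := lintegral_prod_eq_prod_lintegral_of_indepFun Finset.univ _ hind'
    (fun c => Measurable.comp (by fun_prop) (hN.measurable_apply (hmeas c)))
  have hlt : ∀ c : ℝ, m (B ∩ φ ⁻¹' {c}) < ∞ :=
    fun c => (measure_mono inter_subset_left).trans_lt hm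
  simp only [Function.comp_def] at h
  simp_rw [fun c : φ.range => hN.lintegral_exp_count (hmeas c) (hlt c) (θ * c)] at h
  rw [← ENNReal.ofReal_prod_of_nonneg (fun _ _ => (Real.exp_pos _).le), ← Real.exp_sum,
    Finset.sum_coe_sort φ.range
      (fun c => (m (B ∩ φ ⁻¹' {c})).toReal * (Real.exp (θ * c) - 1))] at h
  rw [← h]
  congr 1
  ext ω
  rw [← ENNReal.ofReal_prod_of_nonneg (fun _ _ => (Real.exp_pos _).le), ← Real.exp_sum,
    Finset.sum_coe_sort φ.range (fun c => θ * c * (N ω (B ∩ φ ⁻¹' {c})).toReal), Finset.mul_sum]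
  simp_rw [mul_assoc]

end IsPoissonRandomMeasure

lemma setIntegral_simpleFunc {X : Type*} [MeasurableSpace X] {μ : Measure X} {B : Set X} (hμ : μ B < ∞) (φ : SimpleFunc X ℝ) :
    ∫ x in B, φ x ∂μ = ∑ c ∈ φ.range, c * (μ (B ∩ φ ⁻¹' {c})).toReal := by
  have : IsFiniteMeasure (μ.restrict B) := ⟨by simpa using hμ⟩
  rw [SimpleFunc.integral_eq_sum φ (SimpleFunc.integrable_of_isFiniteMeasure φ)]
  refine Finset.sum_congr rfl fun c _ => ?_
  rw [measureReal_def, Measure.restrict_apply (φ.measurableSet_preimage _), inter_comm, smul_eq_mul,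
    mul_comm]

end Poisson

/-! ### Tail bounds for compensated Poisson integrals. -/

section Chernoff

lemma sum_measure_preimage_simpleFunc {X : Type*} [MeasurableSpace X] {m : Measure X} {B : Set X}
    (hm : m B < ∞) (φ : SimpleFunc X ℝ) :
    ∑ c ∈ φ.range, (m (B ∩ φ ⁻¹' {c})).toReal = (m B).toReal := by
  have h := SimpleFunc.sum_range_measure_preimage_singleton φ (m.restrict B)
  rw [Measure.restrict_apply_univ] at h
  rw [← h, ENNReal.toReal_sum]
  · refine Finset.sum_congr rfl fun c _ => ?_
    rw [Measure.restrict_apply (φ.measurableSet_preimage _), inter_comm]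
  · intro c _
    exact ((measure_mono (subset_univ _)).trans_lt (by simpa using hm)).ne

namespace IsPoissonRandomMeasure

variable {Ω X : Type*} [MeasurableSpace Ω] [MeasurableSpace X] {P : Measure Ω}
  {m : Measure X} {N : Ω → Measure X}

lemma aemeasurable_setIntegral_simpleFunc (hN : IsPoissonRandomMeasure P m N) {B : Set X}
    (hB : MeasurableSet B) (hm : m B < ∞) (φ : SimpleFunc X ℝ) :
    AEMeasurable (fun ω => ∫ x in B, φ x ∂(N ω)) P := by
  have h : (fun ω => ∑ c ∈ φ.range, c * (N ω (B ∩ φ ⁻¹' {c})).toReal) =ᵐ[P]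
      fun ω => ∫ x in B, φ x ∂(N ω) := by
    filter_upwards [hN.ae_lt_top hB hm] with ω hω
    rw [setIntegral_simpleFunc hω]
  refine AEMeasurable.congr (Measurable.aemeasurable ?_) h
  refine Finset.measurable_sum _ fun c _ => ?_
  exact (hN.measurable_apply (hB.inter (φ.measurableSet_preimage _))).ennreal_toReal.const_mul c

/-- After compensation the exponent is the integral of `e^y - 1 - y` with `y = θ φ`, and `e^y - 1 -
y ≤ y²` for `|y| ≤ 1`. -/
lemma lintegral_exp_simpleFunc_le (hN : IsPoissonRandomMeasure P m N) {B : Set X}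
    (hB : MeasurableSet B) (hm : m B < ∞) (φ : SimpleFunc X ℝ) (hφ : ∀ x, |φ x| ≤ 1) {θ : ℝ}
    (h0 : 0 ≤ θ) (h1 : θ ≤ 1) :
    ∫⁻ ω, ENNReal.ofReal (Real.exp (θ * (∫ x in B, φ x ∂(N ω) - ∫ x in B, φ x ∂m))) ∂P ≤
      ENNReal.ofReal (Real.exp (θ ^ 2 * (m B).toReal)) := by
  have e1 : ∫⁻ ω, ENNReal.ofReal
      (Real.exp (θ * (∫ x in B, φ x ∂(N ω) - ∫ x in B, φ x ∂m))) ∂P =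
      ∫⁻ ω, ENNReal.ofReal (Real.exp (-(θ * ∫ x in B, φ x ∂m))) * ENNReal.ofReal
        (Real.exp (θ * ∑ c ∈ φ.range, c * (N ω (B ∩ φ ⁻¹' {c})).toReal)) ∂P := by
    refine lintegral_congr_ae ?_
    filter_upwards [hN.ae_lt_top hB hm] with ω hω
    rw [setIntegral_simpleFunc hω, ← ENNReal.ofReal_mul (Real.exp_pos _).le, ← Real.exp_add]
    congr 2
    ring
  rw [e1, lintegral_const_mul' _ _ ENNReal.ofReal_ne_top, hN.lintegral_exp_simpleFunc hB hm,
    ← ENNReal.ofReal_mul (Real.exp_pos _).le, ← Real.exp_add]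
  refine ENNReal.ofReal_le_ofReal (Real.exp_le_exp.2 ?_)
  rw [setIntegral_simpleFunc hm, ← sum_measure_preimage_simpleFunc hm φ, Finset.mul_sum,
    Finset.mul_sum, ← Finset.sum_neg_distrib, ← Finset.sum_add_distrib]
  refine Finset.sum_le_sum fun c hc => ?_
  obtain ⟨x, rfl⟩ := SimpleFunc.mem_range.1 hc
  have hθ : |θ * φ x| ≤ 1 := by
    rw [abs_mul, abs_of_nonneg h0]
    exact mul_le_one₀ h1 (abs_nonneg _) (hφ x)
  have h2 := (abs_le.1 (Real.abs_exp_sub_one_sub_id_le hθ)).2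
  have h3 : (θ * φ x) ^ 2 ≤ θ ^ 2 := by
    rw [mul_pow]
    exact mul_le_of_le_one_right (sq_nonneg _) ((sq_le_one_iff_abs_le_one _).2 (hφ x))
  have h4 : 0 ≤ (m (B ∩ φ ⁻¹' {φ x})).toReal := ENNReal.toReal_nonneg
  nlinarith [mul_le_mul_of_nonneg_left (h2.trans h3) h4]

/-- One sequence serves all measures at once, so the same approximation can be used for the
intensity and for every sample. -/
lemma exists_approx {φ : X → ℝ} (hφm : Measurable φ) (hφ : ∀ x, |φ x| ≤ 1) :
    ∃ ψ : ℕ → SimpleFunc X ℝ, (∀ n x, |ψ n x| ≤ 1) ∧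
      ∀ μ : Measure X, ∀ B : Set X, μ B < ∞ →
        Tendsto (fun n => ∫ x in B, ψ n x ∂μ) atTop (𝓝 (∫ x in B, φ x ∂μ)) := by
  have h0 : (0 : ℝ) ∈ Icc (-1 : ℝ) 1 := by simp
  have hb : ∀ n x, |SimpleFunc.approxOn φ hφm (Icc (-1) 1) 0 h0 n x| ≤ 1 := fun n x =>
    abs_le.2 (SimpleFunc.approxOn_mem hφm h0 n x)
  refine ⟨fun n => SimpleFunc.approxOn φ hφm (Icc (-1) 1) 0 h0 n, hb, fun μ B hB => ?_⟩
  have : IsFiniteMeasure (μ.restrict B) := ⟨by simpa using hB⟩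
  refine tendsto_integral_of_dominated_convergence (fun _ => 1)
    (fun n => (SimpleFunc.measurable _).aestronglyMeasurable) (integrable_const _)
    (fun n => ae_of_all _ fun x => hb n x) (ae_of_all _ fun x => ?_)
  exact SimpleFunc.tendsto_approxOn hφm h0 (subset_closure (abs_le.1 (hφ x)))

/-- Fatou's lemma carries the bound from simple functions to bounded measurable ones; the almost
sure limit also yields the measurability. -/
lemma lintegral_exp_le (hN : IsPoissonRandomMeasure P m N) {B : Set X}
    (hB : MeasurableSet B) (hm : m B < ∞) {φ : X → ℝ} (hφm : Measurable φ) (hφ : ∀ x, |φ x| ≤ 1)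
    {θ : ℝ} (h0 : 0 ≤ θ) (h1 : θ ≤ 1) :
    AEMeasurable (fun ω => ∫ x in B, φ x ∂(N ω)) P ∧
    ∫⁻ ω, ENNReal.ofReal (Real.exp (θ * (∫ x in B, φ x ∂(N ω) - ∫ x in B, φ x ∂m))) ∂P ≤
      ENNReal.ofReal (Real.exp (θ ^ 2 * (m B).toReal)) := by
  obtain ⟨ψ, hψ, hlim⟩ := exists_approx hφm hφ
  have hN' : ∀ᵐ ω ∂P, Tendsto (fun n => ∫ x in B, ψ n x ∂(N ω)) atTop
      (𝓝 (∫ x in B, φ x ∂(N ω))) := by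
    filter_upwards [hN.ae_lt_top hB hm] with ω hω using hlim _ B hω
  refine ⟨aemeasurable_of_tendsto_metrizable_ae atTop
    (fun n => hN.aemeasurable_setIntegral_simpleFunc hB hm (ψ n)) hN', ?_⟩
  calc ∫⁻ ω, ENNReal.ofReal (Real.exp (θ * (∫ x in B, φ x ∂(N ω) - ∫ x in B, φ x ∂m))) ∂P
      = ∫⁻ ω, liminf (fun n => ENNReal.ofReal
          (Real.exp (θ * (∫ x in B, ψ n x ∂(N ω) - ∫ x in B, ψ n x ∂m)))) atTop ∂P := by
        refine lintegral_congr_ae ?_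
        filter_upwards [hN'] with ω hω
        refine (Tendsto.liminf_eq ?_).symm
        exact ENNReal.tendsto_ofReal ((Real.continuous_exp.tendsto _).comp
          ((hω.sub (hlim m B hm)).const_mul θ))
    _ ≤ liminf (fun n => ∫⁻ ω, ENNReal.ofReal
          (Real.exp (θ * (∫ x in B, ψ n x ∂(N ω) - ∫ x in B, ψ n x ∂m))) ∂P) atTop := by
        refine lintegral_liminf_le' fun n => ?_
        have := hN.aemeasurable_setIntegral_simpleFunc hB hm (ψ n)
        fun_prop
    _ ≤ liminf (fun _ : ℕ => ENNReal.ofReal (Real.exp (θ ^ 2 * (m B).toReal))) atTop := by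
        refine liminf_le_liminf (Eventually.of_forall fun n => ?_)
        exact hN.lintegral_exp_simpleFunc_le hB hm (ψ n) (hψ n) h0 h1
    _ = _ := liminf_const _

/-- Bernstein-type tail bound for the compensated integral of a bounded function. -/
lemma measure_le_setIntegral_sub (hN : IsPoissonRandomMeasure P m N) {B : Set X}
    (hB : MeasurableSet B) (hm : m B < ∞) {φ : X → ℝ} (hφm : Measurable φ) (hφ : ∀ x, |φ x| ≤ 1)
    {M k : ℝ} (hM : (m B).toReal ≤ M) (hk : 0 < k) :
    P {ω | 2 * (√(k * M) + k) ≤ ∫ x in B, φ x ∂(N ω) - ∫ x in B, φ x ∂m} ≤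
      ENNReal.ofReal (Real.exp (-k)) := by
  have hM0 : 0 ≤ M := ENNReal.toReal_nonneg.trans hM
  -- The choice `θ = √(k / M)` makes `θ² M = k`; it is cut off at `1`, the limit of validity of the
  -- moment bound.
  obtain ⟨θ, h0, h1, hθ⟩ : ∃ θ : ℝ, 0 ≤ θ ∧ θ ≤ 1 ∧
      θ ^ 2 * M - θ * (2 * (√(k * M) + k)) ≤ -k := by
    rcases le_total M k with h | h
    · refine ⟨1, zero_le_one, le_rfl, ?_⟩
      have := Real.sqrt_nonneg (k * M)
      linarith
    · have hMp : 0 < M := hk.trans_le h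
      refine ⟨√(k / M), Real.sqrt_nonneg _, Real.sqrt_le_one.2 ((div_le_one hMp).2 h), ?_⟩
      have e1 : √(k / M) * √(k * M) = k := by
        rw [← Real.sqrt_mul (by positivity), show k / M * (k * M) = k ^ 2 by field_simp,
          Real.sqrt_sq hk.le]
      have e2 : √(k / M) ^ 2 * M = k := by
        rw [Real.sq_sqrt (by positivity)]
        field_simp
      have e3 : 0 ≤ √(k / M) * k := by positivity
      nlinarith
  obtain ⟨hae, hle⟩ := hN.lintegral_exp_le hB hm hφm hφ h0 h1
  set Λ := 2 * (√(k * M) + k) with hΛ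
  have hpos : ENNReal.ofReal (Real.exp (θ * Λ)) ≠ 0 := by simp [Real.exp_pos]
  calc P {ω | Λ ≤ ∫ x in B, φ x ∂(N ω) - ∫ x in B, φ x ∂m}
      ≤ P {ω | ENNReal.ofReal (Real.exp (θ * Λ)) ≤ ENNReal.ofReal
          (Real.exp (θ * (∫ x in B, φ x ∂(N ω) - ∫ x in B, φ x ∂m)))} := by
        refine measure_mono fun ω hω => ?_
        exact ENNReal.ofReal_le_ofReal (Real.exp_le_exp.2 (mul_le_mul_of_nonneg_left hω h0))
    _ ≤ (∫⁻ ω, ENNReal.ofReal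
          (Real.exp (θ * (∫ x in B, φ x ∂(N ω) - ∫ x in B, φ x ∂m))) ∂P) /
          ENNReal.ofReal (Real.exp (θ * Λ)) :=
        meas_ge_le_lintegral_div (by fun_prop) hpos ENNReal.ofReal_ne_top
    _ ≤ ENNReal.ofReal (Real.exp (θ ^ 2 * (m B).toReal)) / ENNReal.ofReal (Real.exp (θ * Λ)) := by
        gcongr
    _ = ENNReal.ofReal (Real.exp (θ ^ 2 * (m B).toReal - θ * Λ)) := by
        rw [Real.exp_sub, ENNReal.ofReal_div_of_pos (Real.exp_pos _)]
    _ ≤ ENNReal.ofReal (Real.exp (-k)) := by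
        refine ENNReal.ofReal_le_ofReal (Real.exp_le_exp.2 (le_trans ?_ hθ))
        gcongr

lemma measure_le_abs_setIntegral_sub (hN : IsPoissonRandomMeasure P m N) {B : Set X}
    (hB : MeasurableSet B) (hm : m B < ∞) {φ : X → ℝ} (hφm : Measurable φ) (hφ : ∀ x, |φ x| ≤ 1)
    {M k : ℝ} (hM : (m B).toReal ≤ M) (hk : 0 < k) :
    P {ω | 2 * (√(k * M) + k) ≤ |∫ x in B, φ x ∂(N ω) - ∫ x in B, φ x ∂m|} ≤
      2 * ENNReal.ofReal (Real.exp (-k)) := by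
  have h1 := hN.measure_le_setIntegral_sub hB hm hφm hφ hM hk
  have h2 := hN.measure_le_setIntegral_sub hB hm hφm.neg (φ := fun x => -φ x)
    (fun x => by simpa using hφ x) hM hk
  rw [two_mul (ENNReal.ofReal _)]
  refine (measure_mono fun ω hω => ?_).trans ((measure_union_le _ _).trans (add_le_add h1 h2))
  rcases le_abs.1 (mem_ofPred_eq ▸ hω : _ ≤ |_|) with h | h
  · exact Or.inl h
  · refine Or.inr ?_
    simp only [mem_ofPred_eq, integral_neg]
    linarith

end IsPoissonRandomMeasure

end Chernoff

/-! ### Intensities of the sets of atoms whose hyperplanes pass near or between points. -/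

section Intensity

variable {d : ℕ}

lemma measurable_dist0 : Measurable (dist0 : AtomSpace d → ℝ) :=
  measurable_subtype_coe.comp measurable_fst

lemma measurable_normal : Measurable (normal : AtomSpace d → Space d) :=
  measurable_subtype_coe.comp (measurable_fst.comp measurable_snd)

lemma measurable_jump : Measurable (jump : AtomSpace d → ℝ) :=
  measurable_subtype_coe.comp (measurable_snd.comp measurable_snd)

lemma measurable_inner_normal (t : Space d) :
    Measurable fun p : AtomSpace d => (inner ℝ (normal p) t : ℝ) :=
  measurable_normal.inner_const

lemma measurable_direction : Measurable fun q : MarkSpace d => (q.1 : Space d) :=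
  measurable_subtype_coe.comp measurable_fst

lemma measurable_size : Measurable fun q : MarkSpace d => (q.2 : ℝ) :=
  measurable_subtype_coe.comp measurable_snd

lemma measurable_reflect : Measurable (reflect : MarkSpace d → MarkSpace d) := by
  refine Measurable.prodMk ?_ ?_
  · exact (continuous_neg.measurable).comp measurable_fst
  · exact (measurable_size.neg).subtype_mk

lemma norm_normal (p : AtomSpace d) : ‖normal p‖ = 1 := by
  simp [normal]

lemma dist0_pos (p : AtomSpace d) : 0 < dist0 p := p.1.2

lemma jump_ne_zero (p : AtomSpace d) : jump p ≠ 0 := p.2.2.2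

lemma measurableSet_separating (t : Space d) : MeasurableSet (separating t) :=
  measurableSet_lt measurable_dist0 (measurable_inner_normal t)

/-- The marks `(s, x)` with `|x|` in the `j`-th dyadic interval. -/
def bandMarks (j : ℕ) : Set (MarkSpace d) := {q | |(q.2 : ℝ)| ∈ band j}

/-- The atoms `(ρ, s, x)` with `|x|` in the `j`-th dyadic interval. -/
def bandAtoms (j : ℕ) : Set (AtomSpace d) := {p | |jump p| ∈ band j}

lemma measurableSet_band (j : ℕ) : MeasurableSet (band j) := measurableSet_Ioc

lemma measurableSet_bandMarks (j : ℕ) : MeasurableSet (bandMarks j : Set (MarkSpace d)) :=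
  (measurableSet_band j).preimage measurable_size.abs

lemma measurableSet_bandAtoms (j : ℕ) : MeasurableSet (bandAtoms j : Set (AtomSpace d)) :=
  (measurableSet_band j).preimage measurable_jump.abs

/-- The real number `ν_j`. -/
def bandReal (ν : Measure (MarkSpace d)) (j : ℕ) : ℝ := (bandMass ν j).toReal

lemma bandReal_nonneg (ν : Measure (MarkSpace d)) (j : ℕ) : 0 ≤ bandReal ν j :=
  ENNReal.toReal_nonneg

namespace IsAdmissible

variable {ν : Measure (MarkSpace d)}

lemma measure_size_gt_lt_top (hν : IsAdmissible ν) {ε : ℝ} (hε : 0 < ε) :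
    ν {q | ε < |(q.2 : ℝ)|} < ∞ := by
  have hmeas : Measurable fun q : MarkSpace d => ENNReal.ofReal (min 1 ((q.2 : ℝ) ^ 2)) := by
    have := measurable_size (d := d)
    fun_prop
  have hpos : 0 < min 1 (ε ^ 2) := by positivity
  refine (measure_mono ?_).trans_lt ((meas_ge_le_lintegral_div hmeas.aemeasurable
    (ENNReal.ofReal_pos.2 hpos).ne' ENNReal.ofReal_ne_top).trans_lt
    (ENNReal.div_lt_top hν.levy.ne (ENNReal.ofReal_pos.2 hpos).ne'))
  intro q hq
  refine ENNReal.ofReal_le_ofReal (min_le_min_left _ ?_)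
  rw [← sq_abs (q.2 : ℝ)]
  exact pow_le_pow_left₀ hε.le (le_of_lt hq) 2

lemma sigmaFinite (hν : IsAdmissible ν) : SigmaFinite ν := by
  refine ⟨⟨⟨fun n : ℕ => {q | 1 / ((n : ℝ) + 1) < |(q.2 : ℝ)|}, fun _ => trivial,
    fun n => hν.measure_size_gt_lt_top (by positivity), ?_⟩⟩⟩
  refine eq_univ_of_forall fun q => ?_
  obtain ⟨n, hn⟩ := exists_nat_one_div_lt (abs_pos.2 q.2.2)
  exact mem_iUnion.2 ⟨n, hn⟩

lemma bandMass_lt_top (hν : IsAdmissible ν) (j : ℕ) : bandMass ν j < ∞ := by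
  refine (measure_mono ?_).trans_lt
    (hν.measure_size_gt_lt_top (ε := (2 : ℝ) ^ (-(j : ℤ))) (by positivity))
  intro q hq
  exact hq.1.trans_le (le_abs_self _)

lemma measurePreserving_reflect (hν : IsAdmissible ν) : MeasurePreserving reflect ν ν :=
  ⟨measurable_reflect, hν.symmetric⟩

/-- `bandMass` counts positive jumps only; the negative ones have the same mass by reflection. -/
lemma measure_bandMarks (hν : IsAdmissible ν) (j : ℕ) : ν (bandMarks j) = 2 * bandMass ν j := by
  have hpos : ∀ x ∈ band j, 0 < x := fun x hx => lt_trans (by positivity) hx.1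
  have hm : MeasurableSet {q : MarkSpace d | (q.2 : ℝ) ∈ band j} :=
    (measurableSet_band j).preimage measurable_size
  have h1 : (bandMarks j : Set (MarkSpace d)) =
      {q | (q.2 : ℝ) ∈ band j} ∪ reflect ⁻¹' {q | (q.2 : ℝ) ∈ band j} := by
    ext q
    change |(q.2 : ℝ)| ∈ band j ↔ (q.2 : ℝ) ∈ band j ∨ -(q.2 : ℝ) ∈ band j
    rcases abs_cases (q.2 : ℝ) with ⟨h, h'⟩ | ⟨h, h'⟩ <;> rw [h]
    · refine ⟨Or.inl, fun h2 => h2.elim id fun h3 => ?_⟩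
      linarith [hpos _ h3]
    · refine ⟨Or.inr, fun h2 => h2.elim (fun h3 => ?_) id⟩
      linarith [hpos _ h3]
  rw [h1, measure_union _ (hm.preimage measurable_reflect),
    hν.measurePreserving_reflect.measure_preimage hm.nullMeasurableSet, two_mul]
  · rfl
  · refine Set.disjoint_left.2 fun q hq hq' => ?_
    have h2 := hpos _ hq
    have h3 : 0 < -(q.2 : ℝ) := hpos _ hq'
    linarith

lemma ofReal_bandReal (hν : IsAdmissible ν) (j : ℕ) :
    ENNReal.ofReal (bandReal ν j) = bandMass ν j :=
  ENNReal.ofReal_toReal (hν.bandMass_lt_top j).ne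

lemma measure_bandMarks_eq_ofReal (hν : IsAdmissible ν) (j : ℕ) :
    ν (bandMarks j) = ENNReal.ofReal (2 * bandReal ν j) := by
  rw [hν.measure_bandMarks, ENNReal.ofReal_mul zero_le_two, hν.ofReal_bandReal,
    ENNReal.ofReal_ofNat]

lemma summable_chi (hν : IsAdmissible ν) :
    Summable fun j : ℕ => (2 : ℝ)⁻¹ ^ (j + 1) * √(((j : ℝ) + 1) * bandReal ν (j + 1)) := by
  have h := ENNReal.summable_toReal hν.chi_lt_top.ne
  refine h.congr fun j => ?_
  rw [ENNReal.toReal_mul, ← ENNReal.toReal_rpow, ENNReal.toReal_mul, ENNReal.toReal_natCast,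
    Real.sqrt_eq_rpow, bandReal, ENNReal.zpow_neg]
  push_cast
  congr 1
  rw [inv_pow]
  norm_cast
  rw [ENNReal.toReal_inv, ENNReal.toReal_natCast]

/-- The terms of the convergent series `χ_ν` are bounded. This growth bound is what makes the mesh
`4^{-j}` fine enough for the interpolation in `ae_increment`. -/
lemma exists_bandReal_le (hν : IsAdmissible ν) :
    ∃ C : ℝ, 0 < C ∧ ∀ j : ℕ, ((j : ℝ) + 1) * bandReal ν (j + 1) ≤ C * 4 ^ (j + 1) := by
  obtain ⟨B, hB⟩ := hν.summable_chi.tendsto_atTop_zero.bddAbove_range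
  refine ⟨B ^ 2 + 1, by positivity, fun j => ?_⟩
  have h1 : (2 : ℝ)⁻¹ ^ (j + 1) * √(((j : ℝ) + 1) * bandReal ν (j + 1)) ≤ B := hB ⟨j, rfl⟩
  have h0 : 0 ≤ ((j : ℝ) + 1) * bandReal ν (j + 1) :=
    mul_nonneg (by positivity) (bandReal_nonneg _ _)
  have h2 : √(((j : ℝ) + 1) * bandReal ν (j + 1)) ≤ B * 2 ^ (j + 1) := by
    rw [inv_pow, inv_mul_le_iff₀ (by positivity)] at h1
    linarith
  rw [Real.sqrt_le_iff] at h2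
  have h3 : (B * 2 ^ (j + 1)) ^ 2 = B ^ 2 * 4 ^ (j + 1) := by
    rw [mul_pow, ← pow_mul, mul_comm (j + 1) 2, pow_mul]
    norm_num
  have h4 : (0 : ℝ) < 4 ^ (j + 1) := by positivity
  nlinarith [h2.2]

end IsAdmissible

instance sigmaFinite_comap_Ioi :
    SigmaFinite (Measure.comap ((↑) : Ioi (0 : ℝ) → ℝ) volume) := by
  refine ⟨⟨⟨fun n : ℕ => {ρ | (ρ : ℝ) < n}, fun _ => trivial, fun n => ?_, ?_⟩⟩⟩
  · rw [comap_subtype_coe_apply measurableSet_Ioi]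
    refine (measure_mono (t := Ioo 0 (n : ℝ)) ?_).trans_lt (by simp)
    rintro _ ⟨ρ, hρ, rfl⟩
    exact ⟨ρ.2, hρ⟩
  · refine eq_univ_of_forall fun ρ => ?_
    obtain ⟨n, hn⟩ := exists_nat_gt (ρ : ℝ)
    exact mem_iUnion.2 ⟨n, hn⟩

lemma intensity_apply (ν : Measure (MarkSpace d)) [SFinite ν] {S : Set (AtomSpace d)}
    (hS : MeasurableSet S) :
    intensity ν S = ∫⁻ q, volume (Subtype.val '' {ρ : Ioi (0 : ℝ) | (ρ, q) ∈ S}) ∂ν := by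
  rw [intensity, Measure.prod_apply_symm hS]
  refine lintegral_congr fun q => ?_
  rw [comap_subtype_coe_apply measurableSet_Ioi]
  rfl

lemma intensity_le (ν : Measure (MarkSpace d)) [SFinite ν] {S : Set (AtomSpace d)}
    (hS : MeasurableSet S) {A : Set (MarkSpace d)} (hA : MeasurableSet A) (lo : MarkSpace d → ℝ)
    {l : ℝ} (h : ∀ p ∈ S, p.2 ∈ A ∧ lo p.2 ≤ dist0 p ∧ dist0 p ≤ lo p.2 + l) :
    intensity ν S ≤ ENNReal.ofReal l * ν A := by
  rw [intensity_apply ν hS, ← lintegral_indicator_const hA]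
  refine lintegral_mono fun q => ?_
  by_cases hq : q ∈ A
  · rw [indicator_of_mem hq]
    calc volume (Subtype.val '' {ρ : Ioi (0 : ℝ) | (ρ, q) ∈ S})
        ≤ volume (Icc (lo q) (lo q + l)) := by
          refine measure_mono ?_
          rintro _ ⟨ρ, hρ, rfl⟩
          exact (h (ρ, q) hρ).2
      _ = ENNReal.ofReal l := by rw [Real.volume_Icc, add_sub_cancel_left]
  · have : {ρ : Ioi (0 : ℝ) | (ρ, q) ∈ S} = ∅ :=
      eq_empty_of_forall_notMem fun ρ hρ => hq (h (ρ, q) hρ).1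
    simp [this]

lemma le_intensity (ν : Measure (MarkSpace d)) [SFinite ν] {S : Set (AtomSpace d)}
    (hS : MeasurableSet S) {A : Set (MarkSpace d)} (hA : MeasurableSet A) (lo : MarkSpace d → ℝ)
    {l : ℝ} (hlo : ∀ q ∈ A, 0 ≤ lo q)
    (h : ∀ p : AtomSpace d, p.2 ∈ A → lo p.2 < dist0 p → dist0 p < lo p.2 + l → p ∈ S) :
    ENNReal.ofReal l * ν A ≤ intensity ν S := by
  rw [intensity_apply ν hS, ← lintegral_indicator_const hA]
  refine lintegral_mono fun q => ?_
  by_cases hq : q ∈ A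
  · rw [indicator_of_mem hq]
    calc ENNReal.ofReal l = volume (Ioo (lo q) (lo q + l)) := by
          rw [Real.volume_Ioo, add_sub_cancel_left]
      _ ≤ volume (Subtype.val '' {ρ : Ioi (0 : ℝ) | (ρ, q) ∈ S}) := by
          refine measure_mono fun ρ hρ => ?_
          exact ⟨⟨ρ, (hlo q hq).trans_lt hρ.1⟩, h (⟨ρ, (hlo q hq).trans_lt hρ.1⟩, q) hq hρ.1 hρ.2,
            rfl⟩
  · rw [indicator_of_notMem hq]
    exact zero_le

/-- The atoms of the `j`-th band whose hyperplane is within distance `r` of `t`. -/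
def closedStrip (j : ℕ) (r : ℝ) (t : Space d) : Set (AtomSpace d) :=
  bandAtoms j ∩ {p | |dist0 p - inner ℝ (normal p) t| ≤ r}

/-- The atoms of the `j`-th band whose hyperplane is at distance less than `r` from `t`. -/
def openStrip (j : ℕ) (r : ℝ) (t : Space d) : Set (AtomSpace d) :=
  bandAtoms j ∩ {p | |dist0 p - inner ℝ (normal p) t| < r}

lemma measurableSet_closedStrip (j : ℕ) (r : ℝ) (t : Space d) :
    MeasurableSet (closedStrip j r t) :=
  (measurableSet_bandAtoms j).inter (measurableSet_le
    (measurable_dist0.sub (measurable_inner_normal t)).abs measurable_const)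

lemma measurableSet_openStrip (j : ℕ) (r : ℝ) (t : Space d) :
    MeasurableSet (openStrip j r t) :=
  (measurableSet_bandAtoms j).inter (measurableSet_lt
    (measurable_dist0.sub (measurable_inner_normal t)).abs measurable_const)

lemma measurableSet_symmDiff_separating (j : ℕ) (t u : Space d) :
    MeasurableSet (bandAtoms j ∩ symmDiff (separating t) (separating u)) :=
  (measurableSet_bandAtoms j).inter
    ((measurableSet_separating t).symmDiff (measurableSet_separating u))

lemma abs_inner_normal_le (p : AtomSpace d) (t : Space d) : |inner ℝ (normal p) t| ≤ ‖t‖ := by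
  simpa [norm_normal] using abs_real_inner_le_norm (normal p) t

/-- A hyperplane between `t` and `u` has `ρ` between `⟨s, t⟩` and `⟨s, u⟩`, which differ by at most
`‖u - t‖`. The first bound places the atom in a strip about `t`, the other two in an interval of `ρ`
for given `s`. -/
lemma mem_symmDiff_separating {p : AtomSpace d} {t u : Space d}
    (h : p ∈ symmDiff (separating t) (separating u)) :
    |dist0 p - inner ℝ (normal p) t| ≤ ‖u - t‖ ∧
      min (inner ℝ (normal p) t : ℝ) (inner ℝ (normal p) u) ≤ dist0 p ∧
      dist0 p ≤ min (inner ℝ (normal p) t : ℝ) (inner ℝ (normal p) u) + ‖u - t‖ := by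
  have h1 := abs_le.1 (abs_inner_normal_le p (u - t))
  rw [inner_sub_right] at h1
  rcases h with ⟨ht, hu⟩ | ⟨hu, ht⟩
  · have ht' : dist0 p < inner ℝ (normal p) t := ht
    have hu' : inner ℝ (normal p) u ≤ dist0 p := not_lt.1 hu
    rw [min_eq_right (hu'.trans ht'.le)]
    exact ⟨abs_le.2 ⟨by linarith, by linarith⟩, hu', by linarith⟩
  · have hu' : dist0 p < inner ℝ (normal p) u := hu
    have ht' : inner ℝ (normal p) t ≤ dist0 p := not_lt.1 ht
    rw [min_eq_left (ht'.trans hu'.le)]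
    exact ⟨abs_le.2 ⟨by linarith, by linarith⟩, ht', by linarith⟩

namespace IsAdmissible

variable {ν : Measure (MarkSpace d)}

lemma intensity_symmDiff_le (hν : IsAdmissible ν) (j : ℕ) (t u : Space d) :
    intensity ν (bandAtoms j ∩ symmDiff (separating t) (separating u)) ≤
      ENNReal.ofReal (2 * bandReal ν j * ‖u - t‖) := by
  have := hν.sigmaFinite
  refine (intensity_le ν (measurableSet_symmDiff_separating j t u) (measurableSet_bandMarks j)
    (fun q => min (inner ℝ (q.1 : Space d) t : ℝ) (inner ℝ (q.1 : Space d) u)) (l := ‖u - t‖)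
    fun p hp => ⟨hp.1, (mem_symmDiff_separating hp.2).2⟩).trans_eq ?_
  rw [hν.measure_bandMarks_eq_ofReal, ← ENNReal.ofReal_mul (norm_nonneg _), mul_comm]

lemma intensity_closedStrip_le (hν : IsAdmissible ν) (j : ℕ) {r : ℝ} (hr : 0 ≤ r) (t : Space d) :
    intensity ν (closedStrip j r t) ≤ ENNReal.ofReal (4 * bandReal ν j * r) := by
  have := hν.sigmaFinite
  refine (intensity_le ν (measurableSet_closedStrip j r t) (measurableSet_bandMarks j)
    (fun q => (inner ℝ (q.1 : Space d) t : ℝ) - r) (l := 2 * r)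
    fun p hp => ⟨hp.1, ?_⟩).trans_eq ?_
  · have h := abs_le.1 (mem_ofPred_eq ▸ hp.2 : _ ≤ r)
    change (inner ℝ (normal p) t : ℝ) - r ≤ dist0 p ∧ dist0 p ≤ inner ℝ (normal p) t - r + 2 * r
    constructor <;> linarith [h.1, h.2]
  · rw [hν.measure_bandMarks_eq_ofReal, ← ENNReal.ofReal_mul (by positivity)]
    congr 1
    ring

/-- Only `ρ > 0` is available, so directions with `⟨s, t⟩ < 0` may contribute nothing. By reflection
at least half of the band has `⟨s, t⟩ ≥ 0`, and there the whole interval from `⟨s, t⟩` to `⟨s, t⟩ +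
r` counts. -/
lemma le_intensity_openStrip (hν : IsAdmissible ν) (j : ℕ) {r : ℝ} (hr : 0 ≤ r) (t : Space d) :
    ENNReal.ofReal (bandReal ν j * r) ≤ intensity ν (openStrip j r t) := by
  have := hν.sigmaFinite
  set A : Set (MarkSpace d) := bandMarks j ∩ {q | 0 ≤ (inner ℝ (q.1 : Space d) t : ℝ)} with hA
  have hmA : MeasurableSet A := (measurableSet_bandMarks j).inter
    (measurableSet_le measurable_const measurable_direction.inner_const)
  have h1 : bandMass ν j ≤ ν A := by
    have h2 : ν (bandMarks j) ≤ ν A + ν A := by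
      conv_rhs => rw [← hν.measurePreserving_reflect.measure_preimage hmA.nullMeasurableSet]
      refine (measure_mono ?_).trans (measure_union_le A (reflect ⁻¹' A)) |>.trans_eq ?_
      · intro q hq
        rcases le_total 0 (inner ℝ (q.1 : Space d) t : ℝ) with h | h
        · exact Or.inl ⟨hq, h⟩
        · refine Or.inr ⟨?_, ?_⟩
          · change |-(q.2 : ℝ)| ∈ band j
            rw [abs_neg]
            exact hq
          · change 0 ≤ (inner ℝ (-(q.1 : Space d)) t : ℝ)
            rw [inner_neg_left]
            linarith
      · rw [hν.measurePreserving_reflect.measure_preimage hmA.nullMeasurableSet]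
    rw [hν.measure_bandMarks, ← two_mul] at h2
    exact (ENNReal.mul_le_mul_iff_right (by simp) (by simp)).1 h2
  calc ENNReal.ofReal (bandReal ν j * r) = ENNReal.ofReal r * bandMass ν j := by
        rw [mul_comm, ENNReal.ofReal_mul hr, hν.ofReal_bandReal]
    _ ≤ ENNReal.ofReal r * ν A := by gcongr
    _ ≤ _ := by
        refine le_intensity ν (measurableSet_openStrip j r t) hmA
          (fun q => (inner ℝ (q.1 : Space d) t : ℝ)) (fun q hq => hq.2) fun p hp h2 h3 => ?_
        refine ⟨hp.1, ?_⟩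
        change |dist0 p - inner ℝ (normal p) t| < r
        change inner ℝ (normal p) t < dist0 p at h2
        change dist0 p < inner ℝ (normal p) t + r at h3
        rw [abs_lt]
        constructor <;> linarith

lemma intensity_slab_le (hν : IsAdmissible ν) (a l ε : ℝ) :
    intensity ν ({p | a < dist0 p ∧ dist0 p ≤ a + l} ∩ {p | ε < |jump p|}) ≤
      ENNReal.ofReal l * ν {q | ε < |(q.2 : ℝ)|} := by
  have := hν.sigmaFinite
  refine intensity_le ν ?_ (measurableSet_lt measurable_const measurable_size.abs) (fun _ => a)
    fun p hp => ⟨hp.2, hp.1.1.le, hp.1.2⟩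
  exact ((measurableSet_lt measurable_const measurable_dist0).inter
    (measurableSet_le measurable_dist0 measurable_const)).inter
    (measurableSet_lt measurable_const measurable_jump.abs)

end IsAdmissible

end Intensity

/-! ### Linearity of the compensators. -/

section Compensator

variable {d : ℕ}

lemma mem_band_succ {x : ℝ} {j : ℕ} :
    x ∈ band (j + 1) ↔ (2 : ℝ)⁻¹ ^ (j + 1) < x ∧ x ≤ (2 : ℝ)⁻¹ ^ j := by
  have h1 : (2 : ℝ) ^ (-((j + 1 : ℕ) : ℤ)) = (2 : ℝ)⁻¹ ^ (j + 1) := by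
    rw [zpow_neg, zpow_natCast, inv_pow]
  have h2 : (2 : ℝ) ^ (-((j + 1 : ℕ) : ℤ) + 1) = (2 : ℝ)⁻¹ ^ j := by
    rw [show -((j + 1 : ℕ) : ℤ) + 1 = -(j : ℤ) by push_cast; ring, zpow_neg, zpow_natCast, inv_pow]
  rw [band, h1, h2, mem_Ioc]

lemma separating_zero : (separating (0 : Space d)) = ∅ := by
  refine eq_empty_of_forall_notMem fun p hp => ?_
  have h : dist0 p < inner ℝ (normal p) (0 : Space d) := hp
  rw [inner_zero_right] at h
  exact absurd h (dist0_pos p).not_gt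

lemma measurableSet_separating_inter (t : Space d) (j : ℕ) :
    MeasurableSet (separating t ∩ bandAtoms j) :=
  (measurableSet_separating t).inter (measurableSet_bandAtoms j)

lemma integrableOn_jump {μ : Measure (AtomSpace d)} {S : Set (AtomSpace d)} {j : ℕ}
    (hSm : MeasurableSet S) (hS : S ⊆ bandAtoms (j + 1)) (hμ : μ S < ∞) :
    IntegrableOn jump S μ := by
  refine Measure.integrableOn_of_bounded (M := (2 : ℝ)⁻¹ ^ j) hμ.ne
    measurable_jump.aestronglyMeasurable ?_
  refine (ae_restrict_iff' hSm).2 (ae_of_all _ fun p hp => ?_)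
  exact (mem_band_succ.1 (hS hp)).2

lemma measureReal_radial_lt (a : ℝ) :
    (Measure.comap ((↑) : Ioi (0 : ℝ) → ℝ) volume).real {ρ | (ρ : ℝ) < a} = max a 0 := by
  have h : ((↑) : Ioi (0 : ℝ) → ℝ) '' {ρ | (ρ : ℝ) < a} = Ioo 0 a := by
    ext x
    constructor
    · rintro ⟨ρ, hρ, rfl⟩
      exact ⟨ρ.2, hρ⟩
    · exact fun hx => ⟨⟨x, hx.1⟩, hx.2, rfl⟩
  rw [measureReal_def, comap_subtype_coe_apply measurableSet_Ioi, h, Real.volume_Ioo, sub_zero,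
    ENNReal.toReal_ofReal']

/-- The vector `½ ∫_{|x| ∈ band j} x s ν(ds, dx)`, which represents the compensator of the `j`-th
layer. -/
def drift (ν : Measure (MarkSpace d)) (j : ℕ) : Space d :=
  (2 : ℝ)⁻¹ • ∫ q in bandMarks j, (q.2 : ℝ) • (q.1 : Space d) ∂ν

namespace IsAdmissible

variable {ν : Measure (MarkSpace d)}

lemma intensity_separating_lt_top (hν : IsAdmissible ν) (j : ℕ) (t : Space d) :
    intensity ν (separating t ∩ bandAtoms j) < ∞ := by
  have h := hν.intensity_symmDiff_le j 0 t
  rw [separating_zero, ← bot_eq_empty, bot_symmDiff, inter_comm] at h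
  exact h.trans_lt ENNReal.ofReal_lt_top

lemma norm_mark_le {j : ℕ} {q : MarkSpace d} (hq : q ∈ bandMarks (j + 1)) :
    ‖(q.2 : ℝ) • (q.1 : Space d)‖ ≤ (2 : ℝ)⁻¹ ^ j := by
  rw [norm_smul, show ‖(q.1 : Space d)‖ = 1 by simp, mul_one]
  exact (mem_band_succ.1 hq).2

lemma integrableOn_mark (hν : IsAdmissible ν) (j : ℕ) :
    IntegrableOn (fun q : MarkSpace d => (q.2 : ℝ) • (q.1 : Space d)) (bandMarks (j + 1)) ν := by
  refine Measure.integrableOn_of_bounded (M := (2 : ℝ)⁻¹ ^ j) ?_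
    (measurable_size.smul measurable_direction).aestronglyMeasurable ?_
  · rw [hν.measure_bandMarks_eq_ofReal]
    exact ENNReal.ofReal_ne_top
  · exact (ae_restrict_iff' (measurableSet_bandMarks _)).2 (ae_of_all _ fun q hq => norm_mark_le hq)

lemma norm_drift_le (hν : IsAdmissible ν) (j : ℕ) :
    ‖drift ν (j + 1)‖ ≤ (2 : ℝ)⁻¹ ^ j * bandReal ν (j + 1) := by
  have h := norm_setIntegral_le_of_norm_le_const (μ := ν) (s := bandMarks (j + 1))
    (f := fun q : MarkSpace d => (q.2 : ℝ) • (q.1 : Space d)) (C := (2 : ℝ)⁻¹ ^ j)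
    (by rw [hν.measure_bandMarks_eq_ofReal]; exact ENNReal.ofReal_lt_top)
    (fun q hq => norm_mark_le hq)
  rw [measureReal_def, hν.measure_bandMarks_eq_ofReal, ENNReal.toReal_ofReal
    (mul_nonneg zero_le_two (bandReal_nonneg _ _))] at h
  rw [drift, norm_smul, norm_inv, Real.norm_ofNat]
  linarith

lemma setIntegral_intensity_eq (hν : IsAdmissible ν) (j : ℕ) (t : Space d) :
    ∫ p in separating t ∩ bandAtoms (j + 1), jump p ∂(intensity ν) =
      ∫ q in bandMarks (j + 1), (q.2 : ℝ) * max (inner ℝ (q.1 : Space d) t : ℝ) 0 ∂ν := by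
  have := hν.sigmaFinite
  have hS := measurableSet_separating_inter t (j + 1)
  have hint : Integrable ((separating t ∩ bandAtoms (j + 1)).indicator jump)
      ((Measure.comap ((↑) : Ioi (0 : ℝ) → ℝ) volume).prod ν) :=
    (integrable_indicator_iff hS).2
      (integrableOn_jump hS inter_subset_right (hν.intensity_separating_lt_top _ t))
  rw [← integral_indicator hS, ← integral_indicator (measurableSet_bandMarks _), intensity,
    integral_prod_symm _ hint]
  congr 1
  ext q
  by_cases hq : q ∈ bandMarks (j + 1)
  · rw [indicator_of_mem hq]
    have h1 : (fun ρ : Ioi (0 : ℝ) =>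
        (separating t ∩ bandAtoms (j + 1)).indicator (jump : AtomSpace d → ℝ) (ρ, q)) =
        {ρ : Ioi (0 : ℝ) | (ρ : ℝ) < inner ℝ (q.1 : Space d) t}.indicator fun _ => (q.2 : ℝ) := by
      ext ρ
      by_cases hρ : (ρ : ℝ) < inner ℝ (q.1 : Space d) t
      · rw [indicator_of_mem (show ((ρ, q) : AtomSpace d) ∈ separating t ∩ bandAtoms (j + 1) from
          ⟨hρ, hq⟩)]
        exact (indicator_of_mem (s := {ρ : Ioi (0 : ℝ) | (ρ : ℝ) < inner ℝ (q.1 : Space d) t}) hρ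
          fun _ => (q.2 : ℝ)).symm
      · rw [indicator_of_notMem (fun h => hρ h.1)]
        exact (indicator_of_notMem
          (s := {ρ : Ioi (0 : ℝ) | (ρ : ℝ) < inner ℝ (q.1 : Space d) t}) hρ
          fun _ => (q.2 : ℝ)).symm
    rw [h1, integral_indicator_const _ (measurableSet_lt measurable_subtype_coe measurable_const),
      measureReal_radial_lt, smul_eq_mul, mul_comm]
  · rw [indicator_of_notMem hq]
    have h1 : (fun ρ : Ioi (0 : ℝ) =>
        (separating t ∩ bandAtoms (j + 1)).indicator (jump : AtomSpace d → ℝ) (ρ, q)) =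
        fun _ => 0 := by
      ext ρ
      exact indicator_of_notMem (fun h => hq h.2) _
    rw [h1, integral_zero]

/-- The compensator of a layer is linear. -/
lemma setIntegral_intensity_eq_inner (hν : IsAdmissible ν) (j : ℕ) (t : Space d) :
    ∫ p in separating t ∩ bandAtoms (j + 1), jump p ∂(intensity ν) =
      inner ℝ (drift ν (j + 1)) t := by
  set g : MarkSpace d → ℝ := fun q => (q.2 : ℝ) * max (inner ℝ (q.1 : Space d) t : ℝ) 0 with hg
  have hgm : Measurable g :=
    measurable_size.mul ((measurable_direction.inner_const).max measurable_const)
  set A : Set (MarkSpace d) := bandMarks (j + 1) with hA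
  have hAm : MeasurableSet A := measurableSet_bandMarks _
  have hrefl : ∀ q, reflect q ∈ A ↔ q ∈ A := fun q => by
    change |-(q.2 : ℝ)| ∈ band (j + 1) ↔ |(q.2 : ℝ)| ∈ band (j + 1)
    rw [abs_neg]
  have hint : IntegrableOn g A ν := by
    refine Measure.integrableOn_of_bounded (M := (2 : ℝ)⁻¹ ^ j * ‖t‖) ?_
      hgm.aestronglyMeasurable ?_
    · rw [hν.measure_bandMarks_eq_ofReal]
      exact ENNReal.ofReal_ne_top
    · refine (ae_restrict_iff' hAm).2 (ae_of_all _ fun q hq => ?_)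
      rw [hg, norm_mul]
      refine mul_le_mul (mem_band_succ.1 hq).2 ?_ (norm_nonneg _) (by positivity)
      rw [Real.norm_of_nonneg (le_max_right _ _)]
      refine max_le ?_ (norm_nonneg _)
      have := real_inner_le_norm (q.1 : Space d) t
      rwa [show ‖(q.1 : Space d)‖ = 1 by simp, one_mul] at this
  -- Averaging the integrand with its reflection replaces the positive part by a linear function,
  -- since `max c 0 - max (-c) 0 = c`; hence the factor `½` in `drift`.
  have h1 : ∫ q in A, g q ∂ν = ∫ q in A, g (reflect q) ∂ν := by
    rw [← integral_indicator hAm, ← integral_indicator hAm]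
    conv_lhs => rw [← hν.symmetric]
    rw [integral_map measurable_reflect.aemeasurable
      (hgm.indicator hAm).aestronglyMeasurable]
    congr 1
    ext q
    by_cases hq : q ∈ A
    · rw [indicator_of_mem hq, indicator_of_mem ((hrefl q).2 hq)]
    · rw [indicator_of_notMem hq, indicator_of_notMem (fun h => hq ((hrefl q).1 h))]
  have hint' : IntegrableOn (fun q => g (reflect q)) A ν := by
    have h2 := (hν.measurePreserving_reflect.integrable_comp
      (hgm.indicator hAm).aestronglyMeasurable).2 ((integrable_indicator_iff hAm).2 hint)
    refine (integrable_indicator_iff hAm).1 (h2.congr (ae_of_all _ fun q => ?_))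
    by_cases hq : q ∈ A
    · simp only [Function.comp_apply]
      rw [indicator_of_mem hq, indicator_of_mem ((hrefl q).2 hq)]
    · simp only [Function.comp_apply]
      rw [indicator_of_notMem hq, indicator_of_notMem (fun h => hq ((hrefl q).1 h))]
  have h3 : ∫ q in A, g q ∂ν + ∫ q in A, g (reflect q) ∂ν =
      ∫ q in A, (inner ℝ t ((q.2 : ℝ) • (q.1 : Space d)) : ℝ) ∂ν := by
    rw [← integral_add hint hint']
    congr 1
    ext q
    have h4 : g (reflect q) = -(q.2 : ℝ) * max (-(inner ℝ (q.1 : Space d) t : ℝ)) 0 := by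
      rw [← inner_neg_left]
      rfl
    rw [h4, hg, inner_smul_right, real_inner_comm (q.1 : Space d) t]
    dsimp only
    rcases le_total (inner ℝ (q.1 : Space d) t : ℝ) 0 with h | h
    · rw [max_eq_right h, max_eq_left (by linarith)]
      ring
    · rw [max_eq_left h, max_eq_right (by linarith)]
      ring
  rw [hν.setIntegral_intensity_eq, drift, real_inner_smul_left, real_inner_comm,
    ← integral_inner (hν.integrableOn_mark j), ← h3, ← h1]
  ring

end IsAdmissible

end Compensator

/-! ### Local finiteness of the atoms and distinctness of their coordinates `ρ`. -/

section Atoms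

variable {d : ℕ}

/-- The atoms with `ρ ≤ R` and `|x| > ε`. -/
def largeAtoms (d : ℕ) (R ε : ℝ) : Set (AtomSpace d) := {p | dist0 p ≤ R} ∩ {p | ε < |jump p|}

lemma measurableSet_largeAtoms (R ε : ℝ) : MeasurableSet (largeAtoms d R ε) :=
  (measurableSet_le measurable_dist0 measurable_const).inter
    (measurableSet_lt measurable_const measurable_jump.abs)

lemma sum_dirac_apply {X ι : Type*} [MeasurableSpace X] (a : ι → X) {S : Set X}
    (hS : MeasurableSet S) :
    Measure.sum (fun i => Measure.dirac (a i)) S = {i | a i ∈ S}.encard := by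
  rw [Measure.sum_apply _ hS, ← ENNReal.tsum_set_one, tsum_subtype _ fun _ => (1 : ℝ≥0∞)]
  refine tsum_congr fun i => ?_
  rw [Measure.dirac_apply' _ hS]
  rfl

lemma two_le_sum_dirac {X ι : Type*} [MeasurableSpace X] (a : ι → X) {S : Set X}
    (hS : MeasurableSet S) {i i' : ι} (hne : i ≠ i') (hi : a i ∈ S) (hi' : a i' ∈ S) :
    2 ≤ Measure.sum (fun i => Measure.dirac (a i)) S := by
  have h : ({i, i'} : Set ι).encard ≤ {i | a i ∈ S}.encard := encard_le_encard (by
    rintro k (rfl | rfl) <;> assumption)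
  rw [encard_pair hne] at h
  rw [sum_dirac_apply a hS]
  exact_mod_cast h

/-- The slab of atoms with `ρ ∈ (i R / q, (i + 1) R / q]` and `|x| > ε`. -/
def slab (d : ℕ) (R ε : ℝ) (q i : ℕ) : Set (AtomSpace d) :=
  {p | i * (R / q) < dist0 p ∧ dist0 p ≤ i * (R / q) + R / q} ∩ {p | ε < |jump p|}

lemma measurableSet_slab (R ε : ℝ) (q i : ℕ) : MeasurableSet (slab d R ε q i) :=
  ((measurableSet_lt measurable_const measurable_dist0).inter
    (measurableSet_le measurable_dist0 measurable_const)).inter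
    (measurableSet_lt measurable_const measurable_jump.abs)

/-- The slab depends on `ρ` alone, so two atoms with equal `ρ` and jumps above `ε` share it. -/
lemma exists_mem_slab {R ε : ℝ} (q : ℕ) (hq : 0 < q) {p : AtomSpace d} (hp : dist0 p ≤ R) :
    ∃ i < q, ∀ p' : AtomSpace d, dist0 p' = dist0 p → ε < |jump p'| → p' ∈ slab d R ε q i := by
  have h0 := dist0_pos p
  have hR : 0 < R := h0.trans_le hp
  have hq' : (0 : ℝ) < q := by exact_mod_cast hq
  have hpos : 0 < dist0 p / (R / q) := by positivity
  -- The slabs are open on the left and closed on the right, so the index is the ceiling minus one,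
  -- not the floor.
  obtain ⟨i, hi⟩ : ∃ i, ⌈dist0 p / (R / q)⌉₊ = i + 1 :=
    Nat.exists_eq_succ_of_ne_zero (Nat.ceil_pos.2 hpos).ne'
  have h1 : dist0 p / (R / q) ≤ (i : ℝ) + 1 := by
    have := Nat.le_ceil (dist0 p / (R / q))
    rw [hi] at this
    exact_mod_cast this
  have h2 : (i : ℝ) < dist0 p / (R / q) := by
    have := Nat.ceil_lt_add_one hpos.le
    rw [hi] at this
    push_cast at this
    linarith
  rw [div_le_iff₀ (by positivity)] at h1
  rw [lt_div_iff₀ (by positivity)] at h2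
  refine ⟨i, ?_, fun p' h3 h4 => ⟨⟨by rw [h3]; exact h2, by rw [h3]; linarith⟩, h4⟩⟩
  have h5 : (i : ℝ) * (R / q) < q * (R / q) := by
    rw [mul_div_cancel₀ _ hq'.ne']
    exact h2.trans_le hp
  exact_mod_cast lt_of_mul_lt_mul_right h5 (by positivity)

variable {Ω : Type*} [MeasurableSpace Ω] {P : Measure Ω}
  {ν : Measure (MarkSpace d)} {N : Ω → Measure (AtomSpace d)}

lemma IsAdmissible.intensity_largeAtoms_lt_top (hν : IsAdmissible ν) (R : ℝ) {ε : ℝ}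
    (hε : 0 < ε) : intensity ν (largeAtoms d R ε) < ∞ := by
  refine (measure_mono ?_).trans_lt ((hν.intensity_slab_le 0 R ε).trans_lt
    (ENNReal.mul_lt_top ENNReal.ofReal_lt_top (hν.measure_size_gt_lt_top hε)))
  intro p hp
  exact ⟨⟨dist0_pos p, by rw [zero_add]; exact hp.1⟩, hp.2⟩

lemma ae_largeAtoms_lt_top (hν : IsAdmissible ν) (hN : IsPoissonRandomMeasure P (intensity ν) N) :
    ∀ᵐ ω ∂P, ∀ R ε : ℝ, 0 < ε → N ω (largeAtoms d R ε) < ∞ := by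
  have h : ∀ᵐ ω ∂P, ∀ R k : ℕ, N ω (largeAtoms d R (1 / ((k : ℝ) + 1))) < ∞ := by
    simp_rw [ae_all_iff]
    exact fun R k => hN.ae_lt_top (measurableSet_largeAtoms _ _)
      (hν.intensity_largeAtoms_lt_top _ (by positivity))
  filter_upwards [h] with ω hω R ε hε
  obtain ⟨k, hk⟩ := exists_nat_one_div_lt hε
  obtain ⟨R', hR'⟩ := exists_nat_ge R
  refine (measure_mono ?_).trans_lt (hω R' k)
  exact fun p hp => ⟨le_trans hp.1 hR', hk.trans hp.2⟩

/-- Each of `q` slabs has intensity `O(1/q)`, so it holds two atoms with probability `O(1/q²)`, and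
some slab does with probability `O(1/q)`. The event that this happens for every `q` is therefore
null. -/
lemma ae_slab_lt_two (hν : IsAdmissible ν) (hN : IsPoissonRandomMeasure P (intensity ν) N) :
    ∀ᵐ ω ∂P, ∀ R k : ℕ, ∃ q : ℕ, 0 < q ∧ ∀ i < q, N ω (slab d R (1 / ((k : ℝ) + 1)) q i) < 2 := by
  simp_rw [ae_all_iff]
  intro R k
  set Λ := ν {q | 1 / ((k : ℝ) + 1) < |(q.2 : ℝ)|} with hΛ
  have hΛt : Λ < ∞ := hν.measure_size_gt_lt_top (by positivity)
  have hbound : ∀ q i : ℕ, intensity ν (slab d R (1 / ((k : ℝ) + 1)) (q + 1) i) ≤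
      ENNReal.ofReal ((R * Λ.toReal) / (q + 1)) := fun q i => by
    refine (hν.intensity_slab_le _ _ _).trans_eq ?_
    rw [← hΛ, ← ENNReal.ofReal_toReal hΛt.ne, ← ENNReal.ofReal_mul (by positivity),
      ENNReal.toReal_ofReal ENNReal.toReal_nonneg]
    congr 1
    push_cast
    ring
  set S : ℕ → Set Ω := fun q => ⋃ i ∈ Finset.range (q + 1),
    {ω | 2 ≤ N ω (slab d R (1 / ((k : ℝ) + 1)) (q + 1) i)} with hS
  have hPS : ∀ q, P (S q) ≤ ENNReal.ofReal ((R * Λ.toReal) ^ 2 * (1 / ((q : ℝ) + 1))) := fun q => by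
    calc P (S q) ≤ ∑ i ∈ Finset.range (q + 1),
          P {ω | 2 ≤ N ω (slab d R (1 / ((k : ℝ) + 1)) (q + 1) i)} :=
          measure_biUnion_finset_le _ _
      _ ≤ ∑ i ∈ Finset.range (q + 1), ENNReal.ofReal (((R * Λ.toReal) / (q + 1)) ^ 2) := by
          refine Finset.sum_le_sum fun i _ => ?_
          refine (hN.measure_two_le_count (measurableSet_slab _ _ _ _)
            ((hbound q i).trans_lt ENNReal.ofReal_lt_top)).trans ?_
          rw [ENNReal.ofReal_pow (by positivity)]
          gcongr
          exact hbound q i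
      _ = _ := by
          rw [Finset.sum_const, Finset.card_range, nsmul_eq_mul, ← ENNReal.ofReal_natCast,
            ← ENNReal.ofReal_mul (by positivity)]
          congr 1
          push_cast
          field_simp
  have hlim : Tendsto (fun q : ℕ => ENNReal.ofReal ((R * Λ.toReal) ^ 2 * (1 / ((q : ℝ) + 1))))
      atTop (𝓝 0) := by
    rw [← ENNReal.ofReal_zero]
    refine ENNReal.tendsto_ofReal ?_
    simpa using tendsto_one_div_add_atTop_nhds_zero_nat.const_mul ((R * Λ.toReal) ^ 2)
  have hnull : P (⋂ q, S q) = 0 := le_antisymm (ge_of_tendsto' hlim fun q =>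
    (measure_mono (iInter_subset S q)).trans (hPS q)) zero_le
  filter_upwards [compl_mem_ae_iff.2 hnull] with ω hω
  simp only [hS, mem_compl_iff, mem_iInter, mem_iUnion, not_forall, not_exists] at hω
  obtain ⟨q, hq⟩ := hω
  exact ⟨q + 1, q.succ_pos, fun i hi => not_le.1 (hq i (Finset.mem_range.2 hi))⟩

lemma ae_exists_atoms (hν : IsAdmissible ν) (hN : IsPoissonRandomMeasure P (intensity ν) N) :
    ∀ᵐ ω ∂P, ∃ (I : Set ℕ) (a : I → AtomSpace d),
      N ω = Measure.sum (fun i => Measure.dirac (a i)) ∧ Function.Injective (dist0 ∘ a) := by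
  filter_upwards [hN.pointMeasure, ae_slab_lt_two hν hN] with ω ⟨I, a, ha⟩ hω
  refine ⟨I, a, ha, fun i i' hii' => ?_⟩
  by_contra hne
  obtain ⟨R, hR⟩ := exists_nat_ge (dist0 (a i))
  obtain ⟨k, hk⟩ := exists_nat_one_div_lt
    (lt_min (abs_pos.2 (jump_ne_zero (a i))) (abs_pos.2 (jump_ne_zero (a i'))))
  obtain ⟨q, hq, hlt⟩ := hω R k
  obtain ⟨m, hm, hmem⟩ := exists_mem_slab (ε := 1 / ((k : ℝ) + 1)) q hq hR
  refine (hlt m hm).not_ge ?_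
  rw [ha]
  exact two_le_sum_dirac a (measurableSet_slab _ _ _ _) hne
    (hmem _ rfl (hk.trans_le (min_le_left _ _)))
    (hmem _ hii'.symm (hk.trans_le (min_le_right _ _)))

end Atoms

/-! ### Lattices of mesh `4^{-j}` and a Borel–Cantelli argument over them. -/

section Grid

variable {d : ℕ}

/-- The points of the lattice `4^{-j} ℤ^d` in a cube containing the ball of radius `R`. -/
def grid (d R j : ℕ) : Finset (Space d) :=
  (Fintype.piFinset fun _ : Fin d => Finset.Icc (-((R * 4 ^ j + 1 : ℕ) : ℤ)) (R * 4 ^ j + 1 : ℕ)).image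
    fun z => WithLp.toLp 2 fun i => (4 : ℝ)⁻¹ ^ j * z i

lemma card_grid_le (d R j : ℕ) :
    ((grid d R j).card : ℝ) ≤ (2 * R + 3) ^ d * Real.exp (2 * d * j) := by
  have h1 : (grid d R j).card ≤ (2 * (R * 4 ^ j + 1) + 1) ^ d := by
    refine Finset.card_image_le.trans_eq ?_
    rw [Fintype.card_piFinset, Finset.prod_const, Finset.card_univ, Fintype.card_fin, Int.card_Icc]
    congr 1
    omega
  have h2 : (4 : ℝ) ^ j ≤ Real.exp (2 * j) := by
    -- Exponential form of the cardinality, to be compared with the tails `exp (-level d j)`.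
    have h3 : (4 : ℝ) ≤ Real.exp 2 := by
      have := Real.add_one_le_exp (1 : ℝ)
      rw [show (2 : ℝ) = 1 + 1 by norm_num, Real.exp_add]
      nlinarith
    calc (4 : ℝ) ^ j ≤ Real.exp 2 ^ j := by gcongr
      _ = Real.exp (2 * j) := by rw [← Real.exp_nat_mul, mul_comm]
  calc ((grid d R j).card : ℝ) ≤ (2 * (R * 4 ^ j + 1) + 1 : ℝ) ^ d := by exact_mod_cast h1
    _ ≤ ((2 * R + 3) * 4 ^ j : ℝ) ^ d := by
        gcongr
        have : (1 : ℝ) ≤ 4 ^ j := one_le_pow₀ (by norm_num)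
        linarith
    _ = (2 * R + 3) ^ d * (4 ^ j) ^ d := by rw [mul_pow]
    _ ≤ (2 * R + 3) ^ d * Real.exp (2 * j) ^ d := by gcongr
    _ = _ := by
        rw [← Real.exp_nat_mul]
        ring_nf

lemma norm_le_of_coord_le {x : Space d} {η : ℝ} (hη : 0 ≤ η) (h : ∀ i, |x i| ≤ η) :
    ‖x‖ ≤ d * η := by
  rw [EuclideanSpace.norm_eq, Real.sqrt_le_iff]
  refine ⟨by positivity, ?_⟩
  calc ∑ i, ‖x i‖ ^ 2 ≤ ∑ _i : Fin d, η ^ 2 :=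
        Finset.sum_le_sum fun i _ => pow_le_pow_left₀ (norm_nonneg _) (h i) 2
    _ = d * η ^ 2 := by simp
    _ ≤ (d * d) * η ^ 2 := by
        have : (d : ℝ) ≤ d * d := by exact_mod_cast Nat.le_mul_self d
        gcongr
    _ = (d * η) ^ 2 := by ring

lemma exists_mem_grid {R j : ℕ} {t : Space d} (ht : ‖t‖ ≤ R) :
    ∃ t' ∈ grid d R j, ‖t - t'‖ ≤ d * (4 : ℝ)⁻¹ ^ j := by
  refine ⟨WithLp.toLp 2 fun i => (4 : ℝ)⁻¹ ^ j * (⌊t i * 4 ^ j⌋ : ℤ), ?_, ?_⟩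
  · refine Finset.mem_image.2 ⟨fun i => ⌊t i * 4 ^ j⌋, ?_, rfl⟩
    refine Fintype.mem_piFinset.2 fun i => ?_
    have h1 := abs_le.1 ((PiLp.norm_apply_le t i).trans ht)
    have h4 : (0 : ℝ) < 4 ^ j := by positivity
    have h2 := Int.floor_le (t i * 4 ^ j)
    have h3 := Int.lt_floor_add_one (t i * 4 ^ j)
    have h5 := mul_le_mul_of_nonneg_right h1.1 h4.le
    have h6 := mul_le_mul_of_nonneg_right h1.2 h4.le
    refine Finset.mem_Icc.2 ⟨?_, ?_⟩
    · have : (-((R * 4 ^ j + 1 : ℕ) : ℤ) : ℝ) ≤ (⌊t i * 4 ^ j⌋ : ℤ) := by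
        push_cast
        linarith
      exact_mod_cast this
    · have : ((⌊t i * 4 ^ j⌋ : ℤ) : ℝ) ≤ ((R * 4 ^ j + 1 : ℕ) : ℤ) := by
        push_cast
        linarith
      exact_mod_cast this
  · refine norm_le_of_coord_le (by positivity) fun i => ?_
    have h4 : (0 : ℝ) < 4 ^ j := by positivity
    have h2 := Int.floor_le (t i * 4 ^ j)
    have h3 := Int.lt_floor_add_one (t i * 4 ^ j)
    have e : (t - WithLp.toLp 2 fun i => (4 : ℝ)⁻¹ ^ j * (⌊t i * 4 ^ j⌋ : ℤ)) i =
        (4 : ℝ)⁻¹ ^ j * (t i * 4 ^ j - (⌊t i * 4 ^ j⌋ : ℤ)) := by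
      rw [PiLp.sub_apply, mul_sub, inv_pow, ← mul_assoc, mul_comm _ (t i), mul_assoc,
        inv_mul_cancel₀ h4.ne', mul_one]
    rw [e, abs_mul, abs_of_pos (by positivity)]
    refine mul_le_of_le_one_right (by positivity) ?_
    rw [abs_le]
    constructor <;> linarith

/-- The surplus `c + 1` over the growth rate `c` of the grids leaves the summable bound `O(e^{-j})`
after the union bound. -/
lemma ae_eventually_forall_notMem {Ω ι : Type*} [MeasurableSpace Ω] {P : Measure Ω}
    (G : ℕ → Finset ι) (E : ℕ → ι → Set Ω) {C c : ℝ}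
    (hG : ∀ j, ((G j).card : ℝ) ≤ C * Real.exp (c * j))
    (hE : ∀ j, ∀ i ∈ G j, P (E j i) ≤ 2 * ENNReal.ofReal (Real.exp (-((c + 1) * (j + 1))))) :
    ∀ᵐ ω ∂P, ∀ᶠ j in atTop, ∀ i ∈ G j, ω ∉ E j i := by
  have hsum : Summable fun j : ℕ => C * 2 * Real.exp (-(c + 1)) * Real.exp (-j) :=
    Real.summable_exp_neg_nat.mul_left _
  have h : ∑' j, P (⋃ i ∈ G j, E j i) ≠ ∞ := by
    refine ne_top_of_le_ne_top (hsum.tsum_ofReal_ne_top) (ENNReal.tsum_le_tsum fun j => ?_)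
    calc P (⋃ i ∈ G j, E j i) ≤ ∑ i ∈ G j, P (E j i) := measure_biUnion_finset_le _ _
      _ ≤ ∑ i ∈ G j, 2 * ENNReal.ofReal (Real.exp (-((c + 1) * (j + 1)))) :=
          Finset.sum_le_sum (hE j)
      _ = ENNReal.ofReal ((G j).card * (2 * Real.exp (-((c + 1) * (j + 1))))) := by
          rw [Finset.sum_const, nsmul_eq_mul, ENNReal.ofReal_mul (by positivity),
            ENNReal.ofReal_mul zero_le_two, ENNReal.ofReal_natCast, ENNReal.ofReal_ofNat]
      _ ≤ ENNReal.ofReal (C * Real.exp (c * j) * (2 * Real.exp (-((c + 1) * (j + 1))))) := by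
          gcongr
          exact hG j
      _ = _ := by
          congr 1
          rw [show C * Real.exp (c * j) * (2 * Real.exp (-((c + 1) * (j + 1)))) =
            C * 2 * (Real.exp (c * j) * Real.exp (-((c + 1) * (j + 1)))) by ring,
            mul_assoc (C * 2), ← Real.exp_add, ← Real.exp_add]
          ring_nf
  filter_upwards [ae_eventually_notMem h] with ω hω
  filter_upwards [hω] with j hj i hi hmem
  exact hj (mem_biUnion hi hmem)

end Grid

/-! ### Increments of a layer as compensated Poisson integrals. -/

section Increments

variable {d : ℕ}

lemma two_inv_mul_two_pow (j : ℕ) : (2 : ℝ)⁻¹ ^ j * 2 ^ j = 1 := by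
  rw [← mul_pow, inv_mul_cancel₀ two_ne_zero, one_pow]

/-- The jumps of the band `j + 1`, rescaled by `2^j`, counted positively if they are picked up
between `t` and `u` and negatively if they are lost. -/
def signedJump (j : ℕ) (t u : Space d) (p : AtomSpace d) : ℝ :=
  2 ^ j * ((separating u ∩ bandAtoms (j + 1)).indicator jump p -
    (separating t ∩ bandAtoms (j + 1)).indicator jump p)

lemma measurable_signedJump (j : ℕ) (t u : Space d) : Measurable (signedJump j t u) :=
  ((measurable_jump.indicator (measurableSet_separating_inter u _)).sub
    (measurable_jump.indicator (measurableSet_separating_inter t _))).const_mul _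

lemma abs_two_pow_mul_jump_le {j : ℕ} {p : AtomSpace d} (hp : p ∈ bandAtoms (j + 1)) :
    |2 ^ j * jump p| ≤ 1 := by
  rw [abs_mul, abs_of_pos (by positivity), ← two_inv_mul_two_pow j, mul_comm]
  exact mul_le_mul_of_nonneg_right (mem_band_succ.1 hp).2 (by positivity)

lemma abs_signedJump_le (j : ℕ) (t u : Space d) (p : AtomSpace d) : |signedJump j t u p| ≤ 1 := by
  rw [signedJump]
  by_cases hb : p ∈ bandAtoms (j + 1)
  · have h := abs_two_pow_mul_jump_le hb
    by_cases hu : p ∈ separating u <;> by_cases ht : p ∈ separating t <;>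
      first
      | (simp [indicator, hb, hu, ht]; done)
      | simpa [indicator, hb, hu, ht] using h
  · simp [indicator, hb]

lemma signedJump_eq_zero {j : ℕ} {t u : Space d} {p : AtomSpace d}
    (hp : p ∉ bandAtoms (j + 1) ∩ symmDiff (separating t) (separating u)) :
    signedJump j t u p = 0 := by
  rw [signedJump]
  by_cases hb : p ∈ bandAtoms (j + 1)
  · by_cases hu : p ∈ separating u <;> by_cases ht : p ∈ separating t <;>
      simp_all [indicator, mem_symmDiff]
  · simp [indicator, hb]

lemma setIntegral_signedJump {μ : Measure (AtomSpace d)} {j : ℕ} {t u : Space d}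
    (ht : μ (separating t ∩ bandAtoms (j + 1)) < ∞)
    (hu : μ (separating u ∩ bandAtoms (j + 1)) < ∞) :
    ∫ p in separating u ∩ bandAtoms (j + 1), jump p ∂μ -
        ∫ p in separating t ∩ bandAtoms (j + 1), jump p ∂μ =
      (2 : ℝ)⁻¹ ^ j * ∫ p in bandAtoms (j + 1) ∩ symmDiff (separating t) (separating u),
        signedJump j t u p ∂μ := by
  have hmt := measurableSet_separating_inter t (j + 1)
  have hmu := measurableSet_separating_inter u (j + 1)
  rw [setIntegral_eq_integral_of_forall_compl_eq_zero fun p hp => signedJump_eq_zero hp]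
  simp only [signedJump]
  rw [integral_const_mul, ← mul_assoc, two_inv_mul_two_pow, one_mul,
    integral_sub ((integrable_indicator_iff hmu).2 (integrableOn_jump hmu inter_subset_right hu))
      ((integrable_indicator_iff hmt).2 (integrableOn_jump hmt inter_subset_right ht)),
    integral_indicator hmu, integral_indicator hmt]

lemma separating_inter_subset_largeAtoms {j : ℕ} {t : Space d} {R : ℝ} (ht : ‖t‖ ≤ R) :
    separating t ∩ bandAtoms (j + 1) ⊆ largeAtoms d R ((2 : ℝ)⁻¹ ^ (j + 1)) := fun p hp =>
  ⟨((show dist0 p < inner ℝ (normal p) t from hp.1).le.trans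
    ((le_abs_self _).trans (abs_inner_normal_le p t))).trans ht, (mem_band_succ.1 hp.2).1⟩

variable {ν : Measure (MarkSpace d)}

lemma layer_succ (hν : IsAdmissible ν) (n : Measure (AtomSpace d)) (j : ℕ) (t : Space d) :
    layer ν n (j + 1) t = ∫ p in separating t ∩ bandAtoms (j + 1), jump p ∂n -
      inner ℝ (drift ν (j + 1)) t := by
  rw [← hν.setIntegral_intensity_eq_inner]
  rfl

/-- The rescaling by `2^j` gives an integrand bounded by `1` and supported on the atoms between `t`
and `u`, as the tail bound requires. -/
lemma layer_sub_eq_signedJump (hν : IsAdmissible ν) {n : Measure (AtomSpace d)} {j : ℕ}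
    {t u : Space d} (ht : n (separating t ∩ bandAtoms (j + 1)) < ∞)
    (hu : n (separating u ∩ bandAtoms (j + 1)) < ∞) :
    layer ν n (j + 1) u - layer ν n (j + 1) t = (2 : ℝ)⁻¹ ^ j *
      (∫ p in bandAtoms (j + 1) ∩ symmDiff (separating t) (separating u), signedJump j t u p ∂n -
        ∫ p in bandAtoms (j + 1) ∩ symmDiff (separating t) (separating u), signedJump j t u p
          ∂(intensity ν)) := by
  rw [mul_sub, ← setIntegral_signedJump ht hu, ← setIntegral_signedJump
    (hν.intensity_separating_lt_top _ t) (hν.intensity_separating_lt_top _ u)]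
  change (_ - _) - (_ - _) = _
  simp only [bandAtoms]
  ring

/-- Between nearby points, a layer varies by at most the jumps across hyperplanes in between. -/
lemma abs_layer_sub_le_of_near (hν : IsAdmissible ν) {n : Measure (AtomSpace d)} {j : ℕ}
    {t u : Space d} {η : ℝ} (htu : ‖u - t‖ ≤ η)
    (ht : n (separating t ∩ bandAtoms (j + 1)) < ∞)
    (hu : n (separating u ∩ bandAtoms (j + 1)) < ∞)
    (hs : n (closedStrip (j + 1) η t) < ∞) :
    |layer ν n (j + 1) u - layer ν n (j + 1) t| ≤
      (2 : ℝ)⁻¹ ^ j * (n.real (closedStrip (j + 1) η t) + bandReal ν (j + 1) * η) := by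
  set B := bandAtoms (j + 1) ∩ symmDiff (separating t) (separating u) with hB
  have hsub : B ⊆ closedStrip (j + 1) η t := fun p hp =>
    ⟨hp.1, (mem_symmDiff_separating hp.2).1.trans htu⟩
  have h1 : |∫ p in B, signedJump j t u p ∂n| ≤ n.real (closedStrip (j + 1) η t) := by
    have h := norm_setIntegral_le_of_norm_le_const (μ := n) (s := B) (f := signedJump j t u)
      (C := 1) ((measure_mono hsub).trans_lt hs) fun p _ => abs_signedJump_le j t u p
    rw [one_mul] at h
    exact h.trans (measureReal_mono hsub hs.ne)
  have h2 : |(inner ℝ (drift ν (j + 1)) (u - t) : ℝ)| ≤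
      (2 : ℝ)⁻¹ ^ j * (bandReal ν (j + 1) * η) := by
    refine (abs_real_inner_le_norm _ _).trans ?_
    rw [← mul_assoc]
    exact mul_le_mul (hν.norm_drift_le j) htu (norm_nonneg _)
      (mul_nonneg (by positivity) (bandReal_nonneg _ _))
  have e : layer ν n (j + 1) u - layer ν n (j + 1) t =
      (2 : ℝ)⁻¹ ^ j * ∫ p in B, signedJump j t u p ∂n - inner ℝ (drift ν (j + 1)) (u - t) := by
    rw [hB, ← setIntegral_signedJump ht hu, layer_succ hν, layer_succ hν, inner_sub_right]
    ring
  rw [e, mul_add]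
  refine (abs_sub _ _).trans (add_le_add ?_ h2)
  rw [abs_mul, abs_of_pos (by positivity)]
  gcongr

end Increments

/-! ### Almost sure estimates at the lattice points. -/

section GridEvents

variable {d : ℕ} {Ω : Type*} [MeasurableSpace Ω] {P : Measure Ω}
  {ν : Measure (MarkSpace d)} {N : Ω → Measure (AtomSpace d)}

/-- The exponent of the deviation probabilities at level `j`. -/
def level (d j : ℕ) : ℝ := (4 * d + 1) * (j + 1)

lemma level_pos (d j : ℕ) : 0 < level d j := by
  rw [level]
  positivity

lemma card_grid_prod_le (d R j : ℕ) :
    ((grid d R j ×ˢ grid d R j).card : ℝ) ≤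
      ((2 * R + 3) ^ d * (2 * R + 3) ^ d) * Real.exp ((4 * d : ℝ) * j) := by
  rw [Finset.card_product, Nat.cast_mul]
  refine (mul_le_mul (card_grid_le d R j) (card_grid_le d R j) (by positivity)
    (by positivity)).trans_eq ?_
  rw [show (4 * d : ℝ) * j = 2 * d * j + 2 * d * j by ring, Real.exp_add]
  ring

lemma card_grid_le' (d R j : ℕ) :
    ((grid d R j).card : ℝ) ≤ (2 * R + 3) ^ d * Real.exp ((4 * d : ℝ) * j) := by
  refine (card_grid_le d R j).trans ?_
  gcongr
  norm_num

lemma separating_finite {n : Measure (AtomSpace d)}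
    (hn : ∀ R ε : ℝ, 0 < ε → n (largeAtoms d R ε) < ∞) (j : ℕ) (t : Space d) :
    n (separating t ∩ bandAtoms (j + 1)) < ∞ :=
  (measure_mono (separating_inter_subset_largeAtoms le_rfl)).trans_lt
    (hn ‖t‖ _ (by positivity))

lemma openStrip_subset_closedStrip (j : ℕ) (r : ℝ) (t : Space d) :
    openStrip j r t ⊆ closedStrip j r t :=
  inter_subset_inter_right _ fun p (hp : |dist0 p - inner ℝ (normal p) t| < r) => hp.le

lemma closedStrip_subset_largeAtoms (j : ℕ) (r : ℝ) (t : Space d) :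
    closedStrip (j + 1) r t ⊆ largeAtoms d (‖t‖ + r) ((2 : ℝ)⁻¹ ^ (j + 1)) := fun p hp => by
  have h1 := (abs_le.1 (show |dist0 p - inner ℝ (normal p) t| ≤ r from hp.2)).2
  have h2 := (le_abs_self _).trans (abs_inner_normal_le p t)
  exact ⟨show dist0 p ≤ ‖t‖ + r by linarith, (mem_band_succ.1 hp.1).1⟩

lemma closedStrip_finite {n : Measure (AtomSpace d)}
    (hn : ∀ R ε : ℝ, 0 < ε → n (largeAtoms d R ε) < ∞) (j : ℕ) (r : ℝ) (t : Space d) :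
    n (closedStrip (j + 1) r t) < ∞ :=
  (measure_mono (closedStrip_subset_largeAtoms j r t)).trans_lt (hn _ _ (by positivity))

lemma ae_eventually_grid_increment (hν : IsAdmissible ν)
    (hN : IsPoissonRandomMeasure P (intensity ν) N) (R : ℕ) :
    ∀ᵐ ω ∂P, ∀ᶠ j in atTop, ∀ t ∈ grid d R j, ∀ u ∈ grid d R j,
      |layer ν (N ω) (j + 1) u - layer ν (N ω) (j + 1) t| ≤ (2 : ℝ)⁻¹ ^ j *
        (2 * (√(level d j * (2 * bandReal ν (j + 1) * ‖u - t‖)) + level d j)) := by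
  set B : ℕ → Space d × Space d → Set (AtomSpace d) := fun j q =>
    bandAtoms (j + 1) ∩ symmDiff (separating q.1) (separating q.2) with hB
  have h := ae_eventually_forall_notMem (P := P) (c := 4 * d) (fun j => grid d R j ×ˢ grid d R j)
    (fun j q => {ω | 2 * (√(level d j * (2 * bandReal ν (j + 1) * ‖q.2 - q.1‖)) + level d j) ≤
      |∫ p in B j q, signedJump j q.1 q.2 p ∂(N ω) -
        ∫ p in B j q, signedJump j q.1 q.2 p ∂(intensity ν)|})
    (card_grid_prod_le d R) fun j q _ => by
      have hle := hν.intensity_symmDiff_le (j + 1) q.1 q.2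
      refine hN.measure_le_abs_setIntegral_sub (measurableSet_symmDiff_separating _ _ _)
        (hle.trans_lt ENNReal.ofReal_lt_top) (measurable_signedJump j q.1 q.2)
        (abs_signedJump_le j q.1 q.2) ?_ (level_pos d j)
      refine ENNReal.toReal_le_of_le_ofReal ?_ hle
      exact mul_nonneg (mul_nonneg zero_le_two (bandReal_nonneg _ _)) (norm_nonneg _)
  filter_upwards [h, ae_largeAtoms_lt_top hν hN] with ω hω hfin
  filter_upwards [hω] with j hj t ht u hu
  have h1 := not_le.1 (hj (t, u) (Finset.mem_product.2 ⟨ht, hu⟩))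
  rw [layer_sub_eq_signedJump hν (separating_finite hfin j t) (separating_finite hfin j u), abs_mul,
    abs_of_pos (by positivity)]
  exact mul_le_mul_of_nonneg_left h1.le (by positivity)

/-- Tail bound for the integrand `1`. A count in a strip about a lattice point controls the
variation of the layer over a whole cell, hence passes from the lattice to all points. -/
lemma ae_eventually_grid_count (hν : IsAdmissible ν)
    (hN : IsPoissonRandomMeasure P (intensity ν) N) (R : ℕ) (r : ℕ → ℝ) (hr : ∀ j, 0 ≤ r j) :
    ∀ᵐ ω ∂P, ∀ᶠ j in atTop, ∀ t ∈ grid d R j,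
      (N ω).real (closedStrip (j + 1) (r j) t) ≤ 4 * bandReal ν (j + 1) * r j +
        2 * (√(level d j * (4 * bandReal ν (j + 1) * r j)) + level d j) := by
  have hM : ∀ j, 0 ≤ 4 * bandReal ν (j + 1) * r j := fun j =>
    mul_nonneg (mul_nonneg (by norm_num) (bandReal_nonneg _ _)) (hr j)
  have hle : ∀ j (t : Space d), (intensity ν (closedStrip (j + 1) (r j) t)).toReal ≤
      4 * bandReal ν (j + 1) * r j := fun j t =>
    ENNReal.toReal_le_of_le_ofReal (hM j) (hν.intensity_closedStrip_le (j + 1) (hr j) t)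
  have h := ae_eventually_forall_notMem (P := P) (c := 4 * d) (fun j => grid d R j)
    (fun j t => {ω | 2 * (√(level d j * (4 * bandReal ν (j + 1) * r j)) + level d j) ≤
      |∫ p in closedStrip (j + 1) (r j) t, (1 : ℝ) ∂(N ω) -
        ∫ p in closedStrip (j + 1) (r j) t, (1 : ℝ) ∂(intensity ν)|})
    (card_grid_le' d R) fun j t _ =>
      hN.measure_le_abs_setIntegral_sub (measurableSet_closedStrip _ _ _)
        ((hν.intensity_closedStrip_le (j + 1) (hr j) t).trans_lt ENNReal.ofReal_lt_top)
        measurable_const (fun _ => by simp) (hle j t) (level_pos d j)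
  filter_upwards [h] with ω hω
  filter_upwards [hω] with j hj t ht
  have h1 := (abs_lt.1 (not_le.1 (hj t ht))).2
  rw [setIntegral_const, setIntegral_const, smul_eq_mul, smul_eq_mul, mul_one, mul_one] at h1
  have h2 := hle j t
  rw [← measureReal_def] at h2
  linarith

/-- A strip of intensity at least `level d j` is empty with probability at most `exp (-level d j)`.
-/
lemma ae_eventually_grid_occupied (hν : IsAdmissible ν)
    (hN : IsPoissonRandomMeasure P (intensity ν) N) (R : ℕ) (r : ℕ → ℝ) (hr : ∀ j, 0 ≤ r j) :
    ∀ᵐ ω ∂P, ∀ᶠ j in atTop, ∀ t ∈ grid d R j, level d j ≤ bandReal ν (j + 1) * r j →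
      N ω (openStrip (j + 1) (r j) t) ≠ 0 := by
  have h := ae_eventually_forall_notMem (P := P) (c := 4 * d) (fun j => grid d R j)
    (fun j t => {ω | level d j ≤ bandReal ν (j + 1) * r j ∧ N ω (openStrip (j + 1) (r j) t) = 0})
    (card_grid_le' d R) fun j t _ => by
      by_cases hk : level d j ≤ bandReal ν (j + 1) * r j
      · have hlt : intensity ν (openStrip (j + 1) (r j) t) < ∞ :=
          (measure_mono (openStrip_subset_closedStrip _ _ _)).trans_lt
          ((hν.intensity_closedStrip_le (j + 1) (hr j) t).trans_lt ENNReal.ofReal_lt_top)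
        have hle : level d j ≤ (intensity ν (openStrip (j + 1) (r j) t)).toReal :=
          hk.trans (ENNReal.ofReal_le_iff_le_toReal hlt.ne |>.1
            (hν.le_intensity_openStrip (j + 1) (hr j) t))
        refine (measure_mono fun ω hω => hω.2).trans
          ((hN.measure_count_eq_zero (measurableSet_openStrip _ _ _) hlt).trans_le ?_)
        refine le_trans ?_ (le_mul_of_one_le_left zero_le one_le_two)
        exact ENNReal.ofReal_le_ofReal (Real.exp_le_exp.2 (neg_le_neg hle))
      · simp [hk]
  filter_upwards [h] with ω hω
  filter_upwards [hω] with j hj t ht hk h0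
  exact hj t ht ⟨hk, h0⟩

end GridEvents

/-! ### Almost sure regularity of the sample. -/

section Regularity

variable {d : ℕ}

/-- The properties of the atoms that hold almost surely and imply the regularity results. -/
structure IsRegularSample (ν : Measure (MarkSpace d)) (n : Measure (AtomSpace d)) : Prop where
  atoms : ∃ (I : Set ℕ) (a : I → AtomSpace d),
    n = Measure.sum (fun i => Measure.dirac (a i)) ∧ Function.Injective (dist0 ∘ a)
  finite : ∀ R ε : ℝ, 0 < ε → n (largeAtoms d R ε) < ∞
  increment : ∀ R : ℕ, ∃ C : ℝ, ∀ (j : ℕ) (t u : Space d), ‖t‖ ≤ R → ‖u‖ ≤ R →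
    |layer ν n (j + 1) u - layer ν n (j + 1) t| ≤ C * ((2 : ℝ)⁻¹ ^ j *
      (√(((j : ℝ) + 1) * bandReal ν (j + 1) * ‖u - t‖) + (j + 1)))
  covering : ∀ α : ℚ, (1 / 2 : ℝ) < α → ∀ t ∉ approxSet n α, ∃ C : ℝ, ∀ j : ℕ,
    bandReal ν (j + 1) ≤ C * ((j + 1) * ((2 : ℝ)⁻¹ ^ (j + 1)) ^ (-(1 / (α : ℝ))))

lemma exists_forall_le_mul {f g : ℕ → ℝ} {C : ℝ} (hg : ∀ j, 0 < g j)
    (h : ∀ᶠ j in atTop, f j ≤ C * g j) : ∃ C', C ≤ C' ∧ ∀ j, f j ≤ C' * g j := by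
  obtain ⟨j₀, hj₀⟩ := eventually_atTop.1 h
  refine ⟨max C 0 + ∑ i ∈ Finset.range j₀, |f i| / g i,
    (le_max_left _ _).trans (le_add_of_nonneg_right (Finset.sum_nonneg fun i _ =>
      div_nonneg (abs_nonneg _) (hg i).le)), fun j => ?_⟩
  rw [add_mul]
  have h0 : 0 ≤ max C 0 * g j := mul_nonneg (le_max_right _ _) (hg j).le
  have h1 : 0 ≤ (∑ i ∈ Finset.range j₀, |f i| / g i) * g j :=
    mul_nonneg (Finset.sum_nonneg fun i _ => div_nonneg (abs_nonneg _) (hg i).le) (hg j).le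
  rcases le_or_gt j₀ j with hj | hj
  · have := hj₀ j hj
    have := mul_le_mul_of_nonneg_right (le_max_left C 0) (hg j).le
    linarith
  · have h2 : |f j| / g j ≤ ∑ i ∈ Finset.range j₀, |f i| / g i :=
      Finset.single_le_sum (f := fun i => |f i| / g i)
        (fun i _ => div_nonneg (abs_nonneg _) (hg i).le) (Finset.mem_range.2 hj)
    have h3 := mul_le_mul_of_nonneg_right h2 (hg j).le
    rw [div_mul_cancel₀ _ (hg j).ne'] at h3
    linarith [le_abs_self (f j)]

lemma sqrt_le_add_one (x : ℝ) (hx : 0 ≤ x) : √x ≤ x + 1 := by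
  rw [Real.sqrt_le_iff]
  constructor <;> nlinarith

/-- Interpolation of the increments of a layer from the grid. -/
lemma interpolation_bound {K C ν δ η δ' l : ℝ} (hK : 0 ≤ K) (hC : 0 ≤ C) (hν : 0 ≤ ν)
    (hδ : 0 ≤ δ) (hη : 0 ≤ η) (hl : 1 ≤ l) (hb : l * ν * η ≤ C) (hδ' : δ' ≤ δ + 2 * η) :
    2 * (√(K * l * (2 * ν * δ')) + K * l) +
      2 * (4 * ν * η + 2 * (√(K * l * (4 * ν * η)) + K * l) + ν * η) ≤
      (4 * K + 24 * K * C + 6 * K + 10 * C + 8) * (√(l * ν * δ) + l) := by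
  have h1 : ν * η ≤ C := by
    refine le_trans ?_ hb
    rw [mul_assoc]
    exact le_mul_of_one_le_left (by positivity) hl
  have hX : 0 ≤ √(l * ν * δ) := Real.sqrt_nonneg _
  have h2 : √(K * l * (2 * ν * δ')) ≤ (2 * K + 1) * √(l * ν * δ) + (4 * K * C + 1) := by
    calc √(K * l * (2 * ν * δ')) ≤ √(2 * K * (l * ν * δ) + 4 * K * C) := by
          refine Real.sqrt_le_sqrt ?_
          have : K * l * (2 * ν * δ') ≤ K * l * (2 * ν * (δ + 2 * η)) := by gcongr
          nlinarith
      _ ≤ √(2 * K * (l * ν * δ)) + √(4 * K * C) := by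
          rw [Real.sqrt_le_iff]
          have := Real.sqrt_nonneg (2 * K * (l * ν * δ))
          have := Real.sqrt_nonneg (4 * K * C)
          have := Real.sq_sqrt (show 0 ≤ 2 * K * (l * ν * δ) by positivity)
          have := Real.sq_sqrt (show 0 ≤ 4 * K * C by positivity)
          constructor <;> nlinarith
      _ = √(2 * K) * √(l * ν * δ) + √(4 * K * C) := by rw [Real.sqrt_mul (by positivity)]
      _ ≤ _ := by
          gcongr
          · exact sqrt_le_add_one _ (by positivity)
          · exact sqrt_le_add_one _ (by positivity)
  have h3 : √(K * l * (4 * ν * η)) ≤ 4 * K * C + 1 := by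
    refine (sqrt_le_add_one _ (by positivity)).trans ?_
    nlinarith
  have h4 : 0 ≤ (24 * K * C + 6 * K + 10 * C + 6) * √(l * ν * δ) := by positivity
  have h5 : 0 ≤ (24 * K * C + 10 * C + 6) * (l - 1) :=
    mul_nonneg (by positivity) (by linarith)
  have h6 : 0 ≤ (4 * K + 2) * l := by positivity
  nlinarith

variable {Ω : Type*} [MeasurableSpace Ω] {P : Measure Ω}
  {ν : Measure (MarkSpace d)} {N : Ω → Measure (AtomSpace d)}

/-- Both points are moved to the lattice. The increment between lattice points obeys the tail bound;
each displacement costs at most the number of hyperplanes in a strip of width `d 4^{-j}`, which is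
`O(j + 1)` because `(j + 1) ν_{j+1} = O(4^j)`. -/
lemma ae_increment (hν : IsAdmissible ν) (hN : IsPoissonRandomMeasure P (intensity ν) N) (R : ℕ) :
    ∀ᵐ ω ∂P, ∃ C : ℝ, ∀ (j : ℕ) (t u : Space d), ‖t‖ ≤ R → ‖u‖ ≤ R →
      |layer ν (N ω) (j + 1) u - layer ν (N ω) (j + 1) t| ≤ C * ((2 : ℝ)⁻¹ ^ j *
        (√(((j : ℝ) + 1) * bandReal ν (j + 1) * ‖u - t‖) + (j + 1))) := by
  obtain ⟨C₀, hC₀, hband⟩ := hν.exists_bandReal_le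
  set η : ℕ → ℝ := fun j => d * (4 : ℝ)⁻¹ ^ j with hη
  have hη0 : ∀ j, 0 ≤ η j := fun j => by positivity
  have hb : ∀ j : ℕ, ((j : ℝ) + 1) * bandReal ν (j + 1) * η j ≤ 4 * d * C₀ := fun j => by
    calc ((j : ℝ) + 1) * bandReal ν (j + 1) * η j ≤ C₀ * 4 ^ (j + 1) * η j :=
          mul_le_mul_of_nonneg_right (hband j) (hη0 j)
      _ = 4 * d * C₀ := by
          simp only [hη, inv_pow]
          field_simp
          ring
  filter_upwards [ae_eventually_grid_increment hν hN R, ae_eventually_grid_count hν hN R η hη0,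
    ae_largeAtoms_lt_top hν hN] with ω h1 h2 hfin
  classical
  set n := N ω with hn
  set C₁ : ℝ := 4 * (4 * d + 1) + 24 * (4 * d + 1) * (4 * d * C₀) + 6 * (4 * d + 1) +
    10 * (4 * d * C₀) + 8 with hC₁
  have hev : ∀ᶠ j in atTop, ∀ t u : Space d, ‖t‖ ≤ R → ‖u‖ ≤ R →
      |layer ν n (j + 1) u - layer ν n (j + 1) t| ≤ C₁ * ((2 : ℝ)⁻¹ ^ j *
        (√(((j : ℝ) + 1) * bandReal ν (j + 1) * ‖u - t‖) + (j + 1))) := by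
    filter_upwards [h1, h2] with j hj1 hj2 t u ht hu
    obtain ⟨t', ht', htt'⟩ := exists_mem_grid (j := j) ht
    obtain ⟨u', hu', huu'⟩ := exists_mem_grid (j := j) hu
    have e1 := hj1 t' ht' u' hu'
    have near : ∀ v v' : Space d, v' ∈ grid d R j → ‖v - v'‖ ≤ η j →
        |layer ν n (j + 1) v - layer ν n (j + 1) v'| ≤ (2 : ℝ)⁻¹ ^ j *
          (4 * bandReal ν (j + 1) * η j + 2 * (√(level d j * (4 * bandReal ν (j + 1) * η j)) +
            level d j) + bandReal ν (j + 1) * η j) := fun v v' hv' hvv' => by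
      refine (abs_layer_sub_le_of_near hν hvv' (separating_finite hfin j v')
        (separating_finite hfin j v) (closedStrip_finite hfin j _ v')).trans ?_
      gcongr
      exact hj2 v' hv'
    have e2 := near t t' ht' htt'
    have e3 := near u u' hu' huu'
    have htri : ‖u' - t'‖ ≤ ‖u - t‖ + 2 * η j := by
      have : u' - t' = (u - t) - (u - u') + (t - t') := by abel
      rw [this]
      refine (norm_add_le _ _).trans ?_
      have := norm_sub_le (u - t) (u - u')
      have e4 : ‖u - u'‖ ≤ η j := huu'
      have e5 : ‖t - t'‖ ≤ η j := htt'
      linarith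
    have key := interpolation_bound (K := 4 * d + 1) (l := (j : ℝ) + 1) (by positivity)
      (by positivity : 0 ≤ 4 * d * C₀) (bandReal_nonneg ν (j + 1)) (norm_nonneg (u - t)) (hη0 j)
      (by linarith [Nat.cast_nonneg (α := ℝ) j]) (hb j) htri
    have hsplit : layer ν n (j + 1) u - layer ν n (j + 1) t =
        (layer ν n (j + 1) u - layer ν n (j + 1) u') +
        (layer ν n (j + 1) u' - layer ν n (j + 1) t') -
        (layer ν n (j + 1) t - layer ν n (j + 1) t') := by ring
    rw [hsplit]
    refine (abs_sub _ _).trans ((add_le_add_left (abs_add_le _ _) _).trans ?_)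
    rw [level] at e1 e2 e3
    have hp : (0 : ℝ) < (2 : ℝ)⁻¹ ^ j := by positivity
    have := mul_le_mul_of_nonneg_left key hp.le
    calc _ ≤ _ := add_le_add (add_le_add e3 e1) e2
      _ ≤ _ := by
        rw [← mul_add, ← mul_add]
        refine le_trans (le_of_eq ?_) (this.trans_eq ?_)
        · ring
        · ring
  -- At the finitely many levels where the bound with `C₁` may fail, a crude count of the atoms of
  -- the band near the ball is used; it is uniform in `t` and `u`.
  obtain ⟨C₂, hC₂, hC₂'⟩ := exists_forall_le_mul (C := C₁) (g := fun _ => 1)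
    (f := fun j => if (∀ t u : Space d, ‖t‖ ≤ R → ‖u‖ ≤ R →
      |layer ν n (j + 1) u - layer ν n (j + 1) t| ≤ C₁ * ((2 : ℝ)⁻¹ ^ j *
        (√(((j : ℝ) + 1) * bandReal ν (j + 1) * ‖u - t‖) + (j + 1)))) then C₁ else
      n.real (largeAtoms d (R + 2 * R) ((2 : ℝ)⁻¹ ^ (j + 1))) + bandReal ν (j + 1) * (2 * R))
    (fun _ => one_pos) (by
      filter_upwards [hev] with j hj
      rw [if_pos hj, mul_one])
  refine ⟨C₂, fun j t u ht hu => ?_⟩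
  have h3 := hC₂' j
  rw [mul_one] at h3
  split_ifs at h3 with hif
  · refine (hif t u ht hu).trans ?_
    gcongr
  · have htu : ‖u - t‖ ≤ 2 * R := by linarith [norm_sub_le u t]
    refine (abs_layer_sub_le_of_near hν htu (separating_finite hfin j t)
      (separating_finite hfin j u) (closedStrip_finite hfin j _ t)).trans ?_
    have hsub : closedStrip (j + 1) (2 * R) t ⊆
        largeAtoms d (R + 2 * R) ((2 : ℝ)⁻¹ ^ (j + 1)) := fun p hp => by
      have := closedStrip_subset_largeAtoms j (2 * R) t hp
      exact ⟨(show dist0 p ≤ ‖t‖ + 2 * R from this.1).trans (by linarith), this.2⟩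
    have h4 : n.real (closedStrip (j + 1) (2 * R) t) ≤
        n.real (largeAtoms d (R + 2 * R) ((2 : ℝ)⁻¹ ^ (j + 1))) :=
      measureReal_mono hsub (hfin _ _ (by positivity)).ne
    have h5 : n.real (closedStrip (j + 1) (2 * R) t) + bandReal ν (j + 1) * (2 * R) ≤ C₂ := by
      linarith
    have h6 : 0 ≤ n.real (closedStrip (j + 1) (2 * R) t) + bandReal ν (j + 1) * (2 * R) :=
      add_nonneg measureReal_nonneg (mul_nonneg (bandReal_nonneg _ _) (by positivity))
    rw [mul_left_comm C₂]
    refine mul_le_mul_of_nonneg_left ?_ (by positivity)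
    refine h5.trans (le_mul_of_one_le_right (h6.trans h5) ?_)
    linarith [Real.sqrt_nonneg (((j : ℝ) + 1) * bandReal ν (j + 1) * ‖u - t‖),
      Nat.cast_nonneg (α := ℝ) j]

lemma openStrip_subset_of_near {j : ℕ} {r η : ℝ} {t t' : Space d} (h : ‖t - t'‖ ≤ η)
    (hη : η ≤ r) : openStrip j r t' ⊆ openStrip j (2 * r) t := fun p hp => by
  refine ⟨hp.1, ?_⟩
  have h1 := abs_lt.1 (show |dist0 p - inner ℝ (normal p) t'| < r from hp.2)
  have h2 := abs_le.1 (abs_inner_normal_le p (t - t'))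
  rw [inner_sub_right] at h2
  change |dist0 p - inner ℝ (normal p) t| < 2 * r
  rw [abs_lt]
  constructor <;> linarith

lemma bandAtoms_disjoint {j j' : ℕ} (h : j < j') :
    Disjoint (bandAtoms (j + 1) : Set (AtomSpace d)) (bandAtoms (j' + 1)) := by
  refine Set.disjoint_left.2 fun p hp hp' => ?_
  have h1 := (mem_band_succ.1 hp).1
  have h2 := (mem_band_succ.1 hp').2
  have h3 : (2 : ℝ)⁻¹ ^ j' ≤ (2 : ℝ)⁻¹ ^ (j + 1) :=
    pow_le_pow_of_le_one (by norm_num) (by norm_num) h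
  linarith

/-- Away from `approxSet`, the strips of the corresponding width are eventually empty. -/
lemma eventually_openStrip_eq_zero {n : Measure (AtomSpace d)}
    (hn : ∃ (I : Set ℕ) (a : I → AtomSpace d), n = Measure.sum (fun i => Measure.dirac (a i)))
    {α : ℝ} (hα : 0 < α) {t : Space d} (ht : t ∉ approxSet n α) :
    ∀ᶠ j : ℕ in atTop, n (openStrip (j + 1) (((2 : ℝ)⁻¹ ^ (j + 1)) ^ (1 / α)) t) = 0 := by
  -- The strips lie in disjoint bands, and all of them are contained in the set of finite mass that
  -- expresses `t ∉ approxSet n α`.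
  have hsum : ∑' j : ℕ, n (openStrip (j + 1) (((2 : ℝ)⁻¹ ^ (j + 1)) ^ (1 / α)) t) ≠ ∞ := by
    refine ne_top_of_le_ne_top ht ((tsum_meas_le_meas_iUnion_of_disjoint n
      (fun j => measurableSet_openStrip _ _ _) ?_).trans (measure_mono (iUnion_subset fun j => ?_)))
    · intro j j' hjj'
      refine Disjoint.mono inter_subset_left inter_subset_left ?_
      rcases lt_or_gt_of_ne hjj' with h | h
      · exact bandAtoms_disjoint h
      · exact (bandAtoms_disjoint h).symm
    · intro p hp
      obtain ⟨h1, h2⟩ := mem_band_succ.1 hp.1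
      refine ⟨h2.trans (pow_le_one₀ (by norm_num) (by norm_num)), lt_of_lt_of_le hp.2 ?_⟩
      exact Real.rpow_le_rpow (by positivity) h1.le (by positivity)
  have h0 := ENNReal.tendsto_atTop_zero_of_tsum_ne_top hsum
  -- The masses are integers, so they vanish once they are below `1`.
  filter_upwards [h0.eventually (gt_mem_nhds zero_lt_one)] with j hj
  obtain ⟨I, a, rfl⟩ := hn
  rw [sum_dirac_apply a (measurableSet_openStrip _ _ _)] at hj ⊢
  have h1 : {i | a i ∈ openStrip (j + 1) (((2 : ℝ)⁻¹ ^ (j + 1)) ^ (1 / α)) t}.encard < 1 := by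
    exact_mod_cast hj
  rw [Order.lt_one_iff] at h1
  rw [h1, ENat.toENNReal_zero]

lemma tendsto_two_inv_pow : Tendsto (fun j : ℕ => (2 : ℝ)⁻¹ ^ (j + 1)) atTop (𝓝 0) :=
  (tendsto_pow_atTop_nhds_zero_of_lt_one (by norm_num) (by norm_num)).comp (tendsto_add_atTop_nat 1)

/-- In terms of `y = 2^{-(j+1)}` the mesh is of order `y²`, which is negligible against `y^{1/α}`
exactly when `α > 1/2`. -/
lemma eventually_mesh_le (d : ℕ) {α : ℝ} (hα : 1 / 2 < α) :
    ∀ᶠ j : ℕ in atTop, d * (4 : ℝ)⁻¹ ^ j ≤ 2⁻¹ * ((2 : ℝ)⁻¹ ^ (j + 1)) ^ (1 / α) := by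
  have hpos : 0 < 2 - 1 / α := by
    have : 1 / α < 2 := by
      rw [div_lt_iff₀ (by linarith)]
      linarith
    linarith
  have h1 : Tendsto (fun j : ℕ => 8 * d * ((2 : ℝ)⁻¹ ^ (j + 1)) ^ (2 - 1 / α)) atTop (𝓝 0) := by
    have h2 := (tendsto_two_inv_pow.rpow_const (p := 2 - 1 / α) (Or.inr hpos.le)).const_mul
      (8 * d : ℝ)
    rwa [Real.zero_rpow hpos.ne', mul_zero] at h2
  filter_upwards [h1.eventually (gt_mem_nhds zero_lt_one)] with j hj
  have hy : (0 : ℝ) < (2 : ℝ)⁻¹ ^ (j + 1) := by positivity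
  have h3 : (4 : ℝ)⁻¹ ^ j = 4 * ((2 : ℝ)⁻¹ ^ (j + 1)) ^ 2 := by
    rw [← pow_mul, mul_comm (j + 1) 2, pow_mul, show ((2 : ℝ)⁻¹) ^ 2 = 4⁻¹ by norm_num, pow_succ]
    ring
  rw [Real.rpow_sub hy, Real.rpow_two, ← mul_div_assoc, div_lt_one (by positivity)] at hj
  rw [h3]
  linarith

/-- For large `j` the strip of full width about `t` is empty, and it contains the strip of half
width about a neighbouring lattice point. An empty strip at a lattice point is excluded if `ν_{j+1}`
times its width reaches `level d j`, so it does not. -/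
lemma ae_covering (hν : IsAdmissible ν) (hN : IsPoissonRandomMeasure P (intensity ν) N) {α : ℝ}
    (hα : 1 / 2 < α) :
    ∀ᵐ ω ∂P, ∀ t ∉ approxSet (N ω) α, ∃ C : ℝ, ∀ j : ℕ,
      bandReal ν (j + 1) ≤ C * ((j + 1) * ((2 : ℝ)⁻¹ ^ (j + 1)) ^ (-(1 / α))) := by
  set r : ℕ → ℝ := fun j => 2⁻¹ * ((2 : ℝ)⁻¹ ^ (j + 1)) ^ (1 / α) with hr
  have hr0 : ∀ j, 0 < r j := fun j => by positivity
  have h : ∀ᵐ ω ∂P, ∀ R : ℕ, ∀ᶠ j in atTop, ∀ t ∈ grid d R j,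
      level d j ≤ bandReal ν (j + 1) * r j → N ω (openStrip (j + 1) (r j) t) ≠ 0 :=
    ae_all_iff.2 fun R => ae_eventually_grid_occupied hν hN R r fun j => (hr0 j).le
  filter_upwards [h, ae_exists_atoms hν hN] with ω hω ⟨I, a, ha, _⟩ t ht
  obtain ⟨R, hR⟩ := exists_nat_ge ‖t‖
  have hev : ∀ᶠ j : ℕ in atTop, bandReal ν (j + 1) ≤
      (2 * (4 * d + 1)) * ((j + 1) * ((2 : ℝ)⁻¹ ^ (j + 1)) ^ (-(1 / α))) := by
    filter_upwards [hω R, eventually_openStrip_eq_zero ⟨I, a, ha⟩ (by linarith) ht,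
      eventually_mesh_le d hα] with j h1 h2 h3
    obtain ⟨t', ht', htt'⟩ := exists_mem_grid (j := j) hR
    have h4 : N ω (openStrip (j + 1) (r j) t') = 0 := by
      refine measure_mono_null ((openStrip_subset_of_near htt' h3).trans ?_) h2
      rw [mul_inv_cancel_left₀ two_ne_zero]
    have h5 : bandReal ν (j + 1) * r j ≤ level d j := by
      by_contra hc
      exact h1 t' ht' (not_le.1 hc).le h4
    rw [level] at h5
    have hy : (0 : ℝ) < ((2 : ℝ)⁻¹ ^ (j + 1)) ^ (1 / α) := by positivity
    rw [Real.rpow_neg (by positivity), ← mul_assoc, ← div_eq_mul_inv, le_div_iff₀ hy]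
    simp only [hr] at h5
    linarith
  obtain ⟨C, -, hC⟩ := exists_forall_le_mul (fun j => by positivity) hev
  exact ⟨C, hC⟩

theorem ae_isRegularSample (hν : IsAdmissible ν) (hN : IsPoissonRandomMeasure P (intensity ν) N) :
    ∀ᵐ ω ∂P, IsRegularSample ν (N ω) := by
  have h1 : ∀ᵐ ω ∂P, ∀ R : ℕ, ∃ C : ℝ, ∀ (j : ℕ) (t u : Space d), ‖t‖ ≤ R → ‖u‖ ≤ R →
      |layer ν (N ω) (j + 1) u - layer ν (N ω) (j + 1) t| ≤ C * ((2 : ℝ)⁻¹ ^ j *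
        (√(((j : ℝ) + 1) * bandReal ν (j + 1) * ‖u - t‖) + (j + 1))) :=
    ae_all_iff.2 fun R => ae_increment hν hN R
  have h2 : ∀ᵐ ω ∂P, ∀ α : ℚ, (1 / 2 : ℝ) < α → ∀ t ∉ approxSet (N ω) α, ∃ C : ℝ, ∀ j : ℕ,
      bandReal ν (j + 1) ≤ C * ((j + 1) * ((2 : ℝ)⁻¹ ^ (j + 1)) ^ (-(1 / (α : ℝ)))) := by
    refine ae_all_iff.2 fun α => ?_
    by_cases hα : (1 / 2 : ℝ) < α
    · filter_upwards [ae_covering hν hN hα] with ω hω _ using hω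
    · exact ae_of_all _ fun ω h => absurd h hα
  filter_upwards [ae_exists_atoms hν hN, ae_largeAtoms_lt_top hν hN, h1, h2] with ω a b c e
  exact ⟨a, b, c, e⟩

end Regularity

/-! ### Layers as finite sums over atoms. -/

section SamplePath

variable {d : ℕ}

lemma restrict_sum_dirac {X ι : Type*} [MeasurableSpace X] (a : ι → X) {S : Set X}
    (hS : MeasurableSet S) (F : Finset ι) (hF : ∀ i, i ∈ F ↔ a i ∈ S) :
    (Measure.sum fun i => Measure.dirac (a i)).restrict S = ∑ i ∈ F, Measure.dirac (a i) := by
  ext T hT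
  rw [Measure.restrict_apply hT, Measure.sum_apply _ (hT.inter hS), Measure.finsetSum_apply]
  rw [tsum_eq_sum (s := F)]
  · refine Finset.sum_congr rfl fun i hi => ?_
    rw [Measure.dirac_apply' _ (hT.inter hS), Measure.dirac_apply' _ hT]
    by_cases h : a i ∈ T
    · rw [indicator_of_mem h, indicator_of_mem (mem_inter h ((hF i).1 hi))]
    · rw [indicator_of_notMem h, indicator_of_notMem fun h' => h h'.1]
  · intro i hi
    rw [Measure.dirac_apply' _ (hT.inter hS)]
    exact indicator_of_notMem (fun h => hi ((hF i).2 h.2)) _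

lemma setIntegral_sum_dirac {X ι : Type*} [MeasurableSpace X] [MeasurableSingletonClass X]
    (a : ι → X) {S : Set X} (hS : MeasurableSet S) (F : Finset ι) (hF : ∀ i, i ∈ F ↔ a i ∈ S)
    (f : X → ℝ) :
    ∫ x in S, f x ∂(Measure.sum fun i => Measure.dirac (a i)) = ∑ i ∈ F, f (a i) := by
  rw [restrict_sum_dirac a hS F hF, integral_finsetSum_measure]
  · simp
  · exact fun i _ => integrable_dirac (by simp)

/-- The atoms that contribute to the `k`-th layer. -/
def sizeAtoms : ℕ → Set (AtomSpace d)
  | 0 => {p | 1 < |jump p|}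
  | j + 1 => bandAtoms (j + 1)

lemma measurableSet_sizeAtoms (k : ℕ) : MeasurableSet (sizeAtoms k : Set (AtomSpace d)) := by
  cases k with
  | zero => exact measurableSet_lt measurable_const measurable_jump.abs
  | succ j => exact measurableSet_bandAtoms _

lemma sizeAtoms_subset (k : ℕ) : (sizeAtoms k : Set (AtomSpace d)) ⊆
    {p | (2 : ℝ)⁻¹ ^ k < |jump p|} := by
  cases k with
  | zero => exact fun p hp => by simpa [sizeAtoms] using hp
  | succ j => exact fun p hp => (mem_band_succ.1 hp).1

/-- Every atom contributes to exactly one layer. -/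
lemma existsUnique_mem_sizeAtoms (p : AtomSpace d) : ∃! k, p ∈ sizeAtoms k := by
  have huniq : ∀ k l, k < l → p ∈ sizeAtoms k → p ∉ sizeAtoms l := by
    intro k l hkl hk hl
    obtain ⟨m, rfl⟩ : ∃ m, l = m + 1 := Nat.exists_eq_succ_of_ne_zero (by omega)
    have h1 : (2 : ℝ)⁻¹ ^ k < |jump p| := sizeAtoms_subset k hk
    have h2 := (mem_band_succ.1 hl).2
    have h3 : (2 : ℝ)⁻¹ ^ m ≤ (2 : ℝ)⁻¹ ^ k :=
      pow_le_pow_of_le_one (by norm_num) (by norm_num) (by omega)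
    linarith
  have hex : ∃ k, (2 : ℝ)⁻¹ ^ k < |jump p| :=
    exists_pow_lt_of_lt_one (abs_pos.2 (jump_ne_zero p)) (by norm_num)
  classical
  have hmem : p ∈ sizeAtoms (Nat.find hex) := by
    have h1 := Nat.find_spec hex
    rcases hk : Nat.find hex with _ | j
    · rw [hk] at h1
      simpa [sizeAtoms] using h1
    · rw [hk] at h1
      refine mem_band_succ.2 ⟨h1, not_lt.1 (Nat.find_min hex (m := j) (by omega))⟩
  refine ⟨Nat.find hex, hmem, fun l hl => ?_⟩
  rcases lt_trichotomy l (Nat.find hex) with h | h | h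
  · exact absurd hmem (huniq _ _ h hl)
  · exact h
  · exact absurd hl (huniq _ _ h hmem)

/-- The slope of the compensator of the `k`-th layer. -/
def slope (ν : Measure (MarkSpace d)) : ℕ → Space d
  | 0 => 0
  | j + 1 => drift ν (j + 1)

variable {ν : Measure (MarkSpace d)}

lemma layer_eq (hν : IsAdmissible ν) (n : Measure (AtomSpace d)) (k : ℕ) (t : Space d) :
    layer ν n k t = ∫ p in separating t ∩ sizeAtoms k, jump p ∂n - inner ℝ (slope ν k) t := by
  cases k with
  | zero =>
    rw [slope, inner_zero_left, sub_zero]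
    rfl
  | succ j => exact layer_succ hν n j t

lemma layer_apply_zero (hν : IsAdmissible ν) (n : Measure (AtomSpace d)) (k : ℕ) :
    layer ν n k 0 = 0 := by
  rw [layer_eq hν, separating_zero, empty_inter, setIntegral_empty, inner_zero_right, sub_zero]

section Atoms

variable {ι : Type*} {a : ι → AtomSpace d}

/-- Finitely many hyperplanes with jumps larger than `ε` meet a given ball. -/
lemma finite_large_atoms
    (hfin : ∀ R ε : ℝ, 0 < ε → (Measure.sum fun i => Measure.dirac (a i)) (largeAtoms d R ε) < ∞)
    (R ε : ℝ) (hε : 0 < ε) :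
    {i | dist0 (a i) ≤ R ∧ ε < |jump (a i)|}.Finite := by
  have h := hfin R ε hε
  rw [sum_dirac_apply a (measurableSet_largeAtoms _ _)] at h
  refine encard_lt_top_iff.1 ?_
  exact_mod_cast h

lemma dist0_le_of_mem_separating {p : AtomSpace d} {t : Space d} (h : p ∈ separating t) :
    dist0 p ≤ ‖t‖ :=
  (le_of_lt (show dist0 p < inner ℝ (normal p) t from h)).trans
    ((le_abs_self _).trans (abs_inner_normal_le p t))

/-- The index set `F` depends on `R` and not on `t`, so that the layer can be compared at two points
term by term. -/
lemma layer_eq_sum (hν : IsAdmissible ν)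
    {R : ℝ} {k : ℕ} (F : Finset ι) (hF : ∀ i, i ∈ F ↔ dist0 (a i) ≤ R ∧ a i ∈ sizeAtoms k)
    {t : Space d} (ht : ‖t‖ ≤ R) :
    layer ν (Measure.sum fun i => Measure.dirac (a i)) k t =
      ∑ i ∈ F, (separating t).indicator jump (a i) - inner ℝ (slope ν k) t := by
  classical
  rw [layer_eq hν, setIntegral_sum_dirac a
    ((measurableSet_separating t).inter (measurableSet_sizeAtoms k))
    (F.filter fun i => a i ∈ separating t), Finset.sum_filter]
  · rfl
  · intro i
    rw [Finset.mem_filter, hF]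
    refine ⟨fun h => ⟨h.2, h.1.2⟩, fun h => ⟨⟨?_, h.2⟩, h.1⟩⟩
    exact (dist0_le_of_mem_separating h.1).trans ht

lemma exists_finset_sizeAtoms
    (hfin : ∀ R ε : ℝ, 0 < ε → (Measure.sum fun i => Measure.dirac (a i)) (largeAtoms d R ε) < ∞)
    (R : ℝ) (k : ℕ) : ∃ F : Finset ι, ∀ i, i ∈ F ↔ dist0 (a i) ≤ R ∧ a i ∈ sizeAtoms k := by
  have h : {i | dist0 (a i) ≤ R ∧ a i ∈ sizeAtoms k}.Finite :=
    (finite_large_atoms hfin R ((2 : ℝ)⁻¹ ^ k) (by positivity)).subset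
      fun i hi => ⟨hi.1, sizeAtoms_subset k hi.2⟩
  exact ⟨h.toFinset, fun i => by simp⟩

/-- A layer is affine between points that are not separated by its hyperplanes. -/
lemma layer_sub_of_not_separated (hν : IsAdmissible ν)
    (hfin : ∀ R ε : ℝ, 0 < ε → (Measure.sum fun i => Measure.dirac (a i)) (largeAtoms d R ε) < ∞)
    {k : ℕ} {t u : Space d}
    (h : ∀ i, a i ∈ sizeAtoms k → (a i ∈ separating u ↔ a i ∈ separating t)) :
    layer ν (Measure.sum fun i => Measure.dirac (a i)) k u -
      layer ν (Measure.sum fun i => Measure.dirac (a i)) k t = -inner ℝ (slope ν k) (u - t) := by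
  classical
  obtain ⟨F, hF⟩ := exists_finset_sizeAtoms hfin (max ‖u‖ ‖t‖) k
  rw [layer_eq_sum hν F hF (le_max_left _ _), layer_eq_sum hν F hF (le_max_right _ _),
    inner_sub_right]
  have : ∑ i ∈ F, (separating u).indicator jump (a i) =
      ∑ i ∈ F, (separating t).indicator jump (a i) := by
    refine Finset.sum_congr rfl fun i hi => ?_
    rw [indicator_apply, indicator_apply, if_congr (h i ((hF i).1 hi).2) rfl rfl]
  rw [this]
  ring

/-- The layers jump across a hyperplane at the points that lie on no other hyperplane. -/
lemma tendsto_layer_sub (hν : IsAdmissible ν)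
    (hfin : ∀ R ε : ℝ, 0 < ε → (Measure.sum fun i => Measure.dirac (a i)) (largeAtoms d R ε) < ∞)
    {i₀ : ι} {u : Space d} (hu : inner ℝ (normal (a i₀)) u = dist0 (a i₀))
    (hne : ∀ i, i ≠ i₀ → inner ℝ (normal (a i)) u ≠ dist0 (a i)) (k : ℕ) :
    Tendsto (fun ε : ℝ => layer ν (Measure.sum fun i => Measure.dirac (a i)) k
        (u + ε • normal (a i₀)) -
      layer ν (Measure.sum fun i => Measure.dirac (a i)) k (u - ε • normal (a i₀)))
      (𝓝[>] 0) (𝓝 ((sizeAtoms k).indicator jump (a i₀))) := by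
  classical
  obtain ⟨F, hF⟩ := exists_finset_sizeAtoms hfin (‖u‖ + 1) k
  set s := normal (a i₀) with hs
  have hs1 : ‖s‖ = 1 := norm_normal _
  -- For such `ε` the segment crosses no hyperplane of `F` other than possibly that of `i₀`.
  have hev : ∀ᶠ ε : ℝ in 𝓝[>] 0, 0 < ε ∧ ε < 1 ∧ ∀ i ∈ F, i ≠ i₀ →
      ε < |inner ℝ (normal (a i)) u - dist0 (a i)| := by
    refine (eventually_mem_nhdsWithin).and (((gt_mem_nhds zero_lt_one).filter_mono
      nhdsWithin_le_nhds).and ?_)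
    refine (Filter.eventually_all_finset F).2 fun i _ => ?_
    by_cases hi : i = i₀
    · exact Eventually.of_forall fun ε h => absurd hi h
    · filter_upwards [(gt_mem_nhds (abs_pos.2 (sub_ne_zero.2 (hne i hi)))).filter_mono
        nhdsWithin_le_nhds] with ε hε _ using hε
  have hlim : Tendsto (fun ε : ℝ => (sizeAtoms k).indicator jump (a i₀) -
      2 * ε * inner ℝ (slope ν k) s) (𝓝[>] 0) (𝓝 ((sizeAtoms k).indicator jump (a i₀))) := by
    have h : Tendsto (fun ε : ℝ => (sizeAtoms k).indicator jump (a i₀) -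
        2 * ε * inner ℝ (slope ν k) s) (𝓝 0)
        (𝓝 ((sizeAtoms k).indicator jump (a i₀) - 2 * 0 * inner ℝ (slope ν k) s)) := by
      exact (Continuous.tendsto (by fun_prop) 0)
    rw [mul_zero, zero_mul, sub_zero] at h
    exact h.mono_left nhdsWithin_le_nhds
  refine hlim.congr' ?_
  filter_upwards [hev] with ε ⟨h0, h1, h2⟩
  have hn : ‖ε • s‖ = ε := by rw [norm_smul, hs1, mul_one, Real.norm_of_nonneg h0.le]
  rw [layer_eq_sum hν F hF ((norm_add_le _ _).trans (by linarith)),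
    layer_eq_sum hν F hF ((norm_sub_le _ _).trans (by linarith))]
  have key : ∀ i ∈ F, (separating (u + ε • s)).indicator jump (a i) -
      (separating (u - ε • s)).indicator jump (a i) = if i = i₀ then jump (a i₀) else 0 := by
    intro i hi
    by_cases hii : i = i₀
    · subst hii
      have hin : (inner ℝ s (ε • s) : ℝ) = ε := by
        rw [inner_smul_right, real_inner_self_eq_norm_sq, hs1]
        ring
      rw [if_pos rfl, indicator_of_mem, indicator_of_notMem, sub_zero]
      · intro h
        have h3 : dist0 (a i) < inner ℝ s (u - ε • s) := h
        rw [inner_sub_right, hu, hin] at h3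
        linarith
      · change dist0 (a i) < inner ℝ s (u + ε • s)
        rw [inner_add_right, hu, hin]
        linarith
    · rw [if_neg hii, sub_eq_zero]
      have h3 := h2 i hi hii
      have h4 := abs_le.1 (abs_inner_normal_le (a i) (ε • s))
      rw [hn] at h4
      have h5 : a i ∈ separating (u + ε • s) ↔ a i ∈ separating (u - ε • s) := by
        change dist0 (a i) < inner ℝ (normal (a i)) (u + ε • s) ↔
          dist0 (a i) < inner ℝ (normal (a i)) (u - ε • s)
        rw [inner_add_right, inner_sub_right]
        rcases lt_abs.1 h3 with h | h
        · constructor <;> intro <;> linarith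
        · constructor <;> intro <;> linarith
      rw [indicator_apply, indicator_apply, if_congr h5 rfl rfl]
  have hsum : ∑ i ∈ F, (separating (u + ε • s)).indicator jump (a i) -
      ∑ i ∈ F, (separating (u - ε • s)).indicator jump (a i) =
      (sizeAtoms k).indicator jump (a i₀) := by
    rw [← Finset.sum_sub_distrib, Finset.sum_congr rfl key, Finset.sum_ite_eq', indicator_apply]
    refine if_congr ?_ rfl rfl
    rw [hF]
    refine and_iff_right ?_
    rw [← hu]
    exact ((le_abs_self _).trans (abs_inner_normal_le _ u)).trans (by linarith)
  rw [← hsum, inner_add_right, inner_sub_right, inner_smul_right]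
  ring

end Atoms

end SamplePath

/-! ### Convergence of the series and jumps of the field. -/

section Field

variable {d : ℕ} {ν : Measure (MarkSpace d)}

/-- Up to a constant the square roots are the terms of `χ_ν`; the rest is an arithmetic-geometric
series. -/
lemma summable_gauge (hν : IsAdmissible ν) (D : ℝ) :
    Summable fun j : ℕ => (2 : ℝ)⁻¹ ^ j *
      (√(((j : ℝ) + 1) * bandReal ν (j + 1) * D) + (j + 1)) := by
  have h1 := hν.summable_chi.mul_left (2 * √D)
  have h2 : Summable fun j : ℕ => ((j : ℝ) + 1) * (2 : ℝ)⁻¹ ^ j := by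
    have h3 := (summable_pow_mul_geometric_of_norm_lt_one 1
      (show ‖(2 : ℝ)⁻¹‖ < 1 by norm_num)).add
      (summable_geometric_of_lt_one (by norm_num : (0 : ℝ) ≤ 2⁻¹) (by norm_num))
    refine h3.congr fun j => ?_
    rw [pow_one]
    ring
  refine (h1.add h2).congr fun j => ?_
  rw [Real.sqrt_mul (mul_nonneg (by positivity) (bandReal_nonneg _ _)), pow_succ]
  ring

/-- The increments of the layers in a ball are dominated by a summable sequence. -/
lemma exists_summable_bound (hν : IsAdmissible ν) {n : Measure (AtomSpace d)}
    (h : IsRegularSample ν n) (R : ℝ) :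
    ∃ b : ℕ → ℝ, Summable b ∧ ∀ k t u, ‖t‖ ≤ R → ‖u‖ ≤ R →
      |layer ν n k u - layer ν n k t| ≤ b k := by
  obtain ⟨R', hR'⟩ := exists_nat_ge R
  obtain ⟨C, hC⟩ := h.increment R'
  obtain ⟨I, a, ha, -⟩ := h.atoms
  have hfin := h.finite
  rw [ha] at hfin
  obtain ⟨F, hF⟩ := exists_finset_sizeAtoms hfin R 0
  have h0 : ∀ t, ‖t‖ ≤ R → |layer ν n 0 t| ≤ ∑ i ∈ F, |jump (a i)| := fun t ht => by
    rw [ha, layer_eq_sum hν F hF ht, slope, inner_zero_left, sub_zero]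
    refine (Finset.abs_sum_le_sum_abs _ _).trans (Finset.sum_le_sum fun i _ => ?_)
    exact norm_indicator_le_norm_self jump (a i)
  have hCn : 0 ≤ C := by
    have h1 := (abs_nonneg _).trans (hC 0 0 0 (by simp) (by simp))
    simpa using h1
  refine ⟨fun k => Nat.casesOn k (2 * ∑ i ∈ F, |jump (a i)|) fun j => C * ((2 : ℝ)⁻¹ ^ j *
    (√(((j : ℝ) + 1) * bandReal ν (j + 1) * (2 * R')) + (j + 1))), ?_, fun k t u ht hu => ?_⟩
  · rw [← summable_nat_add_iff 1]
    exact (summable_gauge hν (2 * R')).mul_left C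
  · cases k with
    | zero =>
      refine (abs_sub _ _).trans ?_
      rw [two_mul]
      exact add_le_add (h0 u hu) (h0 t ht)
    | succ j =>
      refine (hC j t u (ht.trans hR') (hu.trans hR')).trans ?_
      dsimp only
      have h1 : ‖u - t‖ ≤ 2 * R' := by linarith [norm_sub_le u t]
      have h2 := bandReal_nonneg ν (j + 1)
      gcongr

lemma summable_layer (hν : IsAdmissible ν) {n : Measure (AtomSpace d)}
    (h : IsRegularSample ν n) (t : Space d) : Summable fun k => layer ν n k t := by
  obtain ⟨b, hb, hbound⟩ := exists_summable_bound hν h ‖t‖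
  refine Summable.of_norm_bounded hb fun k => ?_
  have := hbound k 0 t (by simp) le_rfl
  rwa [layer_apply_zero hν, sub_zero] at this

lemma tendsto_partialField (hν : IsAdmissible ν) {n : Measure (AtomSpace d)}
    (h : IsRegularSample ν n) (t : Space d) :
    Tendsto (fun k => partialField ν n k t) atTop (𝓝 (∑' k, layer ν n k t)) :=
  (summable_layer hν h t).hasSum.tendsto_sum_nat

lemma field_eq_tsum (hν : IsAdmissible ν) {n : Measure (AtomSpace d)}
    (h : IsRegularSample ν n) (t : Space d) : field ν n t = ∑' k, layer ν n k t :=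
  (tendsto_partialField hν h t).limUnder_eq

lemma field_sub_eq_tsum (hν : IsAdmissible ν) {n : Measure (AtomSpace d)}
    (h : IsRegularSample ν n) (t u : Space d) :
    field ν n u - field ν n t = ∑' k, (layer ν n k u - layer ν n k t) := by
  rw [field_eq_tsum hν h, field_eq_tsum hν h,
    (summable_layer hν h u).tsum_sub (summable_layer hν h t)]

lemma isLocallyBounded_field (hν : IsAdmissible ν) {n : Measure (AtomSpace d)}
    (h : IsRegularSample ν n) : IsLocallyBounded (field ν n) := by
  intro t₀
  obtain ⟨b, hb, hbound⟩ := exists_summable_bound hν h (‖t₀‖ + 1)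
  refine ⟨∑' k, b k, ?_⟩
  filter_upwards [Metric.ball_mem_nhds t₀ one_pos] with t ht
  have ht' : ‖t‖ ≤ ‖t₀‖ + 1 := by
    rw [mem_ball_iff_norm] at ht
    have := norm_le_insert' t t₀
    linarith
  rw [field_eq_tsum hν h, ← Real.norm_eq_abs]
  refine tsum_of_norm_bounded hb.hasSum fun k => ?_
  have := hbound k 0 t (norm_zero.trans_le (by positivity)) ht'
  rwa [layer_apply_zero hν, sub_zero] at this

section Jumps

variable {ι : Type*} {a : ι → AtomSpace d}

lemma dense_inner_ne {w : Space d} (hw : w ≠ 0) (c : ℝ) :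
    Dense {v : Space d | (inner ℝ w v : ℝ) ≠ c} := by
  refine Metric.dense_iff.2 fun x r hr => ?_
  by_cases hx : (inner ℝ w x : ℝ) = c
  · have hw' : 0 < ‖w‖ := norm_pos_iff.2 hw
    refine ⟨x + (r / 2 / ‖w‖) • w, ?_, ?_⟩
    · rw [mem_ball_iff_norm, add_sub_cancel_left, norm_smul, Real.norm_of_nonneg (by positivity),
        div_mul_cancel₀ _ hw'.ne']
      linarith
    · change (inner ℝ w (x + (r / 2 / ‖w‖) • w) : ℝ) ≠ c
      rw [inner_add_right, hx, inner_smul_right, real_inner_self_eq_norm_sq]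
      have : 0 < r / 2 / ‖w‖ * ‖w‖ ^ 2 := by positivity
      linarith
  · exact ⟨x, Metric.mem_ball_self hr, hx⟩

/-- Near every point of a jump hyperplane there are points of it that lie on no other one. -/
lemma exists_generic_point [Countable ι] (hinj : Function.Injective (dist0 ∘ a)) (i₀ : ι)
    {w : Space d} (hw : inner ℝ (normal (a i₀)) w = dist0 (a i₀)) {r : ℝ} (hr : 0 < r) :
    ∃ u, ‖u - w‖ < r ∧ inner ℝ (normal (a i₀)) u = dist0 (a i₀) ∧
      ∀ i, i ≠ i₀ → inner ℝ (normal (a i)) u ≠ dist0 (a i) := by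
  set s := normal (a i₀) with hs
  have hs1 : ‖s‖ = 1 := norm_normal _
  have hss : (inner ℝ s s : ℝ) = 1 := by rw [real_inner_self_eq_norm_sq, hs1, one_pow]
  -- `q i` is the part of the `i`-th normal orthogonal to `s`. Moving `w` by the projection of `v`
  -- onto the hyperplane changes the `i`-th inner product by `⟨q i, v⟩`, so the bad `v` form an
  -- affine hyperplane when `q i ≠ 0`, and Baire's theorem applies.
  set q : ι → Space d := fun i => normal (a i) - (inner ℝ (normal (a i)) s : ℝ) • s with hq
  set D : ι → Set (Space d) := fun i => {v | q i ≠ 0 →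
    (inner ℝ (q i) v : ℝ) ≠ dist0 (a i) - inner ℝ (normal (a i)) w} with hD
  have hdense : Dense (⋂ i, D i) := by
    refine dense_iInter_of_isOpen (fun i => ?_) fun i => ?_
    · by_cases h : q i = 0
      · simp [hD, h]
      · have : D i = {v | (inner ℝ (q i) v : ℝ) ≠ dist0 (a i) - inner ℝ (normal (a i)) w} := by
          ext v
          simp [hD, h]
        rw [this]
        exact isOpen_ne_fun (by fun_prop) continuous_const
    · by_cases h : q i = 0
      · simp [hD, h]
      · refine (dense_inner_ne h (dist0 (a i) - inner ℝ (normal (a i)) w)).mono fun v hv _ => hv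
  obtain ⟨v, hvr, hv⟩ := Metric.dense_iff.1 hdense 0 (r / 2) (by positivity)
  rw [mem_ball_zero_iff] at hvr
  rw [mem_iInter] at hv
  have hinner : ∀ x : Space d, (inner ℝ x (w + (v - (inner ℝ s v : ℝ) • s)) : ℝ) =
      inner ℝ x w + inner ℝ (x - (inner ℝ x s : ℝ) • s) v := fun x => by
    rw [inner_add_right, inner_sub_right, inner_sub_left, inner_smul_right, real_inner_smul_left]
    ring
  have hu : (inner ℝ s (w + (v - (inner ℝ s v : ℝ) • s)) : ℝ) = dist0 (a i₀) := by
    rw [hinner, hss, one_smul, sub_self, inner_zero_left, add_zero, hw]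
  refine ⟨w + (v - (inner ℝ s v : ℝ) • s), ?_, hu, fun i hi heq => ?_⟩
  · rw [add_sub_cancel_left]
    have h1 : ‖(inner ℝ s v : ℝ) • s‖ ≤ ‖v‖ := by
      rw [norm_smul, hs1, mul_one]
      simpa [hs1] using norm_inner_le_norm (𝕜 := ℝ) s v
    linarith [norm_sub_le v ((inner ℝ s v : ℝ) • s)]
  · by_cases h : q i = 0
    · have h2 : normal (a i) = (inner ℝ (normal (a i)) s : ℝ) • s := sub_eq_zero.1 h
      have h3 : |(inner ℝ (normal (a i)) s : ℝ)| = 1 := by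
        have h4 := congrArg norm h2
        rw [norm_smul, hs1, mul_one, norm_normal] at h4
        exact h4.symm
      rw [h2, real_inner_smul_left, hu] at heq
      have h5 := congrArg abs heq
      rw [abs_mul, h3, one_mul, abs_of_pos (dist0_pos _), abs_of_pos (dist0_pos _)] at h5
      exact hi (hinj h5.symm)
    · refine hv i h ?_
      rw [hinner] at heq
      exact eq_sub_of_add_eq' heq

/-- Dominated convergence for the series of layers: exactly one layer contains the atom `a i₀` and
jumps by `x` in the limit. -/
lemma tendsto_field_sub (hν : IsAdmissible ν)
    (h : IsRegularSample ν (Measure.sum fun i => Measure.dirac (a i)))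
    {i₀ : ι} {u : Space d} (hu : inner ℝ (normal (a i₀)) u = dist0 (a i₀))
    (hne : ∀ i, i ≠ i₀ → inner ℝ (normal (a i)) u ≠ dist0 (a i)) :
    Tendsto (fun ε : ℝ => field ν (Measure.sum fun i => Measure.dirac (a i))
        (u + ε • normal (a i₀)) -
      field ν (Measure.sum fun i => Measure.dirac (a i)) (u - ε • normal (a i₀)))
      (𝓝[>] 0) (𝓝 (jump (a i₀))) := by
  classical
  obtain ⟨k₀, hk₀, huniq⟩ := existsUnique_mem_sizeAtoms (a i₀)
  have hlim : ∑' k, (sizeAtoms k).indicator jump (a i₀) = jump (a i₀) := by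
    rw [tsum_eq_single k₀ fun k hk => indicator_of_notMem (fun hm => hk (huniq k hm)) _,
      indicator_of_mem hk₀]
  obtain ⟨b, hb, hbound⟩ := exists_summable_bound hν h (‖u‖ + 1)
  rw [← hlim]
  simp_rw [field_sub_eq_tsum hν h]
  refine tendsto_tsum_of_dominated_convergence hb
    (fun k => tendsto_layer_sub hν h.finite hu hne k) ?_
  filter_upwards [eventually_mem_nhdsWithin,
    (gt_mem_nhds (zero_lt_one' ℝ)).filter_mono nhdsWithin_le_nhds] with ε h0 h1 k
  have hn : ‖ε • normal (a i₀)‖ ≤ 1 := by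
    rw [norm_smul, norm_normal, mul_one, Real.norm_of_nonneg (le_of_lt h0)]
    exact h1.le
  exact hbound k _ _ ((norm_sub_le _ _).trans (by linarith)) ((norm_add_le _ _).trans (by linarith))

/-- A Hölder condition at `t` bounds the jumps across the hyperplanes close to `t`. -/
lemma IsPointwiseHolder.exists_jump_le [Countable ι] (hν : IsAdmissible ν)
    (h : IsRegularSample ν (Measure.sum fun i => Measure.dirac (a i)))
    (hinj : Function.Injective (dist0 ∘ a)) {β : ℝ} (hβ : 0 < β) {t : Space d}
    (hf : IsPointwiseHolder (field ν (Measure.sum fun i => Measure.dirac (a i))) β t) :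
    ∃ C δ : ℝ, 0 < C ∧ 0 < δ ∧ ∀ (i : ι) (r : ℝ),
      |dist0 (a i) - inner ℝ (normal (a i)) t| < r → r < δ → |jump (a i)| ≤ C * r ^ β := by
  set f := field ν (Measure.sum fun i => Measure.dirac (a i)) with hf'
  obtain ⟨C, hC, Q, -, hQ⟩ := hf
  obtain ⟨δ, hδ, hball⟩ := Metric.eventually_nhds_iff.1 hQ
  refine ⟨2 * C, δ, by positivity, hδ, fun i r hir hrδ => ?_⟩
  set s := normal (a i) with hs
  have hs1 : ‖s‖ = 1 := norm_normal _
  -- `w` is the foot of the perpendicular from `t`. The strict inequality `‖w - t‖ < r` leaves room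
  -- for the generic point `u`.
  set w := t + (dist0 (a i) - inner ℝ s t : ℝ) • s with hw
  have hwt : ‖w - t‖ < r := by
    rw [hw, add_sub_cancel_left, norm_smul, hs1, mul_one]
    exact hir
  have hwi : (inner ℝ s w : ℝ) = dist0 (a i) := by
    rw [hw, inner_add_right, inner_smul_right, real_inner_self_eq_norm_sq, hs1]
    ring
  obtain ⟨u, huw, hui, hne⟩ := exists_generic_point hinj i hwi (sub_pos.2 hwt)
  have hut : ‖u - t‖ < r := by
    have : u - t = (u - w) + (w - t) := by abel
    rw [this]
    linarith [norm_add_le (u - w) (w - t)]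
  have hcontQ : Continuous fun x : Space d => MvPolynomial.eval (fun i => x i) Q :=
    (MvPolynomial.continuous_eval Q).comp (by fun_prop)
  have hlimQ : Tendsto (fun ε : ℝ => MvPolynomial.eval (fun j => (u + ε • s) j) Q -
      MvPolynomial.eval (fun j => (u - ε • s) j) Q) (𝓝[>] 0) (𝓝 0) := by
    have h1 : Continuous fun ε : ℝ => MvPolynomial.eval (fun j => (u + ε • s) j) Q -
        MvPolynomial.eval (fun j => (u - ε • s) j) Q :=
      (hcontQ.comp (f := fun ε : ℝ => u + ε • s) (by fun_prop)).sub
        (hcontQ.comp (f := fun ε : ℝ => u - ε • s) (by fun_prop))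
    have h2 := h1.tendsto 0
    simp only [zero_smul, add_zero, sub_zero, sub_self] at h2
    exact h2.mono_left nhdsWithin_le_nhds
  have hlim := (tendsto_field_sub hν h hui hne).sub hlimQ
  rw [sub_zero] at hlim
  refine le_of_tendsto hlim.abs ?_
  have hsmall : ∀ x : Space d, ‖x - t‖ < r →
      |f x - MvPolynomial.eval (fun j => x j) Q| ≤ C * r ^ β := fun x hx => by
    refine (hball (by rw [dist_eq_norm]; exact hx.trans hrδ)).trans ?_
    have := Real.rpow_le_rpow (norm_nonneg _) hx.le hβ.le
    gcongr
  filter_upwards [eventually_mem_nhdsWithin,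
    (gt_mem_nhds (sub_pos.2 hut)).filter_mono nhdsWithin_le_nhds] with ε h0 h1
  have hn : ‖ε • s‖ = ε := by
    rw [norm_smul, hs1, mul_one, Real.norm_of_nonneg (le_of_lt h0)]
  have h2 := hsmall (u + ε • s) (by
    rw [add_sub_right_comm]
    linarith [norm_add_le (u - t) (ε • s)])
  have h3 := hsmall (u - ε • s) (by
    rw [sub_right_comm]
    linarith [norm_sub_le (u - t) (ε • s)])
  have h4 : ∀ x y z v : ℝ, x - y - (z - v) = (x - z) - (y - v) := fun x y z v => by ring
  rw [h4]
  exact (abs_sub _ _).trans (by linarith)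

end Jumps

end Field

/-! ### The upper bound on the Hölder exponent. -/

section UpperBound

variable {d : ℕ} {ν : Measure (MarkSpace d)} {ι : Type*} {a : ι → AtomSpace d}

lemma exists_mem_of_mem_jumpSet {t : Space d}
    (ht : t ∈ jumpSet (Measure.sum fun i => Measure.dirac (a i))) :
    ∃ i, dist0 (a i) = inner ℝ (normal (a i)) t := by
  by_contra! hc
  have h1 : 1 ≤ (Measure.sum fun i => Measure.dirac (a i)) {p | dist0 p = inner ℝ (normal p) t} :=
    ht
  rw [sum_dirac_apply a (measurableSet_eq_fun measurable_dist0 (measurable_inner_normal t)),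
    show {i | a i ∈ {p | dist0 p = inner ℝ (normal p) t}} = ∅ from
      eq_empty_of_forall_notMem fun i hi => hc i hi] at h1
  simp at h1

lemma mem_jumpSet {t : Space d} {i : ι} (hi : dist0 (a i) = inner ℝ (normal (a i)) t) :
    t ∈ jumpSet (Measure.sum fun i => Measure.dirac (a i)) := by
  change 1 ≤ (Measure.sum fun i => Measure.dirac (a i)) {p | dist0 p = inner ℝ (normal p) t}
  rw [sum_dirac_apply a (measurableSet_eq_fun measurable_dist0 (measurable_inner_normal t))]
  have h : 1 ≤ {i | a i ∈ {p | dist0 p = inner ℝ (normal p) t}}.encard :=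
    one_le_encard_iff_nonempty.2 ⟨i, hi⟩
  exact_mod_cast h

lemma measure_approx_eq_encard (α : ℝ) (t : Space d) :
    (Measure.sum fun i => Measure.dirac (a i))
        {p | |jump p| ≤ 1 ∧ |dist0 p - inner ℝ (normal p) t| < |jump p| ^ (1 / α)} =
      {i | |jump (a i)| ≤ 1 ∧
        |dist0 (a i) - inner ℝ (normal (a i)) t| < |jump (a i)| ^ (1 / α)}.encard := by
  rw [sum_dirac_apply a]
  · rfl
  · exact (measurableSet_le measurable_jump.abs measurable_const).inter
      (measurableSet_lt (measurable_dist0.sub (measurable_inner_normal t)).abs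
        (measurable_jump.abs.pow_const _))

lemma mem_approxSet_iff {α : ℝ} {t : Space d} :
    t ∈ approxSet (Measure.sum fun i => Measure.dirac (a i)) α ↔
      {i | |jump (a i)| ≤ 1 ∧
        |dist0 (a i) - inner ℝ (normal (a i)) t| < |jump (a i)| ^ (1 / α)}.Infinite := by
  rw [← encard_eq_top_iff]
  change _ = ∞ ↔ _
  rw [measure_approx_eq_encard]
  exact ENat.toENNReal_eq_top

variable [Countable ι]

lemma holderExponent_eq_zero_of_mem_jumpSet (hν : IsAdmissible ν)
    (h : IsRegularSample ν (Measure.sum fun i => Measure.dirac (a i)))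
    (hinj : Function.Injective (dist0 ∘ a)) {t : Space d}
    (ht : t ∈ jumpSet (Measure.sum fun i => Measure.dirac (a i))) :
    holderExponent (field ν (Measure.sum fun i => Measure.dirac (a i))) t = 0 := by
  obtain ⟨i, hi⟩ := exists_mem_of_mem_jumpSet ht
  refine le_antisymm (iSup₂_le fun β ⟨hβ, hf⟩ => ?_) zero_le
  exfalso
  obtain ⟨C, δ, hC, hδ, hle⟩ := hf.exists_jump_le hν h hinj hβ
  have hlim : Tendsto (fun r : ℝ => C * r ^ β) (𝓝[>] 0) (𝓝 0) := by
    have h1 : Tendsto (fun r : ℝ => C * r ^ β) (𝓝 0) (𝓝 (C * 0 ^ β)) :=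
      ((Real.continuousAt_rpow_const 0 β (Or.inr hβ.le)).tendsto).const_mul C
    rw [Real.zero_rpow hβ.ne', mul_zero] at h1
    exact h1.mono_left nhdsWithin_le_nhds
  have h0 : |jump (a i)| ≤ 0 := by
    refine ge_of_tendsto hlim ?_
    filter_upwards [eventually_mem_nhdsWithin,
      (gt_mem_nhds hδ).filter_mono nhdsWithin_le_nhds] with r h1 h2
    refine hle i r ?_ h2
    rw [hi, sub_self, abs_zero]
    exact h1
  exact jump_ne_zero (a i) (abs_nonpos_iff.1 h0)

/-- With `r = |x|^{1/α}` the Hölder condition gives `|x| ≤ C |x|^{β/α}`. The infinitely many atoms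
provide arbitrarily small `|x|` by local finiteness, which excludes `β > α`. -/
lemma le_of_mem_approxSet (hν : IsAdmissible ν)
    (h : IsRegularSample ν (Measure.sum fun i => Measure.dirac (a i)))
    (hinj : Function.Injective (dist0 ∘ a)) {t : Space d} {α β : ℝ} (hα : 0 < α) (hβ : 0 < β)
    (ht : t ∈ approxSet (Measure.sum fun i => Measure.dirac (a i)) α)
    (hf : IsPointwiseHolder (field ν (Measure.sum fun i => Measure.dirac (a i))) β t) :
    β ≤ α := by
  by_contra! hαβ
  obtain ⟨C, δ, hC, hδ, hle⟩ := hf.exists_jump_le hν h hinj hβ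
  have hγ : 0 < β / α - 1 := by
    rw [sub_pos, lt_div_iff₀ hα]
    linarith
  have hev : ∀ᶠ x : ℝ in 𝓝 0, C * x ^ (β / α - 1) < 1 ∧ x ^ (1 / α) < δ := by
    have h1 : Tendsto (fun x : ℝ => C * x ^ (β / α - 1)) (𝓝 0) (𝓝 (C * 0 ^ (β / α - 1))) :=
      ((Real.continuousAt_rpow_const 0 _ (Or.inr hγ.le)).tendsto).const_mul C
    have h2 : Tendsto (fun x : ℝ => x ^ (1 / α)) (𝓝 0) (𝓝 (0 ^ (1 / α))) :=
      (Real.continuousAt_rpow_const 0 _ (Or.inr (by positivity))).tendsto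
    rw [Real.zero_rpow hγ.ne', mul_zero] at h1
    rw [Real.zero_rpow (by positivity)] at h2
    exact (h1.eventually (gt_mem_nhds zero_lt_one)).and (h2.eventually (gt_mem_nhds hδ))
  obtain ⟨ε, hε, hball⟩ := Metric.eventually_nhds_iff.1 hev
  have hfin := finite_large_atoms h.finite (‖t‖ + 1) (ε / 2) (by positivity)
  obtain ⟨i, ⟨hi1, hi2⟩, hi3⟩ := ((mem_approxSet_iff.1 ht).sdiff hfin).nonempty
  have hx : 0 < |jump (a i)| := abs_pos.2 (jump_ne_zero _)
  have hsmall : |jump (a i)| < ε := by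
    by_contra! hc
    refine hi3 ⟨?_, by linarith⟩
    have h1 := (abs_le.1 hi2.le).2
    have h2 := (le_abs_self _).trans (abs_inner_normal_le (a i) t)
    have h3 := Real.rpow_le_one hx.le hi1 (show 0 ≤ 1 / α by positivity)
    linarith
  obtain ⟨h1, h2⟩ := hball (y := |jump (a i)|) (by rwa [Real.dist_eq, sub_zero, abs_abs])
  have h3 := hle i _ hi2 h2
  rw [← Real.rpow_mul hx.le, one_div_mul_eq_div] at h3
  have h4 : C * |jump (a i)| ^ (β / α) = C * |jump (a i)| ^ (β / α - 1) * |jump (a i)| := by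
    rw [Real.rpow_sub_one hx.ne']
    field_simp
  rw [h4] at h3
  nlinarith

lemma holderExponent_le_approxRate (hν : IsAdmissible ν)
    (h : IsRegularSample ν (Measure.sum fun i => Measure.dirac (a i)))
    (hinj : Function.Injective (dist0 ∘ a)) (t : Space d) :
    holderExponent (field ν (Measure.sum fun i => Measure.dirac (a i))) t ≤
      approxRate (Measure.sum fun i => Measure.dirac (a i)) t :=
  iSup₂_le fun _ hβ => le_iInf₂ fun _ hα => ENNReal.ofReal_le_ofReal
    (le_of_mem_approxSet hν h hinj hα.1 hβ.1 hα.2 hβ.2)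

end UpperBound

/-! ### The lower bound on the Hölder exponent. -/

section LowerBound

variable {d : ℕ} {ν : Measure (MarkSpace d)} {ι : Type*} {a : ι → AtomSpace d}

/-- Off the jump hyperplanes and off `approxSet`, only small jumps separate nearby points. -/
lemma exists_radius_separated
    (hfin : ∀ R ε : ℝ, 0 < ε → (Measure.sum fun i => Measure.dirac (a i)) (largeAtoms d R ε) < ∞)
    {α : ℝ} (hα : 0 < α) {t : Space d}
    (hJ : t ∉ jumpSet (Measure.sum fun i => Measure.dirac (a i)))
    (hK : t ∉ approxSet (Measure.sum fun i => Measure.dirac (a i)) α) :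
    ∃ δ : ℝ, 0 < δ ∧ δ ≤ 1 ∧ ∀ u, ‖u - t‖ < δ → ∀ i,
      ‖u - t‖ ^ α < |jump (a i)| → (a i ∈ separating u ↔ a i ∈ separating t) := by
  -- The possible exceptions are finitely many, and none has its hyperplane through `t`; `δ` is
  -- taken below their distances. Any other atom separating `u` from `t` has `|x|^{1/α} ≤ ‖u - t‖`.
  set E : Set ι := {i | dist0 (a i) ≤ ‖t‖ + 1 ∧ 1 < |jump (a i)|} ∪ {i | |jump (a i)| ≤ 1 ∧
    |dist0 (a i) - inner ℝ (normal (a i)) t| < |jump (a i)| ^ (1 / α)} with hE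
  have hEfin : E.Finite :=
    (finite_large_atoms hfin _ 1 one_pos).union (not_infinite.1 fun h => hK (mem_approxSet_iff.2 h))
  have hev : ∀ᶠ δ : ℝ in 𝓝[>] 0, ∀ i ∈ E, δ < |dist0 (a i) - inner ℝ (normal (a i)) t| := by
    refine (Filter.eventually_all_finite hEfin).2 fun i _ => ?_
    exact (gt_mem_nhds (abs_pos.2 (sub_ne_zero.2 fun h => hJ (mem_jumpSet h)))).filter_mono
      nhdsWithin_le_nhds
  obtain ⟨δ, hδE, hδ0, hδ1⟩ := (hev.and ((eventually_mem_nhdsWithin (s := Ioi (0 : ℝ))).and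
    ((gt_mem_nhds (zero_lt_one' ℝ)).filter_mono nhdsWithin_le_nhds))).exists
  refine ⟨δ, hδ0, hδ1.le, fun u hu i hi => ?_⟩
  by_contra hsep
  have hmem : a i ∈ symmDiff (separating t) (separating u) := by
    rw [mem_symmDiff]
    tauto
  have h1 := (mem_symmDiff_separating hmem).1
  have hiE : i ∉ E := fun h => absurd (hδE i h) (not_lt.2 (h1.trans hu.le))
  have hR : dist0 (a i) ≤ ‖t‖ + 1 := by
    have h2 := (abs_le.1 h1).2
    have h3 := (le_abs_self _).trans (abs_inner_normal_le (a i) t)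
    linarith
  have hx1 : |jump (a i)| ≤ 1 := by
    by_contra! hc
    exact hiE (Or.inl ⟨hR, hc⟩)
  have h4 : |jump (a i)| ^ (1 / α) ≤ ‖u - t‖ := by
    by_contra! hc
    exact hiE (Or.inr ⟨hx1, h1.trans_lt hc⟩)
  have h5 := Real.rpow_le_rpow (by positivity) h4 hα.le
  rw [← Real.rpow_mul (abs_nonneg _), one_div_mul_cancel hα.ne', Real.rpow_one] at h5
  linarith

/-- The distance scale `2^{-(j + 1) / α}` of the jumps of the band `j + 1`. -/
def scale (α : ℝ) (j : ℕ) : ℝ := ((2 : ℝ)⁻¹ ^ (j + 1)) ^ (1 / α)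

lemma scale_pos (α : ℝ) (j : ℕ) : 0 < scale α j := by
  rw [scale]
  positivity

lemma scale_le_one {α : ℝ} (hα : 0 < α) (j : ℕ) : scale α j ≤ 1 :=
  Real.rpow_le_one (by positivity) (pow_le_one₀ (by norm_num) (by norm_num)) (by positivity)

lemma scale_rpow {α : ℝ} (hα : 0 < α) (j : ℕ) : scale α j ^ α = (2 : ℝ)⁻¹ ^ (j + 1) := by
  rw [scale, ← Real.rpow_mul (by positivity), one_div_mul_cancel hα.ne', Real.rpow_one]

lemma summable_scale {α γ : ℝ} (hα : 0 < α) (hγ : 0 < γ) :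
    Summable fun j : ℕ => ((j : ℝ) + 1) * scale α j ^ γ := by
  set q : ℝ := (2 : ℝ)⁻¹ ^ (γ / α) with hq
  have hq1 : ‖q‖ < 1 := by
    rw [Real.norm_of_nonneg (by positivity)]
    exact Real.rpow_lt_one (by norm_num) (by norm_num) (by positivity)
  have h : Summable fun j : ℕ => ((j + 1 : ℕ) : ℝ) ^ 1 * q ^ (j + 1) :=
    (summable_nat_add_iff (f := fun j : ℕ => (j : ℝ) ^ 1 * q ^ j) 1).2
      (summable_pow_mul_geometric_of_norm_lt_one 1 hq1)
  have hscale : ∀ j : ℕ, scale α j ^ γ = q ^ (j + 1) := fun j => by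
    have h2 : (0 : ℝ) ≤ 2⁻¹ := by norm_num
    rw [scale, ← Real.rpow_mul (by positivity), one_div_mul_eq_div, hq,
      Real.rpow_pow_comm h2]
  refine h.congr fun j => ?_
  rw [pow_one, hscale, Nat.cast_add, Nat.cast_one]

lemma rpow_mul_div_rpow {z r : ℝ} (hz : 0 < z) (hr : 0 ≤ r) (α β : ℝ) :
    z ^ α * (r / z) ^ β = r ^ β * z ^ (α - β) := by
  rw [Real.div_rpow hr hz.le, Real.rpow_sub hz]
  ring

/-- Bounds for `z ≤ r` in terms of the Hölder modulus. -/
lemma rpow_le_of_scale_le {z r α β γ : ℝ} (hz : 0 < z) (hzr : z ≤ r) (hγ : γ ≤ β) :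
    z ^ α * (r / z) ^ γ ≤ r ^ β * z ^ (α - β) := by
  rw [← rpow_mul_div_rpow hz (hz.le.trans hzr)]
  exact mul_le_mul_of_nonneg_left
    (Real.rpow_le_rpow_of_exponent_le ((one_le_div hz).2 hzr) hγ) (by positivity)

lemma rpow_le_of_le_scale {z r α β : ℝ} (hz : 0 < z) (hr : 0 < r) (hrz : r ≤ z) (hβ : β ≤ 1) :
    z ^ α * (r / z) ≤ r ^ β * z ^ (α - β) := by
  rw [← rpow_mul_div_rpow hz hr.le]
  refine mul_le_mul_of_nonneg_left ?_ (by positivity)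
  have := Real.rpow_le_rpow_of_exponent_ge (div_pos hr hz) ((div_le_one hz).2 hrz) hβ
  rwa [Real.rpow_one] at this

variable (ν a) in
/-- Local information at a point where the jumps are well separated. -/
structure IsLocallyControlled (α : ℝ) (t : Space d) (δ C : ℝ) : Prop where
  delta_pos : 0 < δ
  delta_le_one : δ ≤ 1
  const_nonneg : 0 ≤ C
  layer_zero : ∀ u, ‖u - t‖ < δ →
    layer ν (Measure.sum fun i => Measure.dirac (a i)) 0 u =
      layer ν (Measure.sum fun i => Measure.dirac (a i)) 0 t
  layer_succ_of_le : ∀ u, ‖u - t‖ < δ → ∀ j, ‖u - t‖ ≤ scale α j →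
    layer ν (Measure.sum fun i => Measure.dirac (a i)) (j + 1) u -
      layer ν (Measure.sum fun i => Measure.dirac (a i)) (j + 1) t =
      -inner ℝ (drift ν (j + 1)) (u - t)
  increment_le : ∀ u, ‖u - t‖ < δ → ∀ j,
    |layer ν (Measure.sum fun i => Measure.dirac (a i)) (j + 1) u -
      layer ν (Measure.sum fun i => Measure.dirac (a i)) (j + 1) t| ≤
      C * (scale α j ^ α * (√(((j : ℝ) + 1) * bandReal ν (j + 1) * ‖u - t‖) + (j + 1)))

lemma exists_isLocallyControlled (hν : IsAdmissible ν)
    (h : IsRegularSample ν (Measure.sum fun i => Measure.dirac (a i)))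
    {α : ℝ} (hα : 0 < α) {t : Space d}
    (hJ : t ∉ jumpSet (Measure.sum fun i => Measure.dirac (a i)))
    (hK : t ∉ approxSet (Measure.sum fun i => Measure.dirac (a i)) α) :
    ∃ δ C, IsLocallyControlled ν a α t δ C := by
  obtain ⟨δ, hδ0, hδ1, hsep⟩ := exists_radius_separated h.finite hα hJ hK
  obtain ⟨R, hR⟩ := exists_nat_ge (‖t‖ + 1)
  obtain ⟨C, hC⟩ := h.increment R
  have hC0 : 0 ≤ C := by
    have h1 := (abs_nonneg _).trans (hC 0 0 0 (by simp) (by simp))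
    simpa using h1
  refine ⟨δ, 2 * C, hδ0, hδ1, by positivity, fun u hu => ?_, fun u hu j hj => ?_,
    fun u hu j => ?_⟩
  · have h1 := layer_sub_of_not_separated hν h.finite (k := 0) (t := t) (u := u) fun i hi =>
      hsep u hu i ((Real.rpow_le_one (norm_nonneg _) (hu.le.trans hδ1) hα.le).trans_lt hi)
    rw [slope, inner_zero_left, neg_zero] at h1
    exact sub_eq_zero.1 h1
  · refine layer_sub_of_not_separated hν h.finite (k := j + 1) fun i hi => hsep u hu i ?_
    refine lt_of_le_of_lt ?_ (mem_band_succ.1 hi).1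
    rw [← scale_rpow hα]
    exact Real.rpow_le_rpow (norm_nonneg _) hj hα.le
  · have hu' : ‖u‖ ≤ R := by
      have h1 := norm_le_insert' u t
      linarith
    refine (hC j t u (by linarith) hu').trans_eq ?_
    rw [scale_rpow hα, pow_succ]
    ring

variable {α β : ℝ} {t : Space d} {δ C : ℝ}

lemma abs_inner_drift_le (hν : IsAdmissible ν) (hα : 0 < α) (j : ℕ) (u : Space d) :
    |(inner ℝ (drift ν (j + 1)) u : ℝ)| ≤ 2 * (scale α j ^ α * (bandReal ν (j + 1) * ‖u‖)) := by
  refine (abs_real_inner_le_norm _ _).trans ?_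
  have h1 := mul_le_mul_of_nonneg_right (hν.norm_drift_le j) (norm_nonneg u)
  refine h1.trans_eq ?_
  rw [scale_rpow hα, pow_succ]
  ring

/-- Termwise bound for small exponents. -/
lemma IsLocallyControlled.termwise_small (hν : IsAdmissible ν)
    (h : IsLocallyControlled ν a α t δ C) (hα : 0 < α) (hα' : α ≤ 1 / 2) (hβ : 0 ≤ β)
    (hβα : β ≤ α)
    {B : ℝ} (hB : ∀ j : ℕ, (2 : ℝ)⁻¹ ^ (j + 1) * √(((j : ℝ) + 1) * bandReal ν (j + 1)) ≤ B)
    {u : Space d} (hu : ‖u - t‖ < δ) (hut : 0 < ‖u - t‖) (j : ℕ) :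
    |layer ν (Measure.sum fun i => Measure.dirac (a i)) (j + 1) u -
      layer ν (Measure.sum fun i => Measure.dirac (a i)) (j + 1) t| ≤ ‖u - t‖ ^ β *
      ((C + 2 * B) * ((2 : ℝ)⁻¹ ^ (j + 1) * √(((j : ℝ) + 1) * bandReal ν (j + 1))) +
        C * ((j + 1) * scale α j ^ (α - β))) := by
  set r := ‖u - t‖ with hr
  set z := scale α j with hz
  set l : ℝ := (j : ℝ) + 1 with hl
  set y : ℝ := (2 : ℝ)⁻¹ ^ (j + 1) with hy
  set m := bandReal ν (j + 1) with hm
  have hm0 : 0 ≤ m := bandReal_nonneg _ _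
  have hl0 : 1 ≤ l := by
    rw [hl]
    linarith [Nat.cast_nonneg (α := ℝ) j]
  have hy0 : 0 < y := by positivity
  have hz0 : 0 < z := scale_pos α j
  have hzy : z ^ α = y := scale_rpow hα j
  have hC := h.const_nonneg
  have hr1 : r ≤ 1 := hu.le.trans h.delta_le_one
  have hsqrt : √r ≤ r ^ β := by
    rw [Real.sqrt_eq_rpow]
    exact Real.rpow_le_rpow_of_exponent_ge hut hr1 (hβα.trans hα')
  have hB0 : 0 ≤ B := le_trans (by positivity) (hB j)
  rcases le_or_gt r z with hrz | hzr
  -- Coarse band: only the compensator varies. Since `α ≤ 1/2`, one factor `√r` is at most `y`, and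
  -- `y √(l m) ≤ B` absorbs one factor `√(l m)` of `l m`.
  · have hry : √r ≤ y := by
      rw [Real.sqrt_eq_rpow, ← hzy]
      refine (Real.rpow_le_rpow_of_exponent_ge hut hr1 hα').trans ?_
      exact Real.rpow_le_rpow hut.le hrz hα.le
    have h1 := abs_inner_drift_le hν hα j (u - t)
    rw [h.layer_succ_of_le u hu j hrz, abs_neg]
    refine h1.trans ?_
    rw [← hz, hzy, ← hm, ← hr]
    have h2 : m * r ≤ √(l * m) * √(l * m) * (√r * √r) := by
      rw [Real.mul_self_sqrt (by positivity), Real.mul_self_sqrt hut.le]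
      have : m ≤ l * m := le_mul_of_one_le_left hm0 hl0
      gcongr
    have h3 : √(l * m) * √(l * m) * (√r * √r) ≤ √(l * m) * B * r ^ β := by
      have h4 : √(l * m) * √r ≤ B := by
        refine le_trans ?_ (hB j)
        rw [mul_comm]
        gcongr
      calc √(l * m) * √(l * m) * (√r * √r) = √(l * m) * (√(l * m) * √r) * √r := by ring
        _ ≤ √(l * m) * B * r ^ β := by gcongr
    calc 2 * (y * (m * r)) ≤ 2 * (y * (√(l * m) * B * r ^ β)) := by
          have := h2.trans h3
          gcongr
      _ = r ^ β * (2 * B * (y * √(l * m))) := by ring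
      _ ≤ _ := by
          have h5 : 0 ≤ C * (y * √(l * m)) := by positivity
          have h6 : 0 ≤ C * (l * z ^ (α - β)) := by positivity
          refine mul_le_mul_of_nonneg_left ?_ (by positivity)
          linarith
  -- Fine band: the increment bound, where `√r ≤ r^β` because `β ≤ 1/2`.
  · have hA : z ^ α ≤ r ^ β * z ^ (α - β) := by
      have := rpow_le_of_scale_le (α := α) hz0 hzr.le hβ
      rwa [Real.rpow_zero, mul_one] at this
    refine (h.increment_le u hu j).trans ?_
    rw [Real.sqrt_mul (by positivity), ← hr, ← hz, hzy]
    calc C * (y * (√(l * m) * √r + l)) = C * (y * √(l * m) * √r) + C * (l * y) := by ring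
      _ ≤ C * (y * √(l * m) * r ^ β) + C * (l * (r ^ β * z ^ (α - β))) := by
          rw [hzy] at hA
          gcongr
      _ = r ^ β * (C * (y * √(l * m)) + C * (l * z ^ (α - β))) := by ring
      _ ≤ _ := by
          have h5 : 0 ≤ B * (y * √(l * m)) := by positivity
          refine mul_le_mul_of_nonneg_left ?_ (by positivity)
          linarith

/-- Termwise bound for large exponents. -/
lemma IsLocallyControlled.termwise_large (hν : IsAdmissible ν)
    (h : IsLocallyControlled ν a α t δ C) (hα : 0 < α) (hβ : 1 / 2 ≤ β)
    {B : ℝ} (hB0 : 0 ≤ B) (hB : ∀ j : ℕ, bandReal ν (j + 1) ≤ B * ((j + 1) * (scale α j)⁻¹))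
    {u : Space d} (hu : ‖u - t‖ < δ) (hut : 0 < ‖u - t‖) (j : ℕ) :
    |layer ν (Measure.sum fun i => Measure.dirac (a i)) (j + 1) u -
      layer ν (Measure.sum fun i => Measure.dirac (a i)) (j + 1) t +
      inner ℝ (if β ≤ 1 then 0 else drift ν (j + 1)) (u - t)| ≤ ‖u - t‖ ^ β *
      ((C * (√B + 1) + 2 * B) * ((j + 1) * scale α j ^ (α - β))) := by
  set r := ‖u - t‖ with hr
  set z := scale α j with hz
  set l : ℝ := (j : ℝ) + 1 with hl
  set m := bandReal ν (j + 1) with hm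
  have hm0 : 0 ≤ m := bandReal_nonneg _ _
  have hl0 : 1 ≤ l := by
    rw [hl]
    linarith [Nat.cast_nonneg (α := ℝ) j]
  have hz0 : 0 < z := scale_pos α j
  have hC := h.const_nonneg
  have hmr : m * r ≤ B * (l * (r / z)) := by
    refine (mul_le_mul_of_nonneg_right (hB j) hut.le).trans_eq ?_
    rw [div_eq_mul_inv]
    ring
  have hG : 0 ≤ r ^ β * z ^ (α - β) := by positivity
  have hdrift := abs_inner_drift_le hν hα j (u - t)
  rw [← hz, ← hm, ← hr] at hdrift
  have hdrift' : 2 * (z ^ α * (m * r)) ≤ 2 * B * (l * (z ^ α * (r / z))) := by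
    have : z ^ α * (m * r) ≤ z ^ α * (B * (l * (r / z))) := by gcongr
    linarith
  -- Fine bands: `m r ≤ B l (r / z)`, and `√(r / z) ≤ (r / z)^β` since `r / z ≥ 1` and `β ≥ 1/2`.
  have hinc : z ≤ r → |layer ν (Measure.sum fun i => Measure.dirac (a i)) (j + 1) u -
      layer ν (Measure.sum fun i => Measure.dirac (a i)) (j + 1) t| ≤
      C * (√B + 1) * (l * (r ^ β * z ^ (α - β))) := fun hzr => by
    have h0 : z ^ α ≤ r ^ β * z ^ (α - β) := by
      have := rpow_le_of_scale_le (α := α) hz0 hzr (show 0 ≤ β by linarith)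
      rwa [Real.rpow_zero, mul_one] at this
    have h1 : z ^ α * √(r / z) ≤ r ^ β * z ^ (α - β) := by
      rw [Real.sqrt_eq_rpow]
      exact rpow_le_of_scale_le hz0 hzr hβ
    have h2 : √(l * m * r) ≤ √B * (l * √(r / z)) := by
      rw [← Real.sqrt_sq (show 0 ≤ l by linarith), ← Real.sqrt_mul (by positivity),
        ← Real.sqrt_mul hB0, Real.sqrt_sq (show 0 ≤ l by linarith)]
      refine Real.sqrt_le_sqrt ?_
      calc l * m * r = l * (m * r) := by ring
        _ ≤ l * (B * (l * (r / z))) := by gcongr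
        _ = _ := by ring
    refine (h.increment_le u hu j).trans ?_
    rw [← hr, ← hz]
    calc C * (z ^ α * (√(l * m * r) + l)) ≤ C * (z ^ α * (√B * (l * √(r / z)) + l)) := by gcongr
      _ = C * (√B * (l * (z ^ α * √(r / z))) + l * z ^ α) := by ring
      _ ≤ C * (√B * (l * (r ^ β * z ^ (α - β))) + l * (r ^ β * z ^ (α - β))) := by gcongr
      _ = _ := by ring
  have hfirst : 0 ≤ C * (√B + 1) * (l * (r ^ β * z ^ (α - β))) := by positivity
  have hsecond : 0 ≤ 2 * B * (l * (r ^ β * z ^ (α - β))) := by positivity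
  rw [show r ^ β * ((C * (√B + 1) + 2 * B) * (l * z ^ (α - β))) =
    C * (√B + 1) * (l * (r ^ β * z ^ (α - β))) + 2 * B * (l * (r ^ β * z ^ (α - β))) by ring]
  -- For `β ≤ 1` the compensator of a coarse band is itself small, since `r / z ≤ (r / z)^β`. For `β
  -- > 1` it has to be subtracted: coarse bands then contribute nothing, and fine ones gain a term
  -- `r / z ≤ (r / z)^β`.
  by_cases hβ1 : β ≤ 1
  · rw [if_pos hβ1, inner_zero_left, add_zero]
    rcases le_or_gt r z with hrz | hzr
    · rw [h.layer_succ_of_le u hu j hrz, abs_neg]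
      have h1 := rpow_le_of_le_scale (α := α) hz0 hut hrz hβ1
      have h2 : 2 * B * (l * (z ^ α * (r / z))) ≤ 2 * B * (l * (r ^ β * z ^ (α - β))) := by gcongr
      linarith
    · linarith [hinc hzr.le]
  · rw [if_neg hβ1]
    rcases le_or_gt r z with hrz | hzr
    · rw [h.layer_succ_of_le u hu j hrz, neg_add_cancel, abs_zero]
      linarith
    · have h1 : z ^ α * (r / z) ≤ r ^ β * z ^ (α - β) := by
        have := rpow_le_of_scale_le (α := α) hz0 hzr.le (not_le.1 hβ1).le
        rwa [Real.rpow_one] at this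
      have h2 : 2 * B * (l * (z ^ α * (r / z))) ≤ 2 * B * (l * (r ^ β * z ^ (α - β))) := by gcongr
      refine (abs_add_le _ _).trans ?_
      linarith [hinc hzr.le]

/-- The degree must drop to `0` when `v = 0`, because `IsPointwiseHolder` requires a degree strictly
below `β`, which may be at most `1`. -/
lemma exists_polynomial (b : ℝ) (v : Space d) (t : Space d) :
    ∃ Q : MvPolynomial (Fin d) ℝ, Q.totalDegree ≤ (if v = 0 then 0 else 1) ∧
      ∀ u : Space d, MvPolynomial.eval (fun i => u i) Q = b - inner ℝ v (u - t) := by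
  by_cases hv : v = 0
  · exact ⟨MvPolynomial.C b, by simp, fun u => by simp [hv]⟩
  · refine ⟨MvPolynomial.C (b + inner ℝ v t) - ∑ i, MvPolynomial.C (v i) * MvPolynomial.X i, ?_,
      fun u => ?_⟩
    · rw [if_neg hv]
      refine (MvPolynomial.totalDegree_sub _ _).trans (max_le
        ((MvPolynomial.totalDegree_C _).trans_le zero_le_one) ?_)
      refine (MvPolynomial.totalDegree_finsetSum _ _).trans (Finset.sup_le fun i _ => ?_)
      refine (MvPolynomial.totalDegree_mul _ _).trans ?_
      simp
    · have h : (inner ℝ v u : ℝ) = ∑ i, v i * u i := by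
        rw [PiLp.inner_apply]
        exact Finset.sum_congr rfl fun i _ => mul_comm _ _
      simp only [map_sub, map_sum, map_mul, MvPolynomial.eval_C, MvPolynomial.eval_X]
      rw [inner_sub_right, h]
      ring

/-- Termwise bounds on the increments of the layers yield a Hölder condition. -/
lemma isPointwiseHolder_of_termwise (hν : IsAdmissible ν) {n : Measure (AtomSpace d)}
    (h : IsRegularSample ν n) {β δ : ℝ} {t : Space d} (hβ : 0 < β) (hδ : 0 < δ)
    {c : ℕ → Space d} (hc : Summable c) (hc1 : β ≤ 1 → ∀ k, c k = 0) {g : ℕ → ℝ} (hg : Summable g)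
    (hle : ∀ u, ‖u - t‖ < δ → 0 < ‖u - t‖ → ∀ k,
      |layer ν n k u - layer ν n k t + inner ℝ (c k) (u - t)| ≤ ‖u - t‖ ^ β * g k) :
    IsPointwiseHolder (field ν n) β t := by
  obtain ⟨Q, hQdeg, hQ⟩ := exists_polynomial (field ν n t) (∑' k, c k) t
  refine ⟨|∑' k, g k| + 1, by positivity, Q, ?_, ?_⟩
  · have h1 : (Q.totalDegree : ℝ) ≤ ((if ∑' k, c k = 0 then 0 else 1 : ℕ) : ℝ) := by
      exact_mod_cast hQdeg
    refine h1.trans_lt ?_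
    split_ifs with h0
    · simpa using hβ
    · rw [Nat.cast_one]
      by_contra! hβ1
      exact h0 (by simp [hc1 hβ1])
  · filter_upwards [Metric.ball_mem_nhds t hδ] with u hu
    rw [mem_ball_iff_norm] at hu
    rcases (norm_nonneg (u - t)).eq_or_lt' with h0 | h0
    · rw [norm_eq_zero, sub_eq_zero] at h0
      subst h0
      rw [hQ, sub_self, inner_zero_right, sub_zero, sub_self, abs_zero]
      positivity
    · have hsumL : Summable fun k => layer ν n k u - layer ν n k t :=
        (summable_layer hν h u).sub (summable_layer hν h t)
      have hsumI : HasSum (fun k => (inner ℝ (c k) (u - t) : ℝ)) (inner ℝ (∑' k, c k) (u - t)) := by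
        have := (innerSL ℝ (u - t)).hasSum hc.hasSum
        simpa only [innerSL_apply_apply, real_inner_comm (u - t)] using this
      have e : field ν n u - (field ν n t - inner ℝ (∑' k, c k) (u - t)) =
          ∑' k, (layer ν n k u - layer ν n k t + inner ℝ (c k) (u - t)) := by
        rw [hsumL.tsum_add hsumI.summable, hsumI.tsum_eq, ← field_sub_eq_tsum hν h]
        ring
      rw [hQ, e, ← Real.norm_eq_abs]
      refine (tsum_of_norm_bounded (hg.mul_left (‖u - t‖ ^ β)).hasSum (hle u hu h0)).trans ?_
      rw [tsum_mul_left, mul_comm]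
      refine mul_le_mul_of_nonneg_right ?_ (by positivity)
      linarith [le_abs_self (∑' k, g k)]

lemma summable_of_succ {E : Type*} [NormedAddCommGroup E] {f : ℕ → E} {g : ℕ → E}
    (hg : Summable g) (h : ∀ j, f (j + 1) = g j) : Summable f := by
  rw [← summable_nat_add_iff 1]
  exact hg.congr fun j => (h j).symm

lemma isPointwiseHolder_small (hν : IsAdmissible ν)
    (h : IsRegularSample ν (Measure.sum fun i => Measure.dirac (a i)))
    {α β : ℝ} (hβ : 0 < β) (hβα : β < α) (hα : α ≤ 1 / 2) {t : Space d}
    (hJ : t ∉ jumpSet (Measure.sum fun i => Measure.dirac (a i)))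
    (hK : t ∉ approxSet (Measure.sum fun i => Measure.dirac (a i)) α) :
    IsPointwiseHolder (field ν (Measure.sum fun i => Measure.dirac (a i))) β t := by
  have hα0 : 0 < α := hβ.trans hβα
  obtain ⟨δ, C, hloc⟩ := exists_isLocallyControlled hν h hα0 hJ hK
  obtain ⟨B, hB⟩ := hν.summable_chi.tendsto_atTop_zero.bddAbove_range
  set g : ℕ → ℝ := fun j =>
    (C + 2 * B) * ((2 : ℝ)⁻¹ ^ (j + 1) * √(((j : ℝ) + 1) * bandReal ν (j + 1))) +
      C * ((j + 1) * scale α j ^ (α - β)) with hg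
  have hgs : Summable g := (hν.summable_chi.mul_left _).add
    ((summable_scale hα0 (sub_pos.2 hβα)).mul_left _)
  refine isPointwiseHolder_of_termwise hν h hβ hloc.delta_pos (c := fun _ => 0) summable_zero
    (fun _ _ => rfl) (g := fun k => Nat.casesOn k 0 g)
    (summable_of_succ hgs fun j => rfl) fun u hu hu0 k => ?_
  rw [inner_zero_left, add_zero]
  cases k with
  | zero =>
    rw [hloc.layer_zero u hu, sub_self, abs_zero]
    exact (mul_zero _).ge
  | succ j =>
    exact hloc.termwise_small hν hα0 hα hβ.le hβα.le (fun j => hB ⟨j, rfl⟩) hu hu0 j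

lemma isPointwiseHolder_large (hν : IsAdmissible ν)
    (h : IsRegularSample ν (Measure.sum fun i => Measure.dirac (a i)))
    {α : ℚ} {β : ℝ} (hβ : 1 / 2 ≤ β) (hβα : β < α) {t : Space d}
    (hJ : t ∉ jumpSet (Measure.sum fun i => Measure.dirac (a i)))
    (hK : t ∉ approxSet (Measure.sum fun i => Measure.dirac (a i)) α) :
    IsPointwiseHolder (field ν (Measure.sum fun i => Measure.dirac (a i))) β t := by
  have hα0 : (0 : ℝ) < α := by linarith
  obtain ⟨δ, C, hloc⟩ := exists_isLocallyControlled hν h hα0 hJ hK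
  obtain ⟨B, hB⟩ := h.covering α (by linarith) t hK
  replace hB : ∀ j : ℕ, bandReal ν (j + 1) ≤ |B| * ((j + 1) * (scale α j)⁻¹) := fun j => by
    refine (hB j).trans ?_
    rw [Real.rpow_neg (by positivity), ← scale]
    have := scale_pos α j
    gcongr
    exact le_abs_self B
  have hscale := summable_scale hα0 (sub_pos.2 hβα)
  set g : ℕ → ℝ := fun j =>
    (C * (√|B| + 1) + 2 * |B|) * ((j + 1) * scale α j ^ (α - β)) with hg
  have hgs : Summable g := hscale.mul_left _
  set c : ℕ → Space d := fun j => if β ≤ 1 then 0 else drift ν (j + 1) with hc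
  have hcs : Summable c := by
    by_cases hβ1 : β ≤ 1
    · simp only [hc, if_pos hβ1]
      exact summable_zero
    · simp only [hc, if_neg hβ1]
      -- By the covering bound the slopes are `O((j + 1) z^{α - 1})` with `z = scale α j ≤ 1`, hence
      -- summable since here `α > β > 1`.
      refine Summable.of_norm_bounded (hscale.mul_left (2 * |B|)) fun j => ?_
      have hz := scale_pos α j
      calc ‖drift ν (j + 1)‖ ≤ (2 : ℝ)⁻¹ ^ j * bandReal ν (j + 1) := hν.norm_drift_le j
        _ = 2 * (scale α j ^ (α : ℝ) * bandReal ν (j + 1)) := by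
            rw [scale_rpow hα0, pow_succ]
            ring
        _ ≤ 2 * (scale α j ^ (α : ℝ) * (|B| * ((j + 1) * (scale α j)⁻¹))) := by
            gcongr
            exact hB j
        _ = 2 * |B| * ((j + 1) * scale α j ^ ((α : ℝ) - 1)) := by
            rw [Real.rpow_sub_one hz.ne']
            ring
        _ ≤ 2 * |B| * ((j + 1) * scale α j ^ (α - β)) := by
            have := Real.rpow_le_rpow_of_exponent_ge hz (scale_le_one hα0 j)
              (show (α : ℝ) - β ≤ α - 1 by linarith)
            gcongr
  refine isPointwiseHolder_of_termwise hν h (by linarith) hloc.delta_pos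
    (c := fun k => Nat.casesOn k 0 c) (summable_of_succ hcs fun j => rfl) ?_
    (g := fun k => Nat.casesOn k 0 g)
    (summable_of_succ hgs fun j => rfl) fun u hu hu0 k => ?_
  · intro hβ1 k
    cases k with
    | zero => rfl
    | succ j => exact if_pos hβ1
  · cases k with
    | zero =>
      rw [hloc.layer_zero u hu, sub_self]
      change |0 + inner ℝ (0 : Space d) (u - t)| ≤ _ * (0 : ℝ)
      rw [inner_zero_left, add_zero, abs_zero, mul_zero]
    | succ j => exact hloc.termwise_large hν hα0 hβ (abs_nonneg B) hB hu hu0 j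

lemma notMem_approxSet_of_lt {n : Measure (AtomSpace d)} {t : Space d} {α : ℝ} (hα : 0 < α)
    (h : ENNReal.ofReal α < approxRate n t) : t ∉ approxSet n α := fun hK =>
  h.not_ge (iInf₂_le α ⟨hα, hK⟩)

/-- Every `β` below the rate admits an `α > β` with `t ∉ K_ν(α)`. If `β < 1/2`, `α` can be kept at
most `1/2`. Otherwise `α` is taken rational, since the covering bound holds almost surely for
countably many exponents at once. -/
lemma approxRate_le_holderExponent (hν : IsAdmissible ν)
    (h : IsRegularSample ν (Measure.sum fun i => Measure.dirac (a i))) {t : Space d}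
    (hJ : t ∉ jumpSet (Measure.sum fun i => Measure.dirac (a i))) :
    approxRate (Measure.sum fun i => Measure.dirac (a i)) t ≤
      holderExponent (field ν (Measure.sum fun i => Measure.dirac (a i))) t := by
  refine le_of_forall_lt fun b hb => ?_
  obtain ⟨β, -, hbβ, hβA⟩ := ENNReal.lt_iff_exists_real_btwn.1 hb
  have hβ : 0 < β := ENNReal.ofReal_pos.1 (bot_le.trans_lt hbβ)
  obtain ⟨γ, -, hβγ, hγA⟩ := ENNReal.lt_iff_exists_real_btwn.1 hβA
  have hγ : 0 < γ := ENNReal.ofReal_pos.1 (bot_le.trans_lt hβγ)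
  rw [ENNReal.ofReal_lt_ofReal_iff hγ] at hβγ
  have hnot : ∀ α : ℝ, 0 < α → α ≤ γ →
      t ∉ approxSet (Measure.sum fun i => Measure.dirac (a i)) α := fun α h0 h1 =>
    notMem_approxSet_of_lt h0 ((ENNReal.ofReal_le_ofReal h1).trans_lt hγA)
  have hf : IsPointwiseHolder (field ν (Measure.sum fun i => Measure.dirac (a i))) β t := by
    rcases lt_or_ge β (1 / 2) with h2 | h2
    · have h3 : β < min γ (1 / 2) := lt_min hβγ h2
      exact isPointwiseHolder_small hν h hβ h3 (min_le_right _ _) hJ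
        (hnot _ (hβ.trans h3) (min_le_left _ _))
    · obtain ⟨α, hβα, hαγ⟩ := exists_rat_btwn hβγ
      exact isPointwiseHolder_large hν h h2 hβα hJ (hnot α (hβ.trans hβα) hαγ.le)
  exact hbβ.trans_le (le_iSup₂_of_le β ⟨hβ, hf⟩ le_rfl)

end LowerBound

end LevyField

end

theorem mainTheorem7 {d : ℕ} {Ω : Type*} [MeasurableSpace Ω] (P : Measure Ω)
    [IsProbabilityMeasure P] (ν : Measure (LevyField.MarkSpace d))
    (hν : LevyField.IsAdmissible ν) (N : Ω → Measure (LevyField.AtomSpace d))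
    (hN : LevyField.IsPoissonRandomMeasure P (LevyField.intensity ν) N) :
    ∀ᵐ ω ∂P,
      (∀ t : LevyField.Space d,
        Tendsto (fun k => LevyField.partialField ν (N ω) k t) atTop
          (𝓝 (LevyField.field ν (N ω) t))) ∧
      LevyField.IsLocallyBounded (LevyField.field ν (N ω)) ∧
      ∀ t : LevyField.Space d,
        (t ∈ LevyField.jumpSet (N ω) →
          LevyField.holderExponent (LevyField.field ν (N ω)) t = 0) ∧
        (t ∉ LevyField.jumpSet (N ω) →
          LevyField.holderExponent (LevyField.field ν (N ω)) t =
            LevyField.approxRate (N ω) t) := by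
  filter_upwards [LevyField.ae_isRegularSample hν hN] with ω h
  obtain ⟨I, a, ha, hinj⟩ := h.atoms
  rw [ha] at h ⊢
  refine ⟨fun t => ?_, LevyField.isLocallyBounded_field hν h, fun t => ⟨fun ht => ?_, fun ht => ?_⟩⟩
  · rw [LevyField.field_eq_tsum hν h]
    exact LevyField.tendsto_partialField hν h t
  · exact LevyField.holderExponent_eq_zero_of_mem_jumpSet hν h hinj ht
  · exact le_antisymm (LevyField.holderExponent_le_approxRate hν h hinj t)
      (LevyField.approxRate_le_holderExponent hν h ht)
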